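/- **Theorem 3.6.** Let $q=p^e$ with $p$ prime and $e$ even, let $\xi$ generate $\mathbb F_q^*$, let $n>1$ with $\gcd(n,q)=1$, let $\lambda\in\mathbb F_q^*$ have order $r$, and let $m$ be the order of $q$ in $\mathbb Z_{rn}^*$. Let $\omega$ be a primitive element of $\mathbb F_{q^m}$ with $\lambda=\omega^{(q^m-1)/r}$ and put $\zeta=\omega^{(q^m-1)/(rn)}$. Let $\mathcal R=\mathbb F_q[x]/\langle x^n-\lambda\rangle$; the weight of an element of $\mathcal R$ is the number of nonzero coefficients of its representative of degree less than $n$. For $c\in \mathbb Z_{rn}^*\cap(1+r\mathbb Z_{rn})$ let $\mu_c(\sum_i f_ix^i)=\sum_i f_ix^{ci}$, and let $\rho(f)=xf$ and $\sigma_\xi(f)=\xi f$; these are $\mathbb F_q$-linear automorphisms of $\mathcal R$. For an integer $a_t$ let $\Gamma_t=\{(1+ra_t)q^i : i\ge 0\}\subseteq\mathbb Z_{rn}$ be the $q$-cyclotomic coset of $1+ra_t$, let $k=|\Gamma_t|$, and let $\varepsilon_t\in\mathcal R$ be the corresponding primitive idempotent, $\varepsilon_t=\sum_{j\in\Gamma_t}e_j$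 with $e_j=\frac1n\sum_{l=0}^{n-1}\zeta^{-jl}x^l$. Let $l_0\in\{0,1\}$ be such that $b=(-1)^{l_0}p^{e/2}\in\mathbb Z_{rn}^*\cap(1+r\mathbb Z_{rn})$, and suppose $b^{-1}(1+ra_t)\notin\Gamma_t$. Let $b'$ be any integer representing $b^{-1}=(-1)^{l_0}p^{-e/2}$ modulo $rn$. Then the sum $$\mathcal C_{l_0}=\mathcal R\varepsilon_t\oplus\mu_b(\mathcal R\varepsilon_t)$$ is direct, $\langle\mu_b,\rho,\sigma_\xi\rangle$ maps $\mathcal C_{l_0}$ to itself, and: 1. The number of $\langle\mu_b,\rho,\sigma_\xi\rangle$-orbits on $\mathcal C_{l_0}\setminus\{0\}$ equals $$\frac1k\sum_{h\mid k}\varphi\Big(\frac kh\Big)\gcd\Big(q^h-1,\frac{q^k-1}{q-1},\frac{(1+ra_t)(q^k-1)}{rn}\Big)$$ $$+\frac1{2m}\sum_{h=0}^{m-1}\Bigg(\gcd\Big(q^{\gcd(k,2h+1)}-1,\frac{2(q^k-1)}{q-1},\frac{(b'+q^h)(1+ra_t)(q^k-1)}{rn}\Big)$$ $$+\gcd\Big((q^{\gcd(k,h)}-1)\gcd\Big(q^{\gcd(k,h)}-1,\frac{q^k-1}{q-1},\frac{(1+ra_t)(q^k-1)}{rn}\Big),\frac{(b'-1)(1+ra_t)(q^k-1)^2}{rn(q-1)}\Big)\Bigg),$$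 where $\gcd(k,0)=k$. 2. The number of nonzero weights of $\mathcal C_{l_0}$ is at most this number of orbits, with equality if and only if for any two nonzero codewords $c_1,c_2\in\mathcal C_{l_0}$ of the same weight there are integers $0\le j_1\le 2m-1$, $0\le j_2\le n-1$, $0\le j_3\le q-2$ with $\mu_b^{j_1}\rho^{j_2}(\xi^{j_3}c_1)=c_2$. 3. One has $q\in\mathbb Z_{rn}^*\cap(1+r\mathbb Z_{rn})$ and $\langle\mu_q,\rho,\sigma_\xi\rangle\le\langle\mu_b,\rho,\sigma_\xi\rangle$, and the number of $\langle\mu_b,\rho,\sigma_\xi\rangle$-orbits on $\mathcal C_{l_0}\setminus\{0\}$ is strictly smaller than the number of $\langle\mu_q,\rho,\sigma_\xi\rangle$-orbits on $\mathcal C_{l_0}\setminus\{0\}$. For every integer $a'$ with $1+ra'\equiv b^{-1}(1+ra_t)\pmod{rn}$ the latter number equals $$\frac1k\sum_{h\mid k}\varphi\Big(\frac kh\Big)\Bigg(\gcd\Big(q^h-1,\frac{q^k-1}{q-1},x_1\Big)+\gcd\Big(q^h-1,\frac{q^k-1}{q-1},x_2\Big)$$ $$+\gcd\Big((q^h-1)\gcd\Big(q^h-1,\frac{q^k-1}{q-1},x_1,x_2\Big),\frac{(a'-a_t)(q^k-1)^2}{n(q-1)}\Big)\Bigg),$$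 where $x_1=\frac{(1+ra_t)(q^k-1)}{rn}$ and $x_2=\frac{(1+ra')(q^k-1)}{rn}$. -/

import Mathlib

open Polynomial

/-- The quotient ring `F[x]/⟨xⁿ - λ⟩`, for `λ` a nonzero element of the field `F`. -/
abbrev ConstacyclicRing {F : Type*} [Field F] (lam : Fˣ) (n : ℕ) : Type _ :=
  AdjoinRoot (X ^ n - C (lam : F))

namespace ConstacyclicRing

section OneField

variable {F : Type*} [Field F] (lam : Fˣ) (n : ℕ)

/-- The class of `x` in `F[x]/⟨xⁿ - λ⟩`. -/
noncomputable abbrev x : ConstacyclicRing lam n := AdjoinRoot.root (X ^ n - C (lam : F))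

theorem x_pow_n : x lam n ^ n = algebraMap F (ConstacyclicRing lam n) (lam : F) := by
  have h := AdjoinRoot.mk_self (f := (X ^ n - C (lam : F)))
  rw [map_sub, map_pow, AdjoinRoot.mk_X, AdjoinRoot.mk_C, sub_eq_zero] at h
  exact h

theorem x_pow_modulus : x lam n ^ (orderOf lam * n) = 1 := by
  rw [mul_comm, pow_mul, x_pow_n, ← map_pow, ← Units.val_pow_eq_pow_val, pow_orderOf_eq_one]
  simp

theorem x_pow_eq_of_cast_eq {i j : ℕ}
    (h : (i : ZMod (orderOf lam * n)) = (j : ZMod (orderOf lam * n))) :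
    x lam n ^ i = x lam n ^ j := by
  rw [ZMod.natCast_eq_natCast_iff] at h
  rw [pow_eq_pow_mod i (x_pow_modulus lam n), pow_eq_pow_mod j (x_pow_modulus lam n), h]

/-- The group `ℤ_{rn}^* ∩ (1 + r ℤ_{rn})`, where `r` is the order of `λ`. -/
def multiplierGroup : Subgroup (ZMod (orderOf lam * n))ˣ where
  carrier := {a | ∃ i : ZMod (orderOf lam * n),
    (a : ZMod (orderOf lam * n)) = 1 + (orderOf lam : ZMod (orderOf lam * n)) * i}
  one_mem' := ⟨0, by simp⟩
  mul_mem' := by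
    rintro a b ⟨i, hi⟩ ⟨j, hj⟩
    exact ⟨i + j + (orderOf lam : ZMod (orderOf lam * n)) * i * j, by
      rw [Units.val_mul, hi, hj]; ring⟩
  inv_mem' := by
    rintro a ⟨i, hi⟩
    refine ⟨-((a⁻¹ : (ZMod (orderOf lam * n))ˣ) : ZMod (orderOf lam * n)) * i, ?_⟩
    have h := a.inv_mul
    rw [hi] at h
    linear_combination h

variable [Finite F] [NeZero n]

instance neZero_modulus : NeZero (orderOf lam * n) :=
  ⟨Nat.mul_ne_zero (orderOf_pos lam).ne' (NeZero.ne n)⟩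

/-- The representative in `{0, …, rn - 1}` of an element of `ℤ_{rn}^* ∩ (1 + r ℤ_{rn})`. -/
noncomputable def rep (a : multiplierGroup lam n) : ℕ :=
  ((a : (ZMod (orderOf lam * n))ˣ) : ZMod (orderOf lam * n)).val

theorem cast_rep (a : multiplierGroup lam n) :
    (rep lam n a : ZMod (orderOf lam * n)) = (a : (ZMod (orderOf lam * n))ˣ) := by
  simp [rep]

theorem lam_pow_rep (a : multiplierGroup lam n) : lam ^ rep lam n a = lam := by
  obtain ⟨i, hi⟩ := a.2
  have h := congrArg (ZMod.castHom (dvd_mul_right (orderOf lam) n) (ZMod (orderOf lam)))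
    ((cast_rep lam n a).trans hi)
  rw [map_add, map_one, map_mul, map_natCast, map_natCast, ZMod.natCast_self, zero_mul,
    add_zero, ← Nat.cast_one, ZMod.natCast_eq_natCast_iff] at h
  conv_rhs => rw [← pow_one lam]
  exact pow_eq_pow_iff_modEq.mpr h

theorem eval_x_pow_rep (a : multiplierGroup lam n) :
    eval₂ (Algebra.ofId F (ConstacyclicRing lam n) : F →+* ConstacyclicRing lam n)
      (x lam n ^ rep lam n a) (X ^ n - C (lam : F)) = 0 := by
  rw [eval₂_sub, eval₂_pow, eval₂_X, eval₂_C, ← pow_mul, mul_comm, pow_mul, x_pow_n, ← map_pow,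
    ← Units.val_pow_eq_pow_val, lam_pow_rep]
  exact sub_self _

/-- The multiplier `μ_a` as an `F`-algebra endomorphism: `∑ f_i xⁱ ↦ ∑ f_i x^{a i}`. -/
noncomputable def multiplierHom (a : multiplierGroup lam n) :
    ConstacyclicRing lam n →ₐ[F] ConstacyclicRing lam n :=
  AdjoinRoot.liftAlgHom _ (Algebra.ofId F _) (x lam n ^ rep lam n a) (eval_x_pow_rep lam n a)

theorem multiplierHom_x (a : multiplierGroup lam n) :
    multiplierHom lam n a (x lam n) = x lam n ^ rep lam n a :=
  AdjoinRoot.liftAlgHom_root ..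

theorem multiplierHom_comp (a b : multiplierGroup lam n) (hab : a * b = 1) :
    (multiplierHom lam n a).comp (multiplierHom lam n b) = AlgHom.id F _ := by
  refine AdjoinRoot.algHom_ext ?_
  rw [AlgHom.comp_apply, multiplierHom_x, map_pow, multiplierHom_x, ← pow_mul, AlgHom.id_apply]
  conv_rhs => rw [← pow_one (AdjoinRoot.root _)]
  apply x_pow_eq_of_cast_eq
  rw [Nat.cast_mul, cast_rep, cast_rep, ← Units.val_mul, ← Subgroup.coe_mul, hab]
  simp

/-- The multiplier `μ_a : ∑ f_i xⁱ ↦ ∑ f_i x^{a i}`, an automorphism of the `F`-vector space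
`F[x]/⟨xⁿ - λ⟩`, for `a ∈ ℤ_{rn}^* ∩ (1 + r ℤ_{rn})`. -/
noncomputable def multiplier (a : multiplierGroup lam n) :
    ConstacyclicRing lam n ≃ₗ[F] ConstacyclicRing lam n :=
  (AlgEquiv.ofAlgHom (multiplierHom lam n a) (multiplierHom lam n a⁻¹)
    (multiplierHom_comp lam n a a⁻¹ (mul_inv_cancel a))
    (multiplierHom_comp lam n a⁻¹ a (inv_mul_cancel a))).toLinearEquiv

/-- The `λ`-constacyclic shift `ρ : f ↦ x f`. -/
noncomputable def shift : ConstacyclicRing lam n ≃ₗ[F] ConstacyclicRing lam n :=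
  DistribMulAction.toLinearEquiv F (ConstacyclicRing lam n)
    (Units.ofPowEqOne (x lam n) (orderOf lam * n) (x_pow_modulus lam n) (NeZero.ne _))

/-- The scalar multiplication `σ_ξ : f ↦ ξ f`. -/
noncomputable def scalar (ξ : Fˣ) : ConstacyclicRing lam n ≃ₗ[F] ConstacyclicRing lam n :=
  DistribMulAction.toLinearEquiv F (ConstacyclicRing lam n) ξ

/-- The group `⟨μ_a, ρ, σ_ξ⟩` of automorphisms of the `F`-vector space `F[x]/⟨xⁿ - λ⟩`. -/
noncomputable def autGroup (a : multiplierGroup lam n) (ξ : Fˣ) :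
    Subgroup (ConstacyclicRing lam n ≃ₗ[F] ConstacyclicRing lam n) :=
  Subgroup.closure {multiplier lam n a, shift lam n, scalar lam n ξ}

end OneField

section Codes

variable {F : Type*} [Field F] {lam : Fˣ} {n : ℕ}

/-- The Hamming weight of `∑_{i<n} f_i xⁱ`: the number of nonzero coefficients of the
representative of degree less than `n`. -/
noncomputable def weight [NeZero n] (c : ConstacyclicRing lam n) : ℕ :=
  (AdjoinRoot.modByMonicHom (monic_X_pow_sub_C (lam : F) (NeZero.ne n)) c).support.card

/-- The number of nonzero weights of a linear code `𝓒`. -/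
noncomputable def numWeights [NeZero n] (𝓒 : Submodule F (ConstacyclicRing lam n)) : ℕ :=
  (weight '' {c | c ∈ 𝓒 ∧ c ≠ 0}).ncard

/-- The number of `G`-orbits of nonzero elements of `𝓒` (where `G` preserves `𝓒`). -/
noncomputable def numOrbits (G : Subgroup (ConstacyclicRing lam n ≃ₗ[F] ConstacyclicRing lam n))
    (𝓒 : Submodule F (ConstacyclicRing lam n)) : ℕ :=
  ((fun c => MulAction.orbit G c) '' {c | c ∈ 𝓒 ∧ c ≠ 0}).ncard

end Codes

/-- The `q`-cyclotomic coset `{j, jq, jq², …}` modulo `N` (for `q` a unit modulo `N`). -/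
noncomputable def cyclotomicCoset (q : ℕ) {N : ℕ} (j : ZMod N) : Finset (ZMod N) :=
  (Finset.range (orderOf (q : ZMod N))).image fun i => j * (q : ZMod N) ^ i

theorem sum_cyclotomicCoset_mul {q N : ℕ} [NeZero N] (hq : q.Coprime N) (j : ZMod N)
    {M : Type*} [AddCommMonoid M] (f : ZMod N → M) :
    ∑ i ∈ cyclotomicCoset q j, f (i * q) = ∑ i ∈ cyclotomicCoset q j, f i := by
  have hu : IsUnit (q : ZMod N) := (ZMod.isUnit_iff_coprime q N).mpr hq
  have hpos : 0 < orderOf (q : ZMod N) := by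
    obtain ⟨u, hu⟩ := hu
    rw [← hu, orderOf_units]
    exact orderOf_pos u
  have hinj : Function.Injective fun i : ZMod N => i * (q : ZMod N) := hu.mul_left_injective
  have himg : (cyclotomicCoset q j).image (fun i => i * (q : ZMod N)) = cyclotomicCoset q j := by
    apply Finset.eq_of_subset_of_card_le
    · intro y hy
      simp only [cyclotomicCoset, Finset.mem_image, Finset.mem_range] at hy ⊢
      obtain ⟨_, ⟨i, -, rfl⟩, rfl⟩ := hy
      exact ⟨(i + 1) % orderOf (q : ZMod N), Nat.mod_lt _ hpos, by
        rw [pow_mod_orderOf, pow_succ, mul_assoc]⟩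
    · rw [Finset.card_image_of_injective _ hinj]
  conv_rhs => rw [← himg]
  rw [Finset.sum_image fun _ _ _ _ h => hinj h]

/-- The greatest common divisor of three integers. -/
def gcd₃ (u v w : ℤ) : ℕ := Int.gcd (Int.gcd u v) w

section TwoFields

variable {F : Type*} [Field F] (lam : Fˣ) (n : ℕ) {K : Type*} [Field K] [Algebra F K]

variable (K) in
/-- The inclusion `F[x]/⟨xⁿ - λ⟩ → K[x]/⟨xⁿ - λ⟩` for a field extension `K / F`. -/
noncomputable def extendScalars :
    ConstacyclicRing lam n →+*
      ConstacyclicRing (Units.map (algebraMap F K : F →* K) lam) n :=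
  AdjoinRoot.map (algebraMap F K) (X ^ n - C (lam : F))
    (X ^ n - C ((Units.map (algebraMap F K : F →* K) lam : Kˣ) : K)) (by simp)

variable (K) in
theorem extendScalars_mk (f : F[X]) :
    extendScalars lam n K (AdjoinRoot.mk _ f) = AdjoinRoot.mk _ (f.map (algebraMap F K)) := by
  have h : (extendScalars lam n K).comp (AdjoinRoot.mk _) =
      (AdjoinRoot.mk _).comp (mapRingHom (algebraMap F K)) := by
    refine ringHom_ext (fun b => ?_) ?_
    · simp only [RingHom.comp_apply, coe_mapRingHom, map_C, AdjoinRoot.mk_C]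
      exact AdjoinRoot.map_of ..
    · simp only [RingHom.comp_apply, coe_mapRingHom, map_X, AdjoinRoot.mk_X]
      exact AdjoinRoot.map_root ..
  exact congrArg (fun g => g f) h

variable (K) in
theorem extendScalars_injective : Function.Injective (extendScalars lam n K) := by
  rw [injective_iff_map_eq_zero]
  intro f hf
  obtain ⟨f, rfl⟩ := AdjoinRoot.mk_surjective f
  rw [extendScalars_mk, AdjoinRoot.mk_eq_zero] at hf
  rw [AdjoinRoot.mk_eq_zero]
  rw [← map_dvd_map' (algebraMap F K)]
  simpa using hf

/-- The primitive idempotent `e_j = (1/n) ∑_{l<n} ζ^{-jl} x^l` of `K[x]/⟨xⁿ - λ⟩`, where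
`ζ ∈ K` is a primitive `rn`-th root of unity with `ζⁿ = λ`. -/
noncomputable def splitIdempotent (ζ : K) (j : ZMod (orderOf lam * n)) :
    ConstacyclicRing (Units.map (algebraMap F K : F →* K) lam) n :=
  (n : K)⁻¹ • ∑ l ∈ Finset.range n, (ζ ^ (j.val * l))⁻¹ • x _ n ^ l

/-- The primitive idempotent `ε = ∑_{i ∈ Γ} e_i` of `F[x]/⟨xⁿ - λ⟩` that corresponds to the
`q`-cyclotomic coset `Γ` of `j`, where `F` has `q` elements: the element of `F[x]/⟨xⁿ - λ⟩`
whose image in `K[x]/⟨xⁿ - λ⟩` is this sum. -/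
noncomputable def primitiveIdempotent [Fintype F] (ζ : K) (j : ZMod (orderOf lam * n)) :
    ConstacyclicRing lam n :=
  Function.invFun (extendScalars lam n K)
    (∑ i ∈ cyclotomicCoset (Fintype.card F) j, splitIdempotent lam n ζ i)

theorem mem_range_of_pow_card_eq [Fintype F] {c : K} (hc : c ^ Fintype.card F = c) :
    ∃ a : F, algebraMap F K a = c := by
  have h : (∏ a : F, (X - C a)) = (X ^ Fintype.card F - X : F[X]) := by
    have hr := FiniteField.roots_X_pow_card_sub_X F
    have hd := FiniteField.X_pow_card_sub_X_natDegree_eq F (Fintype.one_lt_card (α := F))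
    have h := prod_multiset_X_sub_C_of_monic_of_roots_card_eq
      (p := (X ^ Fintype.card F - X : F[X]))
      (monic_X_pow_sub (by rw [degree_X]; exact_mod_cast Fintype.one_lt_card (α := F)))
      (by rw [hr, hd]; rfl)
    rw [hr] at h
    exact h
  have h2 := congrArg (aeval c) h
  simp only [map_prod, map_sub, aeval_X, aeval_C, map_pow, hc, sub_self] at h2
  obtain ⟨a, -, ha⟩ := Finset.prod_eq_zero_iff.mp h2
  exact ⟨a, (sub_eq_zero.mp ha).symm⟩

theorem extendScalars_primitiveIdempotent [Fintype F] [NeZero n]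
    (hn : n.Coprime (Fintype.card F)) {ζ : K} (hζ : ζ ^ (orderOf lam * n) = 1)
    (j : ZMod (orderOf lam * n)) :
    extendScalars lam n K (primitiveIdempotent lam n ζ j) =
      ∑ i ∈ cyclotomicCoset (Fintype.card F) j, splitIdempotent lam n ζ i := by
  refine Function.invFun_eq ?_
  have hN : (Fintype.card F).Coprime (orderOf lam * n) := by
    refine Nat.Coprime.mul_right ?_ hn.symm
    have h1 : orderOf lam ∣ Fintype.card F - 1 := by
      classical
      rw [← Fintype.card_units]
      exact orderOf_dvd_card
    refine Nat.Coprime.coprime_dvd_right h1 ?_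
    exact (Nat.coprime_self_sub_right Fintype.one_lt_card.le).mpr (Nat.coprime_one_right _)
  have hc : ∀ l : ℕ, ∃ a : F, algebraMap F K a =
      ∑ i ∈ cyclotomicCoset (Fintype.card F) j, (ζ ^ (i.val * l))⁻¹ := by
    intro l
    apply mem_range_of_pow_card_eq
    have h1 : ∀ y : K, y ^ Fintype.card F = FiniteField.frobeniusAlgHom F K y := fun _ => rfl
    rw [h1, map_sum]
    conv_rhs => rw [← sum_cyclotomicCoset_mul hN]
    refine Finset.sum_congr rfl fun i _ => ?_
    rw [← h1, inv_pow, ← pow_mul]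
    congr 1
    rw [pow_eq_pow_mod _ hζ, pow_eq_pow_mod ((i * _ : ZMod _).val * l) hζ]
    congr 1
    rw [← ZMod.natCast_eq_natCast_iff']
    simp only [Nat.cast_mul, ZMod.natCast_val, ZMod.cast_id', id_eq]
    ring
  choose a ha using hc
  refine ⟨(n : F)⁻¹ • ∑ l ∈ Finset.range n, a l • x lam n ^ l, ?_⟩
  have hx : extendScalars lam n K (x lam n) = x _ n := AdjoinRoot.map_root ..
  have hs : ∀ (b : F) (y : ConstacyclicRing lam n),
      extendScalars lam n K (b • y) = algebraMap F K b • extendScalars lam n K y := by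
    intro b y
    rw [Algebra.smul_def, Algebra.smul_def, map_mul]
    exact congrArg (· * _) (AdjoinRoot.map_of ..)
  rw [hs, map_sum, map_inv₀, map_natCast]
  simp only [hs, map_pow, hx, ha, splitIdempotent, Finset.sum_smul]
  rw [← Finset.smul_sum, Finset.sum_comm]

end TwoFields

end ConstacyclicRing

/-! ### Burnside counting for one endomorphism, and its transfer to orbits of a generated group. -/

section OrbitCounting

/-! Put θ = ζ^(1+ra) and θ' = θ^(1/b). The ideal of the primitive idempotent consists of the
elements vanishing at every root of xⁿ - λ that is not conjugate to θ, and the hypothesis on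
b⁻¹(1+ra) says that θ' is not conjugate to θ. Evaluation at θ and θ' therefore identifies the code
with L × L, where L is the field with q^k elements inside K. In these coordinates ρ multiplies by
(θ, θ'), σ_ξ multiplies both entries by ξ, and, because b² = q, μ_b is (u, v) ↦ (v^q, u), while μ_q
= μ_b² is the Frobenius on both entries. `PairModel` records the coordinates and the actions of ρ
and σ_ξ, and `IsCodePair.pairModel` produces it.

Choose a generator g of L^*, of order N = q^k - 1, and put s = N/(q-1), θ = g^x₁, θ' = g^x₂. On
pairs with two nonzero entries, logarithms turn ρ and σ_ξ into translations, so their orbits are the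
classes of ℤ² modulo the lattice Λ generated by (N,0), (0,N), (x₁,x₂), (s,s). On ℤ²/Λ the multiplier
acts through a linear map T, which is (y,z) ↦ (qz,y) for μ_b and multiplication by q for μ_q. By
Burnside's lemma the number of orbits is the average of the numbers of fixed points of the powers of
T. Each such number is the size of the kernel of T^i - 1, hence of its cokernel, hence the index of
Λ + (T^i - 1)ℤ², and these indices are the gcds of the formulas (`pairLattice_index`,
`slopeLattice_index`). Pairs with one zero entry give the analogous count in rank one, where μ_b
glues the two axes together.

For the weights, all three generators are monomial maps, so the weight is constant on orbits. For
the strict inequality, ⟨μ_q, ρ, σ_ξ⟩ preserves the ideal A, whereas μ_b moves a nonzero element of A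
into μ_b A, which meets A only in 0. Two distinct orbits of the smaller group are thereby merged. -/

theorem card_quotient_iterate_mul {Q : Type*} [Finite Q] (f : Q → Q) (M : ℕ) (hM : 0 < M)
    (hf : ∀ x, f^[M] x = x) :
    ∃ s : Setoid Q, (∀ x y, s x y ↔ ∃ i : ℕ, f^[i] x = y) ∧
      Nat.card (Quotient s) * M = ∑ i ∈ Finset.range M, Nat.card {x // f^[i] x = x} := by
  classical
  have : NeZero M := ⟨hM.ne'⟩
  have hmod : ∀ (i : ℕ) (x : Q), f^[i % M] x = f^[i] x := by
    intro i x
    have h : ∀ j, f^[M * j] x = x := by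
      intro j
      rw [Function.iterate_mul]
      exact Function.iterate_fixed (hf x) j
    conv_rhs => rw [← Nat.mod_add_div i M, Function.iterate_add_apply, h]
  -- As f^[M] is the identity, the iterates of f form an action of ℤ/M, and Burnside's lemma applies
  -- to it. The action need not be faithful, so M may be any multiple of the order of f.
  let _ : MulAction (Multiplicative (ZMod M)) Q :=
    { smul := fun a x => f^[(Multiplicative.toAdd a).val] x
      one_smul := fun x => by
        change f^[(0 : ZMod M).val] x = x
        simp
      mul_smul := fun a b x => by
        change f^[(Multiplicative.toAdd a + Multiplicative.toAdd b).val] x =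
          f^[(Multiplicative.toAdd a).val] (f^[(Multiplicative.toAdd b).val] x)
        rw [ZMod.val_add, hmod, Function.iterate_add_apply] }
  have hsmul : ∀ (a : ZMod M) (x : Q), Multiplicative.ofAdd a • x = f^[a.val] x := fun _ _ => rfl
  refine ⟨MulAction.orbitRel (Multiplicative (ZMod M)) Q, fun x y => ?_, ?_⟩
  · rw [Setoid.comm', MulAction.orbitRel_apply]
    constructor
    · rintro ⟨a, rfl⟩
      exact ⟨_, rfl⟩
    · rintro ⟨i, rfl⟩
      refine ⟨Multiplicative.ofAdd (i : ZMod M), ?_⟩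
      change f^[(i : ZMod M).val] x = _
      rw [ZMod.val_natCast, hmod]
  · let _ := Fintype.ofFinite Q
    have h := MulAction.sum_card_fixedBy_eq_card_orbits_mul_card_group
      (Multiplicative (ZMod M)) Q
    rw [Fintype.card_multiplicative, ZMod.card] at h
    rw [Nat.card_eq_fintype_card]
    refine Eq.trans ?_ (h.symm.trans ?_)
    · rfl
    · refine Finset.sum_bij (fun a _ => (Multiplicative.toAdd a).val) ?_ ?_ ?_ ?_
      · intro a _
        exact Finset.mem_range.mpr (ZMod.val_lt _)
      · intro a _ b _ hab
        exact Multiplicative.toAdd.injective (ZMod.val_injective M hab)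
      · intro i hi
        exact ⟨Multiplicative.ofAdd (i : ZMod M), Finset.mem_univ _,
          ZMod.val_cast_of_lt (Finset.mem_range.mp hi)⟩
      · intro a _
        rw [← Nat.card_eq_fintype_card]
        rfl

/-- Both sides are the quotient of |A| by the size of the range. -/
theorem card_ker_eq_index_range {A : Type*} [AddCommGroup A] [Finite A] (f : A →+ A) :
    Nat.card f.ker = f.range.index := by
  have h1 := f.ker.card_mul_index
  have h2 := f.range.card_mul_index
  rw [AddSubgroup.index_ker, mul_comm, ← h2] at h1
  exact Nat.eq_of_mul_eq_mul_left Nat.card_pos h1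

/-- The fixed points of T^i on V/Λ form the kernel of T^i - 1, which has as many elements as its
cokernel. The subgroup `I i` is the preimage in V of the image of T^i - 1, so Burnside's sum becomes
a sum of indices in V. -/
theorem exists_orbit_classes {V : Type*} [AddCommGroup V] (Λ : AddSubgroup V) [Λ.FiniteIndex]
    (T : AddMonoid.End V) (hT : ∀ v ∈ Λ, T v ∈ Λ) (M : ℕ) (hM : 0 < M)
    (hTM : ∀ v, (T ^ M) v - v ∈ Λ) (I : ℕ → AddSubgroup V)
    (hI : ∀ i v, v ∈ I i ↔ ∃ w, v - ((T ^ i) w - w) ∈ Λ) :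
    ∃ s : Setoid V, (∀ v w, s v w ↔ ∃ i : ℕ, (T ^ i) v - w ∈ Λ) ∧ Finite (Quotient s) ∧
      Nat.card (Quotient s) * M = ∑ i ∈ Finset.range M, (I i).index := by
  have : Finite (V ⧸ Λ) := AddSubgroup.finite_quotient_of_finiteIndex
  let f : AddMonoid.End (V ⧸ Λ) := QuotientAddGroup.map Λ Λ T hT
  have hf : ∀ (i : ℕ) (v : V), f^[i] (v : V ⧸ Λ) = (((T ^ i) v : V) : V ⧸ Λ) := by
    intro i v
    induction i with
    | zero => simp
    | succ i ih =>
      rw [Function.iterate_succ_apply', ih, pow_succ']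
      rfl
  obtain ⟨s, hs, hcard⟩ := card_quotient_iterate_mul f M hM (by
    intro x
    obtain ⟨v, rfl⟩ := QuotientAddGroup.mk_surjective x
    rw [hf, ← sub_eq_zero, ← QuotientAddGroup.mk_sub]
    exact (QuotientAddGroup.eq_zero_iff _).mpr (hTM v))
  let cl : V → Quotient s := fun v => Quotient.mk s (v : V ⧸ Λ)
  have hcl : Function.Surjective cl := by
    intro x
    obtain ⟨y, rfl⟩ := Quotient.exists_rep x
    obtain ⟨v, rfl⟩ := QuotientAddGroup.mk_surjective y
    exact ⟨v, rfl⟩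
  have e : Quotient (Setoid.ker cl) ≃ Quotient s := Setoid.quotientKerEquivOfSurjective cl hcl
  refine ⟨Setoid.ker cl, fun v w => ?_, Finite.of_equiv _ e.symm, ?_⟩
  · rw [Setoid.ker_def]
    change Quotient.mk s _ = Quotient.mk s _ ↔ _
    rw [Quotient.eq, hs]
    refine exists_congr fun i => ?_
    rw [hf, ← sub_eq_zero, ← QuotientAddGroup.mk_sub, QuotientAddGroup.eq_zero_iff]
  · rw [Nat.card_congr e, hcard]
    refine Finset.sum_congr rfl fun i _ => ?_
    let fi : V ⧸ Λ →+ V ⧸ Λ := (f ^ i - 1 : AddMonoid.End (V ⧸ Λ))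
    have hfi' : ∀ x, fi x = f^[i] x - x := by
      intro x
      change (f ^ i) x - x = _
      rw [AddMonoid.End.coe_pow]
    have h1 : Nat.card {x // f^[i] x = x} = Nat.card fi.ker := by
      refine Nat.card_congr (Equiv.subtypeEquivRight fun x => ?_)
      rw [AddMonoidHom.mem_ker, hfi', sub_eq_zero]
    rw [h1, card_ker_eq_index_range,
      ← AddSubgroup.index_comap_of_surjective _ (QuotientAddGroup.mk'_surjective Λ)]
    congr 1
    ext v
    rw [hI, AddSubgroup.mem_comap, AddMonoidHom.mem_range]
    constructor
    · rintro ⟨x, hx⟩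
      obtain ⟨w, rfl⟩ := QuotientAddGroup.mk_surjective x
      refine ⟨w, ?_⟩
      rw [hfi', hf, ← QuotientAddGroup.mk_sub] at hx
      rw [← QuotientAddGroup.eq_zero_iff, QuotientAddGroup.mk_sub, hx, sub_eq_zero]
      rfl
    · rintro ⟨w, hw⟩
      refine ⟨w, ?_⟩
      rw [hfi', hf, ← QuotientAddGroup.mk_sub]
      rw [← QuotientAddGroup.eq_zero_iff, QuotientAddGroup.mk_sub, sub_eq_zero] at hw
      exact hw.symm

/-- In a finite group the subgroup generated by S is the submonoid generated by S, so it suffices to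
follow each generator forwards. The parametrization π may have repetitions as long as they stay
inside one class. -/
theorem ncard_orbit_image_eq {G X Y : Type*} [Group G] [Finite G] [MulAction G X] (S : Set G)
    (π : Y → X) (s : Setoid Y) [Finite (Quotient s)]
    (hgen : ∀ a ∈ S, ∀ y, ∃ y', a • π y = π y' ∧ s y y')
    (horb : ∀ y y', s y y' → π y' ∈ MulAction.orbit (Subgroup.closure S) (π y))
    (hinj : ∀ y y', π y = π y' → s y y') :
    ((fun c => MulAction.orbit (Subgroup.closure S) c) '' Set.range π).ncard =
      Nat.card (Quotient s) := by
  have hmem : ∀ a ∈ Subgroup.closure S, ∀ y, ∃ y', a • π y = π y' ∧ s y y' := by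
    intro a ha
    rw [← Subgroup.mem_toSubmonoid, Subgroup.closure_toSubmonoid_of_finite] at ha
    induction ha using Submonoid.closure_induction with
    | mem a ha => exact hgen a ha
    | one => exact fun y => ⟨y, one_smul _ _, s.refl y⟩
    | mul a b _ _ iha ihb =>
      intro y
      obtain ⟨y₁, h₁, r₁⟩ := ihb y
      obtain ⟨y₂, h₂, r₂⟩ := iha y₁
      exact ⟨y₂, by rw [mul_smul, h₁, h₂], s.trans r₁ r₂⟩
  have key : ∀ y y', MulAction.orbit (Subgroup.closure S) (π y) =
      MulAction.orbit (Subgroup.closure S) (π y') ↔ s y y' := by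
    intro y y'
    constructor
    · intro h
      have h' : π y' ∈ MulAction.orbit (Subgroup.closure S) (π y) := by
        rw [h]; exact MulAction.mem_orbit_self _
      obtain ⟨⟨a, ha⟩, hay⟩ := h'
      obtain ⟨z, hz, hs⟩ := hmem a ha y
      exact s.trans hs (hinj _ _ (hz.symm.trans hay))
    · intro h
      exact (MulAction.orbit_eq_iff.mpr (horb y y' h)).symm
  rw [← Set.range_comp, ← Nat.card_coe_set_eq]
  refine Nat.card_congr (Equiv.symm (Equiv.ofBijective
    (Quotient.lift (fun y => (⟨_, y, rfl⟩ : Set.range ((fun c =>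
      MulAction.orbit (Subgroup.closure S) c) ∘ π))) ?_) ⟨?_, ?_⟩))
  · intro y y' h
    exact Subtype.ext ((key y y').mpr h)
  · intro x x'
    induction x using Quotient.inductionOn
    induction x' using Quotient.inductionOn
    intro h
    exact Quotient.sound ((key _ _).mp (Subtype.ext_iff.mp h))
  · rintro ⟨_, y, rfl⟩
    exact ⟨Quotient.mk s y, rfl⟩

/-- Counting the orbits of `⟨S⟩` on the image of `π`, when modulo the subgroup `Λ` the group acts
on the labels `lab y` of the points `π y` through the powers of `T`. -/
theorem ncard_orbit_image_mul {G X Y V : Type*} [Group G] [Finite G] [MulAction G X]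
    [AddCommGroup V] (S : Set G) (π : Y → X) (lab : Y → V) (hlab : Function.Surjective lab)
    (Λ : AddSubgroup V) [Λ.FiniteIndex]
    (T : AddMonoid.End V) (hT : ∀ v ∈ Λ, T v ∈ Λ) (M : ℕ) (hM : 0 < M)
    (hTM : ∀ v, (T ^ M) v - v ∈ Λ) (I : ℕ → AddSubgroup V)
    (hI : ∀ i v, v ∈ I i ↔ ∃ w, v - ((T ^ i) w - w) ∈ Λ)
    (hgen : ∀ a ∈ S, ∀ y, ∃ y', a • π y = π y' ∧
      (lab y' - lab y ∈ Λ ∨ lab y' - T (lab y) ∈ Λ))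
    (horb : ∀ y y', lab y' - lab y ∈ Λ → π y' ∈ MulAction.orbit (Subgroup.closure S) (π y))
    (horbT : ∀ y, ∃ y', lab y' = T (lab y) ∧
      π y' ∈ MulAction.orbit (Subgroup.closure S) (π y))
    (hinj : ∀ y y', π y = π y' → lab y' - lab y ∈ Λ) :
    ((fun c => MulAction.orbit (Subgroup.closure S) c) '' Set.range π).ncard * M =
      ∑ i ∈ Finset.range M, (I i).index := by
  obtain ⟨s, hs, hfin, hcard⟩ := exists_orbit_classes Λ T hT M hM hTM I hI
  have e : Quotient (s.comap lab) ≃ Quotient s :=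
    Equiv.ofBijective (Quotient.map' lab fun _ _ h => h) ⟨by
      intro x x'
      induction x using Quotient.inductionOn
      induction x' using Quotient.inductionOn
      intro h
      exact Quotient.sound (Quotient.exact (s := s) h), by
      intro x
      obtain ⟨v, rfl⟩ := Quotient.exists_rep x
      obtain ⟨y, rfl⟩ := hlab v
      exact ⟨Quotient.mk _ y, rfl⟩⟩
  have : Finite (Quotient (s.comap lab)) := Finite.of_equiv _ e.symm
  have hΛ : ∀ v w, w - v ∈ Λ → s v w := by
    intro v w h
    refine (hs _ _).mpr ⟨0, ?_⟩
    rw [pow_zero, AddMonoid.End.coe_one, id, ← neg_sub]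
    exact Λ.neg_mem h
  have hsT : ∀ v, s v (T v) := fun v => (hs _ _).mpr ⟨1, by rw [pow_one, sub_self]; exact Λ.zero_mem⟩
  rw [ncard_orbit_image_eq S π (s.comap lab), Nat.card_congr e, hcard]
  · intro a ha y
    obtain ⟨y', h, h'⟩ := hgen a ha y
    refine ⟨y', h, ?_⟩
    rcases h' with h' | h'
    · exact hΛ _ _ h'
    · exact s.trans (hsT _) (hΛ _ _ h')
  · intro y y' h
    obtain ⟨i, hi⟩ := (hs _ _).mp h
    -- A relation of labels is i applications of T followed by a translation in Λ. The i
    -- applications are realized inside one orbit here, the translation afterwards by `horb`.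
    have hiter : ∀ i : ℕ, ∃ z, lab z = (T ^ i) (lab y) ∧
        π z ∈ MulAction.orbit (Subgroup.closure S) (π y) := by
      intro i
      induction i with
      | zero => exact ⟨y, by simp, MulAction.mem_orbit_self _⟩
      | succ i ih =>
        obtain ⟨z, hz, hzo⟩ := ih
        obtain ⟨z', hz', hzo'⟩ := horbT z
        refine ⟨z', by rw [hz', hz, pow_succ']; rfl, ?_⟩
        rw [← MulAction.orbit_eq_iff] at hzo ⊢
        rw [← hzo, MulAction.orbit_eq_iff]
        exact hzo'
    obtain ⟨z, hz, hzo⟩ := hiter i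
    rw [← hz] at hi
    have := horb z y' (by rw [← neg_sub]; exact Λ.neg_mem hi)
    rw [← MulAction.orbit_eq_iff] at hzo
    rwa [hzo] at this
  · intro y y' h
    exact hΛ _ _ (hinj y y' h)

end OrbitCounting

/-! ### The index of a lattice in ℤ² generated by four vectors. -/

section Lattices

theorem Int.mem_zmultiples_gcd_iff (u v z : ℤ) :
    z ∈ AddSubgroup.zmultiples (Int.gcd u v : ℤ) ↔ ∃ α β : ℤ, z = u * α + v * β := by
  rw [Int.mem_zmultiples_iff]
  constructor
  · rintro ⟨c, rfl⟩
    rw [Int.gcd_eq_gcd_ab]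
    exact ⟨Int.gcdA u v * c, Int.gcdB u v * c, by ring⟩
  · rintro ⟨α, β, rfl⟩
    exact dvd_add ((Int.gcd_dvd_left ..).mul_right _) ((Int.gcd_dvd_right ..).mul_right _)

/-- The subgroup of `ℤ × ℤ` generated by `(D, 0)`, `(0, D)`, `(x₁, x₂)` and `(s, s)`. -/
def pairLattice (D s x₁ x₂ : ℤ) : AddSubgroup (ℤ × ℤ) where
  carrier := {v : ℤ × ℤ | ∃ α β : ℤ, D ∣ v.1 - (α * x₁ + β * s) ∧ D ∣ v.2 - (α * x₂ + β * s)}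
  zero_mem' := ⟨0, 0, by simp⟩
  add_mem' := by
    rintro v w ⟨α, β, h₁, h₂⟩ ⟨α', β', h₁', h₂'⟩
    refine ⟨α + α', β + β', ?_, ?_⟩
    · convert Int.dvd_add h₁ h₁' using 1
      rw [Prod.fst_add]; ring
    · convert Int.dvd_add h₂ h₂' using 1
      rw [Prod.snd_add]; ring
  neg_mem' := by
    rintro v ⟨α, β, ⟨u, hu⟩, ⟨w, hw⟩⟩
    exact ⟨-α, -β, ⟨-u, by rw [Prod.fst_neg]; linear_combination -hu⟩,
      ⟨-w, by rw [Prod.snd_neg]; linear_combination -hw⟩⟩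

theorem mem_pairLattice {D s x₁ x₂ : ℤ} {v : ℤ × ℤ} : v ∈ pairLattice D s x₁ x₂ ↔
    ∃ α β : ℤ, D ∣ v.1 - (α * x₁ + β * s) ∧ D ∣ v.2 - (α * x₂ + β * s) := Iff.rfl

/-- The index is multiplicative along A → B → C, exact at B: H is measured by its trace on the
kernel of f and by its image under f. -/
theorem AddSubgroup.index_eq_index_comap_mul_index_map {A B C : Type*} [AddCommGroup A]
    [AddCommGroup B] [AddCommGroup C] (H : AddSubgroup B) (i : A →+ B) (f : B →+ C)
    (hf : Function.Surjective f) (hif : f.ker = i.range) :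
    H.index = (H.comap i).index * (H.map f).index := by
  rw [AddSubgroup.index_comap, AddSubgroup.index_map, ← hif,
    AddMonoidHom.range_eq_top.mpr hf, AddSubgroup.index_top, mul_one,
    ← AddSubgroup.relIndex_sup_right f.ker H, sup_comm f.ker H,
    AddSubgroup.relIndex_mul_index le_sup_left]

theorem Int.dvd_mul_gcd_iff (t c u v : ℤ) : t ∣ c * Int.gcd u v ↔ t ∣ c * u ∧ t ∣ c * v := by
  constructor
  · intro h
    exact ⟨h.trans (mul_dvd_mul_left _ (Int.gcd_dvd_left ..)),
      h.trans (mul_dvd_mul_left _ (Int.gcd_dvd_right ..))⟩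
  · rintro ⟨h₁, h₂⟩
    rw [Int.gcd_eq_gcd_ab, mul_add, ← mul_assoc, ← mul_assoc]
    exact dvd_add (h₁.mul_right _) (h₂.mul_right _)

/-- The index of a full-rank lattice in ℤ² is the gcd of the 2×2 minors of its generators, here up
to sign D², Ds, Dx₁, Dx₂ and s(x₂ - x₁). The proof obtains this by cutting the lattice along the
diagonal: the image under the difference of the coordinates has index gcd(D, x₂ - x₁), and the
diagonal part is computed separately. -/
theorem pairLattice_index {D : ℤ} (hD : D ≠ 0) (s x₁ x₂ : ℤ) :
    (pairLattice D s x₁ x₂).index =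
      Int.gcd (D * Int.gcd (ConstacyclicRing.gcd₃ D s x₁) x₂) (s * (x₂ - x₁)) := by
  obtain ⟨D', hD'⟩ : (Int.gcd D (x₂ - x₁) : ℤ) ∣ D := Int.gcd_dvd_left ..
  obtain ⟨δ', hδ'⟩ : (Int.gcd D (x₂ - x₁) : ℤ) ∣ x₂ - x₁ := Int.gcd_dvd_right ..
  have hco : IsCoprime D' δ' := by
    refine ⟨Int.gcdA D (x₂ - x₁), Int.gcdB D (x₂ - x₁), ?_⟩
    have h0 : (Int.gcd D (x₂ - x₁) : ℤ) ≠ 0 := by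
      intro h
      rw [h, zero_mul] at hD'
      exact hD hD'
    apply mul_left_cancel₀ h0
    have h := Int.gcd_eq_gcd_ab D (x₂ - x₁)
    linear_combination -h - Int.gcdA D (x₂ - x₁) * hD' - Int.gcdB D (x₂ - x₁) * hδ'
  set d : ℤ := (Int.gcd D (x₂ - x₁) : ℤ) with hd
  have hd0 : d ≠ 0 := by
    rintro h
    rw [h, zero_mul] at hD'
    exact hD hD'
  let i : ℤ →+ ℤ × ℤ := (AddMonoidHom.id ℤ).prod (AddMonoidHom.id ℤ)
  let f : ℤ × ℤ →+ ℤ := AddMonoidHom.snd ℤ ℤ - AddMonoidHom.fst ℤ ℤ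
  have hmap : (pairLattice D s x₁ x₂).map f = AddSubgroup.zmultiples d := by
    ext z
    rw [Int.mem_zmultiples_gcd_iff, AddSubgroup.mem_map]
    constructor
    · rintro ⟨v, ⟨α, β, ⟨u, hu⟩, ⟨w, hw⟩⟩, rfl⟩
      refine ⟨w - u, α, ?_⟩
      change v.2 - v.1 = _
      linear_combination hw - hu
    · rintro ⟨u, α, rfl⟩
      refine ⟨(α * x₁, D * u + α * x₂), ⟨α, 0, ⟨0, by ring⟩, ⟨u, by ring⟩⟩, ?_⟩
      change D * u + α * x₂ - α * x₁ = _
      ring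
  have hcomap : (pairLattice D s x₁ x₂).comap i =
      AddSubgroup.zmultiples (Int.gcd (Int.gcd D s) (D' * x₁) : ℤ) := by
    ext y
    rw [AddSubgroup.mem_comap, Int.mem_zmultiples_gcd_iff]
    constructor
    · rintro ⟨α, β, ⟨u, hu⟩, ⟨w, hw⟩⟩
      change y - _ = _ at hu
      change y - _ = _ at hw
      -- For a diagonal vector the coefficient α must satisfy D ∣ α(x₂ - x₁). After division by d
      -- this reads D' ∣ αδ', so D' ∣ α and only multiples of D'x₁ contribute.
      have h1 : D' * (u - w) = α * δ' := by
        apply mul_left_cancel₀ hd0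
        linear_combination hw - hu - (u - w) * hD' + α * hδ'
      obtain ⟨α', rfl⟩ : D' ∣ α := hco.dvd_of_dvd_mul_right ⟨_, h1.symm⟩
      obtain ⟨g₁, hg₁⟩ : (Int.gcd D s : ℤ) ∣ D := Int.gcd_dvd_left ..
      obtain ⟨g₂, hg₂⟩ : (Int.gcd D s : ℤ) ∣ s := Int.gcd_dvd_right ..
      exact ⟨u * g₁ + β * g₂, α', by linear_combination hu + u * hg₁ + β * hg₂⟩
    · rintro ⟨α, β, rfl⟩
      have hg := Int.gcd_eq_gcd_ab D s
      set A := Int.gcdA D s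
      set B := Int.gcdB D s
      refine ⟨β * D', α * B, ⟨A * α, ?_⟩, ⟨A * α - β * δ', ?_⟩⟩
      · change (Int.gcd D s : ℤ) * α + D' * x₁ * β - _ = _
        linear_combination α * hg
      · change (Int.gcd D s : ℤ) * α + D' * x₁ * β - _ = _
        linear_combination α * hg + β * δ' * hD' - β * D' * hδ'
  rw [AddSubgroup.index_eq_index_comap_mul_index_map _ i f (fun z => ⟨(0, z), sub_zero z⟩) (by
    ext v
    rw [AddMonoidHom.mem_ker, AddMonoidHom.mem_range]
    change v.2 - v.1 = 0 ↔ _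
    constructor
    · intro h
      exact ⟨v.1, Prod.ext rfl (sub_eq_zero.mp h).symm⟩
    · rintro ⟨y, rfl⟩
      exact sub_self y), hmap, hcomap, Int.index_zmultiples, Int.index_zmultiples,
    Int.natAbs_natCast, mul_comm, ← Int.gcd_mul_left, ← mul_assoc, ← hD']
  -- The product of the two partial indices is compared with the claimed gcd through common
  -- divisors. Once D x₁ is divisible by t, so is D(x₂ - x₁) exactly when D x₂ is.
  have key : ∀ t : ℤ, t ∣ (Int.gcd (d * Int.gcd D s) (D * x₁) : ℤ) ↔
      t ∣ (Int.gcd (D * Int.gcd (ConstacyclicRing.gcd₃ D s x₁) x₂) (s * (x₂ - x₁)) : ℤ) := by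
    intro t
    rw [Int.dvd_coe_gcd_iff, Int.dvd_coe_gcd_iff, Int.dvd_mul_gcd_iff, Int.dvd_mul_gcd_iff,
      ConstacyclicRing.gcd₃, Int.dvd_mul_gcd_iff, Int.dvd_mul_gcd_iff, mul_comm d D, mul_comm d s,
      hd, Int.dvd_mul_gcd_iff, Int.dvd_mul_gcd_iff, mul_comm s D]
    have h1 : t ∣ D * x₁ → (t ∣ D * (x₂ - x₁) ↔ t ∣ D * x₂) := by
      intro h
      rw [mul_sub]
      exact dvd_sub_left h
    tauto
  exact Nat.dvd_antisymm (Int.natCast_dvd_natCast.mp ((key _).mp dvd_rfl))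
    (Int.natCast_dvd_natCast.mp ((key _).mpr dvd_rfl))

end Lattices

/-! ### The lattices Λ + (T^i - 1)V for the endomorphisms T that occur. -/

section LatticeEndomorphisms

theorem Int.gcd_pow_sub_one {q : ℕ} (hq : 0 < q) (j k : ℕ) :
    (Int.gcd ((q : ℤ) ^ k - 1) ((q : ℤ) ^ j - 1) : ℤ) = (q : ℤ) ^ Nat.gcd k j - 1 := by
  have h : ∀ i : ℕ, ((q : ℤ) ^ i - 1) = ((q ^ i - 1 : ℕ) : ℤ) := by
    intro i
    rw [Nat.cast_sub (Nat.one_le_pow _ _ hq)]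
    simp
  rw [h, h, h, Int.gcd_natCast_natCast, Nat.pow_sub_one_gcd_pow_sub_one]

theorem AddMonoid.End.intCast_pow_apply {V : Type*} [AddCommGroup V] (q : ℤ) (i : ℕ) (v : V) :
    ((q : AddMonoid.End V) ^ i) v = q ^ i • v := by
  rw [← Int.cast_pow, AddMonoid.End.intCast_apply]

theorem Int.mem_zmultiples_gcd₃_iff (u v w z : ℤ) :
    z ∈ AddSubgroup.zmultiples (ConstacyclicRing.gcd₃ u v w : ℤ) ↔
      ∃ α β γ : ℤ, z = u * α + v * β + w * γ := by
  rw [ConstacyclicRing.gcd₃, Int.mem_zmultiples_gcd_iff]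
  constructor
  · rintro ⟨α, γ, rfl⟩
    obtain ⟨a, b, hab⟩ := (Int.mem_zmultiples_gcd_iff u v _).mp
      (AddSubgroup.mem_zmultiples (Int.gcd u v : ℤ))
    exact ⟨a * α, b * α, γ, by rw [hab]; ring⟩
  · rintro ⟨α, β, γ, rfl⟩
    obtain ⟨c, hc⟩ := Int.mem_zmultiples_iff.mp
      ((Int.mem_zmultiples_gcd_iff u v (u * α + v * β)).mpr ⟨α, β, rfl⟩)
    exact ⟨c, γ, by rw [hc]⟩

/-- Enlarging the subgroup by the image of q^i - 1 only replaces N by gcd(N, q^i - 1);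
`mem_pairLattice_gcd_iff` is the same remark in rank two. -/
theorem mem_zmultiples_gcd₃_pow_iff (N s x q : ℤ) (i : ℕ) (v : ℤ) :
    v ∈ AddSubgroup.zmultiples
        (ConstacyclicRing.gcd₃ (Int.gcd N (q ^ i - 1)) s x : ℤ) ↔
      ∃ w, v - (((q : AddMonoid.End ℤ) ^ i) w - w) ∈
        AddSubgroup.zmultiples (ConstacyclicRing.gcd₃ N s x : ℤ) := by
  simp only [Int.mem_zmultiples_gcd₃_iff, AddMonoid.End.intCast_pow_apply, smul_eq_mul]
  constructor
  · rintro ⟨α, β, γ, rfl⟩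
    obtain ⟨a, b, hab⟩ := (Int.mem_zmultiples_gcd_iff N (q ^ i - 1) _).mp
      (AddSubgroup.mem_zmultiples (Int.gcd N (q ^ i - 1) : ℤ))
    exact ⟨b * α, a * α, β, γ, by rw [hab]; ring⟩
  · rintro ⟨w, α, β, γ, h⟩
    obtain ⟨c, hc⟩ := Int.mem_zmultiples_iff.mp
      ((Int.mem_zmultiples_gcd_iff N (q ^ i - 1) (N * α + (q ^ i - 1) * w)).mpr ⟨α, w, rfl⟩)
    exact ⟨c, β, γ, by linear_combination h + hc⟩

theorem mem_pairLattice_gcd_iff (N s x₁ x₂ c : ℤ) (v : ℤ × ℤ) :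
    v ∈ pairLattice (Int.gcd N (c - 1)) s x₁ x₂ ↔
      ∃ w : ℤ × ℤ, v - (c • w - w) ∈ pairLattice N s x₁ x₂ := by
  have hdvd : ∀ z : ℤ, (Int.gcd N (c - 1) : ℤ) ∣ z ↔ ∃ a b : ℤ, z = N * a + (c - 1) * b := by
    intro z
    rw [← Int.mem_zmultiples_iff, Int.mem_zmultiples_gcd_iff]
  simp only [mem_pairLattice, hdvd, Prod.fst_sub, Prod.snd_sub, Prod.smul_fst, Prod.smul_snd,
    smul_eq_mul]
  constructor
  · rintro ⟨α, β, ⟨a, b, h₁⟩, ⟨a', b', h₂⟩⟩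
    exact ⟨(b, b'), α, β, ⟨a, by linear_combination h₁⟩, ⟨a', by linear_combination h₂⟩⟩
  · rintro ⟨⟨b, b'⟩, α, β, ⟨a, h₁⟩, ⟨a', h₂⟩⟩
    exact ⟨α, β, ⟨a, b, by linear_combination h₁⟩, ⟨a', b', by linear_combination h₂⟩⟩

/-- The endomorphism `(y, z) ↦ (q z, y)` of `ℤ × ℤ`. -/
def twistedSwap (q : ℤ) : AddMonoid.End (ℤ × ℤ) :=
  ((AddMonoidHom.mulLeft q).comp (AddMonoidHom.snd ℤ ℤ)).prod (AddMonoidHom.fst ℤ ℤ)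

theorem twistedSwap_apply (q : ℤ) (v : ℤ × ℤ) : twistedSwap q v = (q * v.2, v.1) := rfl

theorem twistedSwap_pow_two_mul (q : ℤ) (h : ℕ) (v : ℤ × ℤ) :
    (twistedSwap q ^ (2 * h)) v = q ^ h • v := by
  induction h with
  | zero => simp
  | succ h ih =>
    rw [show 2 * (h + 1) = 2 * h + 1 + 1 from by ring, pow_succ', pow_succ']
    change twistedSwap q (twistedSwap q ((twistedSwap q ^ (2 * h)) v)) = _
    rw [ih, twistedSwap_apply, twistedSwap_apply]
    ext <;> simp <;> ring

theorem twistedSwap_pow_two_mul_add_one (q : ℤ) (h : ℕ) (v : ℤ × ℤ) :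
    (twistedSwap q ^ (2 * h + 1)) v = (q ^ (h + 1) * v.2, q ^ h * v.1) := by
  rw [pow_succ']
  change twistedSwap q ((twistedSwap q ^ (2 * h)) v) = _
  rw [twistedSwap_pow_two_mul, twistedSwap_apply]
  ext
  · simp; ring
  · simp

/-- The preimage of `d ℤ` under `(y, z) ↦ z + c y`. -/
def slopeLattice (d c : ℤ) : AddSubgroup (ℤ × ℤ) :=
  (AddSubgroup.zmultiples d).comap
    (AddMonoidHom.snd ℤ ℤ + (AddMonoidHom.mulLeft c).comp (AddMonoidHom.fst ℤ ℤ))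

theorem mem_slopeLattice {d c : ℤ} {v : ℤ × ℤ} : v ∈ slopeLattice d c ↔
    v.2 + c * v.1 ∈ AddSubgroup.zmultiples d := Iff.rfl

theorem slopeLattice_index (d c : ℤ) : (slopeLattice d c).index = d.natAbs := by
  rw [slopeLattice, AddSubgroup.index_comap_of_surjective, Int.index_zmultiples]
  exact fun z => ⟨(0, z), by simp⟩

/-- Modulo the image of T^(2h+1) - 1 the vector (y, 0) equals (0, q^h y), so the quotient is cyclic
and is read off from z + q^h y. Under this form the image of T^(2h+1) - 1 becomes (q^(2h+1) - 1)ℤ,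
the vector (x₁, x₂) gives x₂ + q^h x₁, and (s, s) gives s(q^h + 1). The last is 2s modulo N, since q
- 1 divides q^h - 1 and N = s(q - 1); this is the origin of the factor 2. -/
theorem mem_slopeLattice_iff_twistedSwap {N s q x₁ x₂ : ℤ} (hN : N = s * (q - 1)) (h : ℕ)
    (v : ℤ × ℤ) :
    v ∈ slopeLattice (ConstacyclicRing.gcd₃ (Int.gcd N (q ^ (2 * h + 1) - 1)) (2 * s)
        (x₂ + q ^ h * x₁)) (q ^ h) ↔
      ∃ w, v - ((twistedSwap q ^ (2 * h + 1)) w - w) ∈ pairLattice N s x₁ x₂ := by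
  obtain ⟨c, hc⟩ : q - 1 ∣ q ^ h - 1 := sub_one_dvd_pow_sub_one q h
  simp only [mem_slopeLattice, twistedSwap_pow_two_mul_add_one, mem_pairLattice,
    Prod.fst_sub, Prod.snd_sub]
  rw [Int.mem_zmultiples_gcd₃_iff]
  constructor
  · rintro ⟨α, β, γ, h₁⟩
    obtain ⟨a, b, hab⟩ := (Int.mem_zmultiples_gcd_iff N (q ^ (2 * h + 1) - 1) _).mp
      (AddSubgroup.mem_zmultiples (Int.gcd N (q ^ (2 * h + 1) - 1) : ℤ))
    rw [hab] at h₁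
    refine ⟨(q ^ (h + 1) * (b * α) + γ * x₁ + β * s - v.1, b * α), γ, β, ⟨0, by ring⟩,
      ⟨a * α - c * β, ?_⟩⟩
    linear_combination h₁ - s * β * hc + c * β * hN
  · rintro ⟨⟨w₁, w₂⟩, α, β, ⟨a, ha⟩, ⟨a', ha'⟩⟩
    simp only at ha ha'
    obtain ⟨z, hz⟩ := Int.mem_zmultiples_iff.mp
      ((Int.mem_zmultiples_gcd_iff N (q ^ (2 * h + 1) - 1)
        (N * (a' + q ^ h * a + c * β) + (q ^ (2 * h + 1) - 1) * w₂)).mpr ⟨_, _, rfl⟩)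
    refine ⟨z, β, α, ?_⟩
    rw [← hz]
    linear_combination ha' + q ^ h * ha + s * β * hc - c * β * hN

/-- T maps (s, s) to (s, s) + (N, 0), and modulo N it multiplies (x₁, x₂) by β. In the application β
represents b. -/
theorem twistedSwap_mem_pairLattice {N s q x₁ x₂ β : ℤ} (hN : N = s * (q - 1))
    (h₁ : N ∣ q * x₂ - β * x₁) (h₂ : N ∣ x₁ - β * x₂) {v : ℤ × ℤ}
    (hv : v ∈ pairLattice N s x₁ x₂) : twistedSwap q v ∈ pairLattice N s x₁ x₂ := by
  obtain ⟨α, γ, ⟨a, ha⟩, ⟨b, hb⟩⟩ := hv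
  obtain ⟨c, hc⟩ := h₁
  obtain ⟨d, hd⟩ := h₂
  refine ⟨α * β, γ, ⟨q * b + γ + α * c, ?_⟩, ⟨a + α * d, ?_⟩⟩
  · rw [twistedSwap_apply]
    linear_combination q * hb - γ * hN + α * hc
  · rw [twistedSwap_apply]
    linear_combination ha + α * hd

theorem intCast_mem_of_mem {V : Type*} [AddCommGroup V] (Λ : AddSubgroup V) (q : ℤ) {v : V}
    (hv : v ∈ Λ) : (q : AddMonoid.End V) v ∈ Λ := by
  rw [AddMonoid.End.intCast_apply]
  exact Λ.zsmul_mem hv q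

end LatticeEndomorphisms

/-! ### Orbit counts on pairs of field elements, by the pattern of zero entries. -/

section PairModels

/-- A set `C` with commuting permutations `ρ` and `σ` that looks like `L × L`, where `L` is a
subfield of `K` with unit group `⟨g⟩` of order `N`: here `ρ` multiplies the two coordinates `E₁`
and `E₂` by `g ^ x₁` and `g ^ x₂`, and `σ` multiplies both by a generator of `⟨g ^ s⟩`. -/
structure PairModel {X K G : Type*} [Field K] [Group G] [MulAction G X] (C : Set X)
    (E₁ E₂ : X → K) (g : Kˣ) (N s x₁ x₂ : ℤ) (ρ σ : G) : Prop where
  pos : 0 < N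
  zpow_eq_one : ∀ y : ℤ, g ^ y = 1 ↔ N ∣ y
  inj : ∀ c ∈ C, ∀ c' ∈ C, E₁ c = E₁ c' → E₂ c = E₂ c' → c = c'
  surj : ∀ u v : K, (u = 0 ∨ ∃ y : ℤ, u = (g ^ y : Kˣ)) → (v = 0 ∨ ∃ y : ℤ, v = (g ^ y : Kˣ)) →
    ∃ c ∈ C, E₁ c = u ∧ E₂ c = v
  val₁ : ∀ c ∈ C, E₁ c = 0 ∨ ∃ y : ℤ, E₁ c = (g ^ y : Kˣ)
  val₂ : ∀ c ∈ C, E₂ c = 0 ∨ ∃ y : ℤ, E₂ c = (g ^ y : Kˣ)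
  shift : ∀ c ∈ C, ρ • c ∈ C ∧ E₁ (ρ • c) = (g ^ x₁ : Kˣ) * E₁ c ∧
    E₂ (ρ • c) = (g ^ x₂ : Kˣ) * E₂ c
  scalar : ∃ γ : Kˣ, (∃ t : ℤ, γ = g ^ (t * s)) ∧ (∃ t : ℕ, γ ^ t = g ^ s) ∧
    ∀ c ∈ C, σ • c ∈ C ∧ E₁ (σ • c) = γ * E₁ c ∧ E₂ (σ • c) = γ * E₂ c

namespace PairModel

variable {X K G : Type*} [Field K] [Group G] [MulAction G X] {C : Set X}
    {E₁ E₂ : X → K} {g : Kˣ} {N s x₁ x₂ : ℤ} {ρ σ : G}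

theorem swap (h : PairModel C E₁ E₂ g N s x₁ x₂ ρ σ) :
    PairModel C E₂ E₁ g N s x₂ x₁ ρ σ where
  pos := h.pos
  zpow_eq_one := h.zpow_eq_one
  inj c hc c' hc' h₁ h₂ := h.inj c hc c' hc' h₂ h₁
  surj u v hu hv := by
    obtain ⟨c, hc, h₁, h₂⟩ := h.surj v u hv hu
    exact ⟨c, hc, h₂, h₁⟩
  val₁ := h.val₂
  val₂ := h.val₁
  shift c hc := ⟨(h.shift c hc).1, (h.shift c hc).2.2, (h.shift c hc).2.1⟩
  scalar := by
    obtain ⟨γ, h₁, h₂, h₃⟩ := h.scalar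
    exact ⟨γ, h₁, h₂, fun c hc => ⟨(h₃ c hc).1, (h₃ c hc).2.2, (h₃ c hc).2.1⟩⟩

theorem zpow_eq_zpow (h : PairModel C E₁ E₂ g N s x₁ x₂ ρ σ) {y z : ℤ} :
    g ^ y = g ^ z ↔ N ∣ y - z := by
  rw [← h.zpow_eq_one, zpow_sub, mul_inv_eq_one]

theorem shift_pow (h : PairModel C E₁ E₂ g N s x₁ x₂ ρ σ) (j : ℕ) {c : X} (hc : c ∈ C) :
    ρ ^ j • c ∈ C ∧ E₁ (ρ ^ j • c) = (g ^ (j * x₁) : Kˣ) * E₁ c ∧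
      E₂ (ρ ^ j • c) = (g ^ (j * x₂) : Kˣ) * E₂ c := by
  induction j with
  | zero => simpa using hc
  | succ j ih =>
    obtain ⟨h₀, h₁, h₂⟩ := ih
    obtain ⟨h₀', h₁', h₂'⟩ := h.shift _ h₀
    rw [pow_succ', mul_smul]
    refine ⟨h₀', ?_, ?_⟩
    · rw [h₁', h₁, ← mul_assoc, ← Units.val_mul, ← zpow_add]
      congr 3; push_cast; ring
    · rw [h₂', h₂, ← mul_assoc, ← Units.val_mul, ← zpow_add]
      congr 3; push_cast; ring

theorem scalar_pow (h : PairModel C E₁ E₂ g N s x₁ x₂ ρ σ) (j : ℕ) :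
    ∃ i : ℕ, ∀ c ∈ C, σ ^ i • c ∈ C ∧ E₁ (σ ^ i • c) = (g ^ (j * s) : Kˣ) * E₁ c ∧
      E₂ (σ ^ i • c) = (g ^ (j * s) : Kˣ) * E₂ c := by
  obtain ⟨γ, -, ⟨t, ht⟩, h₃⟩ := h.scalar
  have hp : ∀ i : ℕ, ∀ c ∈ C, σ ^ i • c ∈ C ∧ E₁ (σ ^ i • c) = (γ ^ i : Kˣ) * E₁ c ∧
      E₂ (σ ^ i • c) = (γ ^ i : Kˣ) * E₂ c := by
    intro i c hc
    induction i with
    | zero => simpa using hc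
    | succ i ih =>
      obtain ⟨h₀, h₁, h₂⟩ := ih
      obtain ⟨h₀', h₁', h₂'⟩ := h₃ _ h₀
      rw [pow_succ' σ, mul_smul]
      refine ⟨h₀', ?_, ?_⟩
      · rw [h₁', h₁, ← mul_assoc, ← Units.val_mul, pow_succ']
      · rw [h₂', h₂, ← mul_assoc, ← Units.val_mul, pow_succ']
  refine ⟨t * j, fun c hc => ?_⟩
  have := hp (t * j) c hc
  rwa [pow_mul γ, ht, ← zpow_natCast (g ^ s), ← zpow_mul, mul_comm s] at this

/-- The integer coefficients are first reduced modulo N to natural numbers, so that only nonnegative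
powers of ρ and σ, which are known to preserve C, are needed. -/
theorem exists_translation (h : PairModel C E₁ E₂ g N s x₁ x₂ ρ σ) (S : Set G) (hρ : ρ ∈ S)
    (hσ : σ ∈ S) (α β : ℤ) :
    ∃ a ∈ Subgroup.closure S, ∀ c ∈ C, a • c ∈ C ∧
      E₁ (a • c) = (g ^ (α * x₁ + β * s) : Kˣ) * E₁ c ∧
      E₂ (a • c) = (g ^ (α * x₂ + β * s) : Kˣ) * E₂ c := by
  obtain ⟨α', hα'⟩ := Int.eq_ofNat_of_zero_le (Int.emod_nonneg α h.pos.ne')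
  obtain ⟨β', hβ'⟩ := Int.eq_ofNat_of_zero_le (Int.emod_nonneg β h.pos.ne')
  have hmod : ∀ x, g ^ (α * x + β * s) = g ^ (α' * x) * g ^ (β' * s) := by
    intro x
    rw [← zpow_add, h.zpow_eq_zpow]
    refine ⟨α / N * x + β / N * s, ?_⟩
    rw [← hα', ← hβ']
    have h₁ := Int.emod_add_mul_ediv α N
    have h₂ := Int.emod_add_mul_ediv β N
    linear_combination -x * h₁ - s * h₂
  obtain ⟨i, hi⟩ := h.scalar_pow β'
  refine ⟨ρ ^ α' * σ ^ i, Subgroup.mul_mem _ (Subgroup.pow_mem _ (Subgroup.subset_closure hρ) _)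
    (Subgroup.pow_mem _ (Subgroup.subset_closure hσ) _), fun c hc => ?_⟩
  obtain ⟨h₀, h₁, h₂⟩ := hi c hc
  obtain ⟨h₀', h₁', h₂'⟩ := h.shift_pow α' h₀
  rw [mul_smul]
  exact ⟨h₀', by rw [h₁', h₁, hmod, Units.val_mul, mul_assoc],
    by rw [h₂', h₂, hmod, Units.val_mul, mul_assoc]⟩

/-- The number of orbits on the pairs with two nonzero coordinates. -/
theorem ncard_orbits_units [Finite G] (h : PairModel C E₁ E₂ g N s x₁ x₂ ρ σ) (μ : G)
    (T : AddMonoid.End (ℤ × ℤ))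
    (hμ : ∀ c ∈ C, ∀ v : ℤ × ℤ, E₁ c = (g ^ v.1 : Kˣ) → E₂ c = (g ^ v.2 : Kˣ) → μ • c ∈ C ∧
      E₁ (μ • c) = (g ^ (T v).1 : Kˣ) ∧ E₂ (μ • c) = (g ^ (T v).2 : Kˣ))
    (hT : ∀ v ∈ pairLattice N s x₁ x₂, T v ∈ pairLattice N s x₁ x₂) (M : ℕ) (hM : 0 < M)
    (hTM : ∀ v, (T ^ M) v - v ∈ pairLattice N s x₁ x₂) (I : ℕ → AddSubgroup (ℤ × ℤ))
    (hI : ∀ i v, v ∈ I i ↔ ∃ w, v - ((T ^ i) w - w) ∈ pairLattice N s x₁ x₂)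
    [(pairLattice N s x₁ x₂).FiniteIndex] :
    ((fun c => MulAction.orbit (Subgroup.closure {μ, ρ, σ}) c) ''
        {c | c ∈ C ∧ E₁ c ≠ 0 ∧ E₂ c ≠ 0}).ncard * M = ∑ i ∈ Finset.range M, (I i).index := by
  choose π hπC hπ₁ hπ₂ using fun v : ℤ × ℤ =>
    h.surj (g ^ v.1 : Kˣ) (g ^ v.2 : Kˣ) (Or.inr ⟨_, rfl⟩) (Or.inr ⟨_, rfl⟩)
  have hrange : {c | c ∈ C ∧ E₁ c ≠ 0 ∧ E₂ c ≠ 0} = Set.range π := by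
    ext c
    constructor
    · rintro ⟨hc, h₁, h₂⟩
      obtain ⟨y, hy⟩ := (h.val₁ c hc).resolve_left h₁
      obtain ⟨z, hz⟩ := (h.val₂ c hc).resolve_left h₂
      exact ⟨(y, z), h.inj _ (hπC _) _ hc ((hπ₁ _).trans hy.symm) ((hπ₂ _).trans hz.symm)⟩
    · rintro ⟨v, rfl⟩
      exact ⟨hπC v, by rw [hπ₁]; exact Units.ne_zero _, by rw [hπ₂]; exact Units.ne_zero _⟩
  have heq : ∀ c ∈ C, ∀ v : ℤ × ℤ, E₁ c = (g ^ v.1 : Kˣ) → E₂ c = (g ^ v.2 : Kˣ) → c = π v :=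
    fun c hc v h₁ h₂ => h.inj _ hc _ (hπC v) (h₁.trans (hπ₁ v).symm) (h₂.trans (hπ₂ v).symm)
  rw [hrange]
  refine ncard_orbit_image_mul {μ, ρ, σ} π id Function.surjective_id (pairLattice N s x₁ x₂) T hT
    M hM hTM I hI ?_ ?_ ?_ ?_
  · rintro a (rfl | rfl | rfl) v
    · obtain ⟨h₀, h₁, h₂⟩ := hμ (π v) (hπC v) v (hπ₁ v) (hπ₂ v)
      refine ⟨T v, heq _ h₀ _ h₁ h₂, Or.inr ?_⟩
      rw [id, id, sub_self]
      exact AddSubgroup.zero_mem _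
    · obtain ⟨h₀, h₁, h₂⟩ := h.shift (π v) (hπC v)
      refine ⟨(x₁ + v.1, x₂ + v.2), heq _ h₀ _ ?_ ?_, Or.inl ⟨1, 0, ?_, ?_⟩⟩
      · rw [h₁, hπ₁, ← Units.val_mul, zpow_add]
      · rw [h₂, hπ₂, ← Units.val_mul, zpow_add]
      · simp
      · simp
    · obtain ⟨γ, ⟨t, ht⟩, -, hγ⟩ := h.scalar
      obtain ⟨h₀, h₁, h₂⟩ := hγ (π v) (hπC v)
      refine ⟨(t * s + v.1, t * s + v.2), heq _ h₀ _ ?_ ?_, Or.inl ⟨0, t, ?_, ?_⟩⟩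
      · rw [h₁, hπ₁, ht, ← Units.val_mul, zpow_add]
      · rw [h₂, hπ₂, ht, ← Units.val_mul, zpow_add]
      · simp
      · simp
  · rintro v w ⟨α, β, h₁, h₂⟩
    obtain ⟨a, ha, hat⟩ := h.exists_translation {μ, ρ, σ} (by simp) (by simp) α β
    obtain ⟨h₀, h₁', h₂'⟩ := hat (π v) (hπC v)
    refine ⟨⟨a, ha⟩, heq _ h₀ _ ?_ ?_⟩
    · rw [h₁', hπ₁, ← Units.val_mul, ← zpow_add, Units.val_inj, eq_comm, h.zpow_eq_zpow]
      convert h₁ using 1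
      simp only [id, Prod.fst_sub]; ring
    · rw [h₂', hπ₂, ← Units.val_mul, ← zpow_add, Units.val_inj, eq_comm, h.zpow_eq_zpow]
      convert h₂ using 1
      simp only [id, Prod.snd_sub]; ring
  · intro v
    obtain ⟨h₀, h₁, h₂⟩ := hμ (π v) (hπC v) v (hπ₁ v) (hπ₂ v)
    exact ⟨T v, rfl, ⟨μ, Subgroup.subset_closure (by simp)⟩, heq _ h₀ _ h₁ h₂⟩
  · intro v w hvw
    have h₁ := hπ₁ v
    have h₂ := hπ₂ v
    rw [hvw, hπ₁, Units.val_inj, h.zpow_eq_zpow] at h₁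
    rw [hvw, hπ₂, Units.val_inj, h.zpow_eq_zpow] at h₂
    exact ⟨0, 0, by simpa using h₁, by simpa using h₂⟩

/-- The number of orbits on the pairs `(u, 0)` with `u ≠ 0`. -/
theorem ncard_orbits_left [Finite G] (h : PairModel C E₁ E₂ g N s x₁ x₂ ρ σ) (μ : G) (q : ℕ)
    (hμ : ∀ c ∈ C, μ • c ∈ C ∧ E₁ (μ • c) = E₁ c ^ q ∧ E₂ (μ • c) = E₂ c ^ q) (hq : 0 < q)
    (k : ℕ) (hk : 0 < k) (hN : N = (q : ℤ) ^ k - 1) :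
    ((fun c => MulAction.orbit (Subgroup.closure {μ, ρ, σ}) c) ''
        {c | c ∈ C ∧ E₁ c ≠ 0 ∧ E₂ c = 0}).ncard * k =
      ∑ i ∈ Finset.range k, ConstacyclicRing.gcd₃ ((q : ℤ) ^ Nat.gcd k i - 1) s x₁ := by
  choose π hπC hπ₁ hπ₂ using fun v : ℤ =>
    h.surj (g ^ v : Kˣ) 0 (Or.inr ⟨_, rfl⟩) (Or.inl rfl)
  have hrange : {c | c ∈ C ∧ E₁ c ≠ 0 ∧ E₂ c = 0} = Set.range π := by
    ext c
    constructor
    · rintro ⟨hc, h₁, h₂⟩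
      obtain ⟨y, hy⟩ := (h.val₁ c hc).resolve_left h₁
      exact ⟨y, h.inj _ (hπC _) _ hc ((hπ₁ _).trans hy.symm) ((hπ₂ _).trans h₂.symm)⟩
    · rintro ⟨v, rfl⟩
      exact ⟨hπC v, by rw [hπ₁]; exact Units.ne_zero _, hπ₂ v⟩
  have heq : ∀ c ∈ C, ∀ v : ℤ, E₁ c = (g ^ v : Kˣ) → E₂ c = 0 → c = π v :=
    fun c hc v h₁ h₂ => h.inj _ hc _ (hπC v) (h₁.trans (hπ₁ v).symm) (h₂.trans (hπ₂ v).symm)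
  have hfin : (AddSubgroup.zmultiples (ConstacyclicRing.gcd₃ N s x₁ : ℤ)).FiniteIndex := by
    refine ⟨?_⟩
    rw [Int.index_zmultiples, Int.natAbs_natCast, ConstacyclicRing.gcd₃, Ne, Int.gcd_eq_zero_iff]
    rintro ⟨h₁, -⟩
    exact h.pos.ne' (Int.gcd_eq_zero_iff.mp (by exact_mod_cast h₁)).1
  have hμπ : ∀ v, μ • π v = π (q * v) := by
    intro v
    obtain ⟨h₀, h₁, h₂⟩ := hμ (π v) (hπC v)
    refine heq _ h₀ _ ?_ ?_
    · rw [h₁, hπ₁, ← Units.val_pow_eq_pow_val, ← zpow_natCast, ← zpow_mul, mul_comm]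
    · rw [h₂, hπ₂, zero_pow hq.ne']
  rw [hrange]
  -- The label of (g^v, 0) is v. It matters modulo N because of the order of g, modulo x₁ because of
  -- ρ, and modulo s because of σ.
  rw [ncard_orbit_image_mul {μ, ρ, σ} π id Function.surjective_id
    (AddSubgroup.zmultiples (ConstacyclicRing.gcd₃ N s x₁ : ℤ)) ((q : ℤ) : AddMonoid.End ℤ)
    (fun v hv => intCast_mem_of_mem _ _ hv) k hk ?_ _
    (fun i v => mem_zmultiples_gcd₃_pow_iff N s x₁ q i v)]
  · refine Finset.sum_congr rfl fun i _ => ?_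
    rw [Int.index_zmultiples, Int.natAbs_natCast, hN, Int.gcd_pow_sub_one hq]
  · rintro a (rfl | rfl | rfl) v
    · refine ⟨q * v, hμπ v, Or.inr ?_⟩
      simp
    · obtain ⟨h₀, h₁, h₂⟩ := h.shift (π v) (hπC v)
      refine ⟨x₁ + v, heq _ h₀ _ ?_ ?_, Or.inl ?_⟩
      · rw [h₁, hπ₁, ← Units.val_mul, zpow_add]
      · rw [h₂, hπ₂, mul_zero]
      · rw [Int.mem_zmultiples_gcd₃_iff]
        exact ⟨0, 0, 1, by simp⟩
    · obtain ⟨γ, ⟨t, ht⟩, -, hγ⟩ := h.scalar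
      obtain ⟨h₀, h₁, h₂⟩ := hγ (π v) (hπC v)
      refine ⟨t * s + v, heq _ h₀ _ ?_ ?_, Or.inl ?_⟩
      · rw [h₁, hπ₁, ht, ← Units.val_mul, zpow_add]
      · rw [h₂, hπ₂, mul_zero]
      · rw [Int.mem_zmultiples_gcd₃_iff]
        exact ⟨0, t, 0, by simp [mul_comm]⟩
  · intro v w hvw
    obtain ⟨c, β, α, hvw⟩ := (Int.mem_zmultiples_gcd₃_iff _ _ _ _).mp hvw
    obtain ⟨a, ha, hat⟩ := h.exists_translation {μ, ρ, σ} (by simp) (by simp) α β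
    obtain ⟨h₀, h₁', h₂'⟩ := hat (π v) (hπC v)
    refine ⟨⟨a, ha⟩, heq _ h₀ _ ?_ ?_⟩
    · rw [h₁', hπ₁, ← Units.val_mul, ← zpow_add, Units.val_inj, eq_comm, h.zpow_eq_zpow]
      exact ⟨c, by simp only [id] at hvw; linear_combination hvw⟩
    · rw [h₂', hπ₂, mul_zero]
  · intro v
    exact ⟨q * v, by simp,
      ⟨μ, Subgroup.subset_closure (by simp)⟩, hμπ v⟩
  · intro v w hvw
    have h₁ := hπ₁ w
    rw [← hvw, hπ₁, Units.val_inj, eq_comm, h.zpow_eq_zpow] at h₁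
    obtain ⟨c, hc⟩ := h₁
    rw [Int.mem_zmultiples_gcd₃_iff]
    exact ⟨c, 0, 0, by simpa using hc⟩
  · intro v
    rw [AddMonoid.End.intCast_pow_apply, Int.mem_zmultiples_gcd₃_iff]
    exact ⟨v, 0, 0, by rw [hN, smul_eq_mul]; ring⟩

/-- The number of orbits on the pairs with exactly one nonzero coordinate, when these are swapped
by `μ`. -/
theorem ncard_orbits_axes [Finite G] (h : PairModel C E₁ E₂ g N s x₁ x₂ ρ σ) (μ : G) (q : ℕ)
    (hμ : ∀ c ∈ C, μ • c ∈ C ∧ E₁ (μ • c) = E₂ c ^ q ∧ E₂ (μ • c) = E₁ c) (hq : 0 < q)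
    (k : ℕ) (hk : 0 < k) (hN : N = (q : ℤ) ^ k - 1) (hx : x₁ ∣ x₂) :
    ((fun c => MulAction.orbit (Subgroup.closure {μ, ρ, σ}) c) ''
        {c | c ∈ C ∧ ((E₁ c ≠ 0 ∧ E₂ c = 0) ∨ (E₁ c = 0 ∧ E₂ c ≠ 0))}).ncard * k =
      ∑ i ∈ Finset.range k, ConstacyclicRing.gcd₃ ((q : ℤ) ^ Nat.gcd k i - 1) s x₁ := by
  obtain ⟨b, rfl⟩ := hx
  choose π₁ hπC₁ hπ₁₁ hπ₁₂ using fun v : ℤ =>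
    h.surj (g ^ v : Kˣ) 0 (Or.inr ⟨_, rfl⟩) (Or.inl rfl)
  choose π₂ hπC₂ hπ₂₁ hπ₂₂ using fun v : ℤ =>
    h.surj 0 (g ^ v : Kˣ) (Or.inl rfl) (Or.inr ⟨_, rfl⟩)
  -- Both axes share one set of labels: μ sends (g^v, 0) to (0, g^v), keeping the label, and returns
  -- to the first axis with v multiplied by q. Hence the period in the count is k, as for a single
  -- axis.
  let π : ℤ ⊕ ℤ → X := Sum.elim π₁ π₂
  let lab : ℤ ⊕ ℤ → ℤ := Sum.elim id id
  have hrange : {c | c ∈ C ∧ ((E₁ c ≠ 0 ∧ E₂ c = 0) ∨ (E₁ c = 0 ∧ E₂ c ≠ 0))} = Set.range π := by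
    ext c
    constructor
    · rintro ⟨hc, (⟨h₁, h₂⟩ | ⟨h₁, h₂⟩)⟩
      · obtain ⟨y, hy⟩ := (h.val₁ c hc).resolve_left h₁
        exact ⟨Sum.inl y, h.inj _ (hπC₁ _) _ hc ((hπ₁₁ _).trans hy.symm) ((hπ₁₂ _).trans h₂.symm)⟩
      · obtain ⟨y, hy⟩ := (h.val₂ c hc).resolve_left h₂
        exact ⟨Sum.inr y, h.inj _ (hπC₂ _) _ hc ((hπ₂₁ _).trans h₁.symm) ((hπ₂₂ _).trans hy.symm)⟩
    · rintro ⟨v | v, rfl⟩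
      · exact ⟨hπC₁ v, Or.inl ⟨(hπ₁₁ v).trans_ne (Units.ne_zero _), hπ₁₂ v⟩⟩
      · exact ⟨hπC₂ v, Or.inr ⟨hπ₂₁ v, (hπ₂₂ v).trans_ne (Units.ne_zero _)⟩⟩
  have heq₁ : ∀ c ∈ C, ∀ v : ℤ, E₁ c = (g ^ v : Kˣ) → E₂ c = 0 → c = π₁ v :=
    fun c hc v h₁ h₂ => h.inj _ hc _ (hπC₁ v) (h₁.trans (hπ₁₁ v).symm) (h₂.trans (hπ₁₂ v).symm)
  have heq₂ : ∀ c ∈ C, ∀ v : ℤ, E₁ c = 0 → E₂ c = (g ^ v : Kˣ) → c = π₂ v :=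
    fun c hc v h₁ h₂ => h.inj _ hc _ (hπC₂ v) (h₁.trans (hπ₂₁ v).symm) (h₂.trans (hπ₂₂ v).symm)
  have hfin : (AddSubgroup.zmultiples (ConstacyclicRing.gcd₃ N s x₁ : ℤ)).FiniteIndex := by
    refine ⟨?_⟩
    rw [Int.index_zmultiples, Int.natAbs_natCast, ConstacyclicRing.gcd₃, Ne, Int.gcd_eq_zero_iff]
    rintro ⟨h₁, -⟩
    exact h.pos.ne' (Int.gcd_eq_zero_iff.mp (by exact_mod_cast h₁)).1
  have hμ₁ : ∀ v, μ • π₁ v = π₂ v := by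
    intro v
    obtain ⟨h₀, h₁, h₂⟩ := hμ (π₁ v) (hπC₁ v)
    refine heq₂ _ h₀ _ ?_ ?_
    · rw [h₁, hπ₁₂, zero_pow hq.ne']
    · rw [h₂, hπ₁₁]
  have hμ₂ : ∀ v, μ • π₂ v = π₁ (q * v) := by
    intro v
    obtain ⟨h₀, h₁, h₂⟩ := hμ (π₂ v) (hπC₂ v)
    refine heq₁ _ h₀ _ ?_ ?_
    · rw [h₁, hπ₂₂, ← Units.val_pow_eq_pow_val, ← zpow_natCast, ← zpow_mul, mul_comm]
    · rw [h₂, hπ₂₁]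
  have hμS : μ ∈ Subgroup.closure {μ, ρ, σ} := Subgroup.subset_closure (by simp)
  have horb₁₂ : ∀ v, MulAction.orbit (Subgroup.closure {μ, ρ, σ}) (π₂ v) =
      MulAction.orbit (Subgroup.closure {μ, ρ, σ}) (π₁ v) := by
    intro v
    rw [MulAction.orbit_eq_iff]
    exact ⟨⟨μ, hμS⟩, hμ₁ v⟩
  have horb : ∀ y, MulAction.orbit (Subgroup.closure {μ, ρ, σ}) (π y) =
      MulAction.orbit (Subgroup.closure {μ, ρ, σ}) (π₁ (lab y)) := by
    rintro (v | v)
    · rfl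
    · exact horb₁₂ v
  rw [hrange]
  rw [ncard_orbit_image_mul {μ, ρ, σ} π lab (fun v => ⟨Sum.inl v, rfl⟩)
    (AddSubgroup.zmultiples (ConstacyclicRing.gcd₃ N s x₁ : ℤ)) ((q : ℤ) : AddMonoid.End ℤ)
    (fun v hv => intCast_mem_of_mem _ _ hv) k hk ?_ _
    (fun i v => mem_zmultiples_gcd₃_pow_iff N s x₁ q i v)]
  · refine Finset.sum_congr rfl fun i _ => ?_
    rw [Int.index_zmultiples, Int.natAbs_natCast, hN, Int.gcd_pow_sub_one hq]
  · rintro a (rfl | rfl | rfl) (v | v)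
    · exact ⟨Sum.inr v, hμ₁ v, Or.inl (by simp [lab])⟩
    · exact ⟨Sum.inl (q * v), hμ₂ v, Or.inr (by simp [lab])⟩
    · obtain ⟨h₀, h₁, h₂⟩ := h.shift (π₁ v) (hπC₁ v)
      refine ⟨Sum.inl (x₁ + v), heq₁ _ h₀ _ ?_ ?_, Or.inl ?_⟩
      · rw [h₁, hπ₁₁, ← Units.val_mul, zpow_add]
      · rw [h₂, hπ₁₂, mul_zero]
      · rw [Int.mem_zmultiples_gcd₃_iff]
        exact ⟨0, 0, 1, by simp [lab]⟩
    · obtain ⟨h₀, h₁, h₂⟩ := h.shift (π₂ v) (hπC₂ v)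
      -- On the second axis ρ translates by x₂. As x₁ divides x₂, this adds nothing to the lattice
      -- of the first axis.
      refine ⟨Sum.inr (x₁ * b + v), heq₂ _ h₀ _ ?_ ?_, Or.inl ?_⟩
      · rw [h₁, hπ₂₁, mul_zero]
      · rw [h₂, hπ₂₂, ← Units.val_mul, zpow_add]
      · rw [Int.mem_zmultiples_gcd₃_iff]
        exact ⟨0, 0, b, by simp [lab]⟩
    · obtain ⟨γ, ⟨t, ht⟩, -, hγ⟩ := h.scalar
      obtain ⟨h₀, h₁, h₂⟩ := hγ (π₁ v) (hπC₁ v)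
      refine ⟨Sum.inl (t * s + v), heq₁ _ h₀ _ ?_ ?_, Or.inl ?_⟩
      · rw [h₁, hπ₁₁, ht, ← Units.val_mul, zpow_add]
      · rw [h₂, hπ₁₂, mul_zero]
      · rw [Int.mem_zmultiples_gcd₃_iff]
        exact ⟨0, t, 0, by simp [lab, mul_comm]⟩
    · obtain ⟨γ, ⟨t, ht⟩, -, hγ⟩ := h.scalar
      obtain ⟨h₀, h₁, h₂⟩ := hγ (π₂ v) (hπC₂ v)
      refine ⟨Sum.inr (t * s + v), heq₂ _ h₀ _ ?_ ?_, Or.inl ?_⟩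
      · rw [h₁, hπ₂₁, mul_zero]
      · rw [h₂, hπ₂₂, ht, ← Units.val_mul, zpow_add]
      · rw [Int.mem_zmultiples_gcd₃_iff]
        exact ⟨0, t, 0, by simp [lab, mul_comm]⟩
  · intro y z hyz
    rw [← MulAction.orbit_eq_iff, horb, horb, MulAction.orbit_eq_iff]
    obtain ⟨c, β, α, hyz⟩ := (Int.mem_zmultiples_gcd₃_iff _ _ _ _).mp hyz
    obtain ⟨a, ha, hat⟩ := h.exists_translation {μ, ρ, σ} (by simp) (by simp) α β
    obtain ⟨h₀, h₁', h₂'⟩ := hat (π₁ (lab y)) (hπC₁ _)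
    refine ⟨⟨a, ha⟩, heq₁ _ h₀ _ ?_ ?_⟩
    · rw [h₁', hπ₁₁, ← Units.val_mul, ← zpow_add, Units.val_inj, eq_comm, h.zpow_eq_zpow]
      exact ⟨c, by linear_combination hyz⟩
    · rw [h₂', hπ₁₂, mul_zero]
  · intro y
    refine ⟨Sum.inl (q * lab y), by simp [lab], ?_⟩
    rw [← MulAction.orbit_eq_iff, horb y, ← horb₁₂ (lab y), MulAction.orbit_eq_iff]
    exact ⟨⟨μ, hμS⟩, hμ₂ _⟩
  · have key : ∀ v w : ℤ, g ^ v = g ^ w → w - v ∈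
        AddSubgroup.zmultiples (ConstacyclicRing.gcd₃ N s x₁ : ℤ) := by
      intro v w h₁
      rw [eq_comm, h.zpow_eq_zpow] at h₁
      obtain ⟨c, hc⟩ := h₁
      rw [Int.mem_zmultiples_gcd₃_iff]
      exact ⟨c, 0, 0, by simpa using hc⟩
    rintro (v | v) (w | w) hvw
    · refine key v w ?_
      rw [← Units.val_inj, ← hπ₁₁, ← hπ₁₁]
      exact congrArg E₁ hvw
    · have := hπ₁₁ v
      rw [show π₁ v = π₂ w from hvw, hπ₂₁] at this
      exact absurd this.symm (Units.ne_zero _)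
    · have := hπ₂₂ v
      rw [show π₂ v = π₁ w from hvw, hπ₁₂] at this
      exact absurd this.symm (Units.ne_zero _)
    · refine key v w ?_
      rw [← Units.val_inj, ← hπ₂₂, ← hπ₂₂]
      exact congrArg E₂ hvw
  · intro v
    rw [AddMonoid.End.intCast_pow_apply, Int.mem_zmultiples_gcd₃_iff]
    exact ⟨v, 0, 0, by rw [hN, smul_eq_mul]; ring⟩

end PairModel

end PairModels

/-! ### Assembling the closed orbit formulas. -/

/-- Exactly φ(k/h) indices i < k have gcd(k, i) = h; the index i = 0 accounts for h = k. -/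
theorem Finset.sum_range_comp_gcd {M : Type*} [AddCommMonoid M] {k : ℕ} (hk : 0 < k) (f : ℕ → M) :
    ∑ i ∈ Finset.range k, f (Nat.gcd k i) = ∑ h ∈ k.divisors, Nat.totient (k / h) • f h := by
  rw [← Finset.sum_fiberwise_of_maps_to (g := Nat.gcd k) (t := k.divisors)
    fun i _ => Nat.mem_divisors.mpr ⟨Nat.gcd_dvd_left k i, hk.ne'⟩]
  refine Finset.sum_congr rfl fun h hh => ?_
  rw [Nat.totient_div_of_dvd (Nat.dvd_of_mem_divisors hh), ← Finset.sum_const]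
  exact Finset.sum_congr rfl fun i hi => by rw [(Finset.mem_filter.mp hi).2]

theorem Finset.sum_range_two_mul {M : Type*} [AddCommMonoid M] (f : ℕ → M) (m : ℕ) :
    ∑ i ∈ Finset.range (2 * m), f i = ∑ h ∈ Finset.range m, (f (2 * h + 1) + f (2 * h)) := by
  induction m with
  | zero => simp
  | succ m ih =>
    rw [show 2 * (m + 1) = 2 * m + 1 + 1 from by ring, Finset.sum_range_succ,
      Finset.sum_range_succ, ih, Finset.sum_range_succ, add_assoc, add_comm (f (2 * m))]

/-- As Z is stable under the group, no orbit of a point of Z reaches a point of Z'. -/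
theorem ncard_orbit_image_union {G X : Type*} [Group G] [Finite G] [MulAction G X] [Finite X]
    (S : Set G) {Z Z' : Set X} (hZ : ∀ a ∈ S, ∀ c ∈ Z, a • c ∈ Z) (hd : Disjoint Z Z') :
    ((fun c => MulAction.orbit (Subgroup.closure S) c) '' (Z ∪ Z')).ncard =
      ((fun c => MulAction.orbit (Subgroup.closure S) c) '' Z).ncard +
        ((fun c => MulAction.orbit (Subgroup.closure S) c) '' Z').ncard := by
  have hmem : ∀ a ∈ Subgroup.closure S, ∀ c ∈ Z, a • c ∈ Z := by
    intro a ha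
    rw [← Subgroup.mem_toSubmonoid, Subgroup.closure_toSubmonoid_of_finite] at ha
    induction ha using Submonoid.closure_induction with
    | mem a ha => exact hZ a ha
    | one => exact fun c hc => by rwa [one_smul]
    | mul a b _ _ iha ihb =>
      intro c hc
      rw [mul_smul]
      exact iha _ (ihb c hc)
  rw [Set.image_union, Set.ncard_union_eq _ (Set.toFinite _) (Set.toFinite _)]
  rw [Set.disjoint_left]
  rintro _ ⟨c, hc, rfl⟩ ⟨c', hc', h⟩
  obtain ⟨⟨a, ha⟩, hac⟩ := MulAction.orbit_eq_iff.mp h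
  refine Set.disjoint_left.mp hd (hmem a ha c hc) ?_
  change a • c = c' at hac
  rwa [hac]

theorem pairLattice_finiteIndex {D : ℤ} (hD : D ≠ 0) (s x₁ x₂ : ℤ) :
    (pairLattice D s x₁ x₂).FiniteIndex := by
  refine ⟨?_⟩
  rw [pairLattice_index hD, Ne, Int.gcd_eq_zero_iff]
  rintro ⟨h, -⟩
  have h₁ := (mul_eq_zero.mp h).resolve_left hD
  have h₂ := (Int.gcd_eq_zero_iff.mp (by exact_mod_cast h₁ : Int.gcd _ _ = 0)).1
  have h₃ := (Int.gcd_eq_zero_iff.mp (by exact_mod_cast h₂ : Int.gcd _ _ = 0)).1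
  exact hD (Int.gcd_eq_zero_iff.mp (by exact_mod_cast h₃ : Int.gcd _ _ = 0)).1

namespace PairModel

variable {X K G : Type*} [Field K] [Group G] [MulAction G X] {C : Set X}
    {E₁ E₂ : X → K} {g : Kˣ} {N s x₁ x₂ : ℤ} {ρ σ : G}

/-- The divisor sum counts the pairs with exactly one zero entry. The sum over h < m counts the
others, by Burnside over the 2m powers of the twisted swap, odd and even powers being paired; indeed
T^(2m) = q^m is trivial modulo N because k divides m. -/
theorem ncard_orbits_twisted [Finite G] [Finite X] (h : PairModel C E₁ E₂ g N s x₁ x₂ ρ σ) (μ : G)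
    {q : ℕ} (hq : 1 < q)
    (hμ : ∀ c ∈ C, μ • c ∈ C ∧ E₁ (μ • c) = E₂ c ^ q ∧ E₂ (μ • c) = E₁ c)
    {k m : ℕ} (hk : 0 < k) (hm : 0 < m) (hkm : k ∣ m) (hN : N = (q : ℤ) ^ k - 1)
    (hs : N = s * (q - 1)) {b' β : ℤ} (hx : x₂ = b' * x₁)
    (h₁ : N ∣ q * x₂ - β * x₁) (h₂ : N ∣ x₁ - β * x₂) :
    (((fun c => MulAction.orbit (Subgroup.closure {μ, ρ, σ}) c) ''
        {c | c ∈ C ∧ ¬(E₁ c = 0 ∧ E₂ c = 0)}).ncard : ℚ) =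
      1 / k * ∑ h ∈ k.divisors, (Nat.totient (k / h) : ℚ) *
          ConstacyclicRing.gcd₃ ((q : ℤ) ^ h - 1) s x₁
        + 1 / (2 * m) * ∑ h ∈ Finset.range m,
          ((ConstacyclicRing.gcd₃ ((q : ℤ) ^ Nat.gcd k (2 * h + 1) - 1) (2 * s)
              (x₂ + q ^ h * x₁) : ℚ)
            + Int.gcd (((q : ℤ) ^ Nat.gcd k h - 1) *
                ConstacyclicRing.gcd₃ ((q : ℤ) ^ Nat.gcd k h - 1) s x₁) (s * (x₂ - x₁))) := by
  have hq0 : 0 < q := hq.trans' zero_lt_one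
  have hset : {c | c ∈ C ∧ ¬(E₁ c = 0 ∧ E₂ c = 0)} =
      {c | c ∈ C ∧ ((E₁ c ≠ 0 ∧ E₂ c = 0) ∨ (E₁ c = 0 ∧ E₂ c ≠ 0))} ∪
        {c | c ∈ C ∧ E₁ c ≠ 0 ∧ E₂ c ≠ 0} := by
    ext c
    simp only [Set.mem_union, Set.mem_ofPred_eq]
    tauto
  have hax := h.ncard_orbits_axes μ q hμ hq0 k hk hN ⟨b', by rw [hx, mul_comm]⟩
  rw [Finset.sum_range_comp_gcd hk (fun i => ConstacyclicRing.gcd₃ ((q : ℤ) ^ i - 1) s x₁)] at hax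
  have hNm : N ∣ (q : ℤ) ^ m - 1 := by
    rw [hN]
    obtain ⟨c, rfl⟩ := hkm
    rw [pow_mul]
    exact sub_one_dvd_pow_sub_one _ _
  have hfi := pairLattice_finiteIndex h.pos.ne' s x₁ x₂
  have hun := h.ncard_orbits_units μ (twistedSwap q) (fun c hc v hv₁ hv₂ => by
      obtain ⟨h₀, h₁, h₂⟩ := hμ c hc
      refine ⟨h₀, ?_, ?_⟩
      · rw [h₁, hv₂, twistedSwap_apply, ← Units.val_pow_eq_pow_val, ← zpow_natCast, ← zpow_mul,
          mul_comm]
      · rw [h₂, hv₁, twistedSwap_apply])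
    (fun v hv => twistedSwap_mem_pairLattice hs h₁ h₂ hv) (2 * m) (by omega) (fun v => by
      obtain ⟨c, hc⟩ := hNm
      rw [twistedSwap_pow_two_mul]
      refine ⟨0, 0, ⟨c * v.1, ?_⟩, ⟨c * v.2, ?_⟩⟩
      · rw [Prod.fst_sub, Prod.smul_fst, smul_eq_mul]
        linear_combination v.1 * hc
      · rw [Prod.snd_sub, Prod.smul_snd, smul_eq_mul]
        linear_combination v.2 * hc)
    (fun i => if i % 2 = 0 then pairLattice (Int.gcd N ((q : ℤ) ^ (i / 2) - 1)) s x₁ x₂ else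
      slopeLattice (ConstacyclicRing.gcd₃ (Int.gcd N ((q : ℤ) ^ i - 1)) (2 * s)
        (x₂ + q ^ (i / 2) * x₁)) (q ^ (i / 2))) (fun i v => by
      rcases Nat.even_or_odd' i with ⟨h, rfl | rfl⟩
      · rw [if_pos (by omega), mem_pairLattice_gcd_iff, show 2 * h / 2 = h from by omega]
        simp only [twistedSwap_pow_two_mul]
      · rw [if_neg (by omega), show (2 * h + 1) / 2 = h from by omega]
        exact mem_slopeLattice_iff_twistedSwap hs h v)
  rw [Finset.sum_range_two_mul] at hun
  have hterm : ∀ h ∈ Finset.range m,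
      ((if (2 * h + 1) % 2 = 0 then
        pairLattice (Int.gcd N ((q : ℤ) ^ ((2 * h + 1) / 2) - 1)) s x₁ x₂ else
        slopeLattice (ConstacyclicRing.gcd₃ (Int.gcd N ((q : ℤ) ^ (2 * h + 1) - 1)) (2 * s)
          (x₂ + q ^ ((2 * h + 1) / 2) * x₁)) (q ^ ((2 * h + 1) / 2))).index +
      (if 2 * h % 2 = 0 then pairLattice (Int.gcd N ((q : ℤ) ^ (2 * h / 2) - 1)) s x₁ x₂ else
        slopeLattice (ConstacyclicRing.gcd₃ (Int.gcd N ((q : ℤ) ^ (2 * h) - 1)) (2 * s)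
          (x₂ + q ^ (2 * h / 2) * x₁)) (q ^ (2 * h / 2))).index) =
      ConstacyclicRing.gcd₃ ((q : ℤ) ^ Nat.gcd k (2 * h + 1) - 1) (2 * s) (x₂ + q ^ h * x₁) +
        Int.gcd (((q : ℤ) ^ Nat.gcd k h - 1) *
          ConstacyclicRing.gcd₃ ((q : ℤ) ^ Nat.gcd k h - 1) s x₁) (s * (x₂ - x₁)) := by
    intro h _
    rw [if_neg (by omega), if_pos (by omega), show (2 * h + 1) / 2 = h from by omega,
      show 2 * h / 2 = h from by omega, slopeLattice_index, Int.natAbs_natCast, hN,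
      Int.gcd_pow_sub_one hq0, Int.gcd_pow_sub_one hq0, pairLattice_index, hx]
    -- The index formula also contains x₂ in the inner gcd, but x₂ = b'x₁ is already a multiple of
    -- that gcd.
    · congr 4
      have hd : (ConstacyclicRing.gcd₃ ((q : ℤ) ^ Nat.gcd k h - 1) s x₁ : ℤ) ∣ b' * x₁ :=
        Dvd.dvd.mul_left (Int.gcd_dvd_right ..) b'
      rw [Int.gcd_eq_natAbs_left hd, Int.natAbs_natCast]
    · have h1 : 1 < (q : ℤ) ^ Nat.gcd k h :=
        one_lt_pow₀ (by exact_mod_cast hq) (Nat.gcd_pos_of_pos_left _ hk).ne'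
      omega
  rw [Finset.sum_congr rfl hterm] at hun
  rw [hset, ncard_orbit_image_union {μ, ρ, σ}]
  · have hk' : (k : ℚ) ≠ 0 := by exact_mod_cast hk.ne'
    have hm' : (m : ℚ) ≠ 0 := by exact_mod_cast hm.ne'
    have hax' := congrArg (Nat.cast : ℕ → ℚ) hax
    have hun' := congrArg (Nat.cast : ℕ → ℚ) hun
    push_cast [smul_eq_mul] at hax' hun' ⊢
    rw [← hax', ← hun']
    field_simp
  · rintro a (rfl | rfl | rfl) c ⟨hc, hc'⟩
    · obtain ⟨h₀, h₁, h₂⟩ := hμ c hc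
      refine ⟨h₀, ?_⟩
      rw [h₁, h₂, pow_eq_zero_iff hq0.ne', Ne, pow_eq_zero_iff hq0.ne']
      tauto
    · obtain ⟨h₀, h₁, h₂⟩ := h.shift c hc
      exact ⟨h₀, by rwa [h₁, h₂, Ne, Ne, Units.mul_right_eq_zero, Units.mul_right_eq_zero]⟩
    · obtain ⟨γ, -, -, hγ⟩ := h.scalar
      obtain ⟨h₀, h₁, h₂⟩ := hγ c hc
      exact ⟨h₀, by rwa [h₁, h₂, Ne, Ne, Units.mul_right_eq_zero, Units.mul_right_eq_zero]⟩
  · rw [Set.disjoint_left]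
    rintro c ⟨_, hc⟩ ⟨_, hc'⟩
    tauto

/-- The Frobenius does not exchange the two entries, so the axes are counted separately, the second
one through the swapped model. -/
theorem ncard_orbits_frobenius [Finite G] [Finite X] (h : PairModel C E₁ E₂ g N s x₁ x₂ ρ σ)
    (μ : G) {q : ℕ} (hq : 1 < q)
    (hμ : ∀ c ∈ C, μ • c ∈ C ∧ E₁ (μ • c) = E₁ c ^ q ∧ E₂ (μ • c) = E₂ c ^ q)
    {k : ℕ} (hk : 0 < k) (hN : N = (q : ℤ) ^ k - 1) :
    (((fun c => MulAction.orbit (Subgroup.closure {μ, ρ, σ}) c) ''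
        {c | c ∈ C ∧ ¬(E₁ c = 0 ∧ E₂ c = 0)}).ncard : ℚ) =
      1 / k * ∑ h ∈ k.divisors, (Nat.totient (k / h) : ℚ) *
          (ConstacyclicRing.gcd₃ ((q : ℤ) ^ h - 1) s x₁
            + ConstacyclicRing.gcd₃ ((q : ℤ) ^ h - 1) s x₂
            + Int.gcd (((q : ℤ) ^ h - 1) *
                Int.gcd (ConstacyclicRing.gcd₃ ((q : ℤ) ^ h - 1) s x₁) x₂) (s * (x₂ - x₁))) := by
  have hq0 : 0 < q := hq.trans' zero_lt_one
  have hset : {c | c ∈ C ∧ ¬(E₁ c = 0 ∧ E₂ c = 0)} =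
      {c | c ∈ C ∧ E₁ c ≠ 0 ∧ E₂ c = 0} ∪ ({c | c ∈ C ∧ E₂ c ≠ 0 ∧ E₁ c = 0} ∪
        {c | c ∈ C ∧ E₁ c ≠ 0 ∧ E₂ c ≠ 0}) := by
    ext c
    simp only [Set.mem_union, Set.mem_ofPred_eq]
    tauto
  have hl := h.ncard_orbits_left μ q hμ hq0 k hk hN
  have hr := h.swap.ncard_orbits_left μ q
    (fun c hc => ⟨(hμ c hc).1, (hμ c hc).2.2, (hμ c hc).2.1⟩) hq0 k hk hN
  rw [Finset.sum_range_comp_gcd hk (fun i => ConstacyclicRing.gcd₃ ((q : ℤ) ^ i - 1) s _)] at hl hr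
  have hfi := pairLattice_finiteIndex h.pos.ne' s x₁ x₂
  have hun := h.ncard_orbits_units μ ((q : ℤ) : AddMonoid.End (ℤ × ℤ)) (fun c hc v hv₁ hv₂ => by
      obtain ⟨h₀, h₁, h₂⟩ := hμ c hc
      rw [AddMonoid.End.intCast_apply]
      refine ⟨h₀, ?_, ?_⟩
      · rw [h₁, hv₁, Prod.smul_fst, smul_eq_mul, ← Units.val_pow_eq_pow_val, ← zpow_natCast,
          ← zpow_mul, mul_comm]
      · rw [h₂, hv₂, Prod.smul_snd, smul_eq_mul, ← Units.val_pow_eq_pow_val, ← zpow_natCast,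
          ← zpow_mul, mul_comm])
    (fun v hv => intCast_mem_of_mem _ _ hv) k hk (fun v => by
      rw [AddMonoid.End.intCast_pow_apply]
      refine ⟨0, 0, ⟨v.1, ?_⟩, ⟨v.2, ?_⟩⟩
      · rw [Prod.fst_sub, Prod.smul_fst, smul_eq_mul, hN]
        ring
      · rw [Prod.snd_sub, Prod.smul_snd, smul_eq_mul, hN]
        ring)
    (fun i => pairLattice (Int.gcd N ((q : ℤ) ^ i - 1)) s x₁ x₂) (fun i v => by
      rw [mem_pairLattice_gcd_iff]
      simp only [AddMonoid.End.intCast_pow_apply])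
  have hterm : ∀ i ∈ Finset.range k,
      (pairLattice (Int.gcd N ((q : ℤ) ^ i - 1)) s x₁ x₂).index =
      Int.gcd (((q : ℤ) ^ Nat.gcd k i - 1) *
        Int.gcd (ConstacyclicRing.gcd₃ ((q : ℤ) ^ Nat.gcd k i - 1) s x₁) x₂) (s * (x₂ - x₁)) := by
    intro i _
    rw [hN, Int.gcd_pow_sub_one hq0, pairLattice_index]
    have h1 : 1 < (q : ℤ) ^ Nat.gcd k i :=
      one_lt_pow₀ (by exact_mod_cast hq) (Nat.gcd_pos_of_pos_left _ hk).ne'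
    omega
  rw [Finset.sum_congr rfl hterm, Finset.sum_range_comp_gcd hk (fun i =>
    Int.gcd (((q : ℤ) ^ i - 1) *
        Int.gcd (ConstacyclicRing.gcd₃ ((q : ℤ) ^ i - 1) s x₁) x₂) (s * (x₂ - x₁)))] at hun
  have hstab : ∀ a ∈ ({μ, ρ, σ} : Set G), ∀ c ∈ C, a • c ∈ C ∧ (E₁ (a • c) = 0 ↔ E₁ c = 0) ∧
      (E₂ (a • c) = 0 ↔ E₂ c = 0) := by
    rintro a (rfl | rfl | rfl) c hc
    · obtain ⟨h₀, h₁, h₂⟩ := hμ c hc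
      rw [h₁, h₂, pow_eq_zero_iff hq0.ne', pow_eq_zero_iff hq0.ne']
      tauto
    · obtain ⟨h₀, h₁, h₂⟩ := h.shift c hc
      exact ⟨h₀, by rw [h₁, Units.mul_right_eq_zero], by rw [h₂, Units.mul_right_eq_zero]⟩
    · obtain ⟨γ, -, -, hγ⟩ := h.scalar
      obtain ⟨h₀, h₁, h₂⟩ := hγ c hc
      exact ⟨h₀, by rw [h₁, Units.mul_right_eq_zero], by rw [h₂, Units.mul_right_eq_zero]⟩
  rw [hset, ncard_orbit_image_union {μ, ρ, σ}, ncard_orbit_image_union {μ, ρ, σ}]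
  · have hk' : (k : ℚ) ≠ 0 := by exact_mod_cast hk.ne'
    have hl' := congrArg (Nat.cast : ℕ → ℚ) hl
    have hr' := congrArg (Nat.cast : ℕ → ℚ) hr
    have hun' := congrArg (Nat.cast : ℕ → ℚ) hun
    simp only [mul_add, Finset.sum_add_distrib]
    push_cast [smul_eq_mul] at hl' hr' hun' ⊢
    rw [← hl', ← hr', ← hun']
    field_simp
    ring
  · rintro a ha c ⟨hc, hc'⟩
    obtain ⟨h₀, h₁, h₂⟩ := hstab a ha c hc
    exact ⟨h₀, by rwa [Ne, h₁, h₂]⟩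
  · rw [Set.disjoint_left]
    rintro c ⟨_, hc⟩ ⟨_, hc'⟩
    tauto
  · rintro a ha c ⟨hc, hc'⟩
    obtain ⟨h₀, h₁, h₂⟩ := hstab a ha c hc
    exact ⟨h₀, by rwa [Ne, h₁, h₂]⟩
  · rw [Set.disjoint_left]
    rintro c ⟨_, hc⟩ (⟨_, hc'⟩ | ⟨_, hc'⟩) <;> tauto

end PairModel

namespace ConstacyclicRing

/-! ### Weights under monomial maps, and normal forms in the automorphism group. -/

section Scalars

variable {F : Type*} [Field F] {lam : Fˣ} {n : ℕ}

theorem x_pow_eq_smul (i : ℕ) :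
    x lam n ^ i = ((lam ^ (i / n) : Fˣ) : F) • x lam n ^ (i % n) := by
  conv_lhs => rw [← Nat.div_add_mod i n, pow_add, pow_mul, x_pow_n, ← map_pow]
  rw [Algebra.smul_def, Units.val_pow_eq_pow_val]

theorem scalar_apply (ξ : Fˣ) (c : ConstacyclicRing lam n) : scalar lam n ξ c = (ξ : F) • c := rfl

theorem scalar_pow (ξ : Fˣ) (j : ℕ) : scalar lam n ξ ^ j = scalar lam n (ξ ^ j) := by
  induction j with
  | zero =>
    refine LinearEquiv.ext fun c => ?_
    rw [pow_zero, pow_zero, scalar_apply, Units.val_one, one_smul]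
    rfl
  | succ j ih =>
    refine LinearEquiv.ext fun c => ?_
    rw [pow_succ, ih, pow_succ, scalar_apply, Units.val_mul, mul_smul]
    rfl

theorem scalar_mul_comm (ξ : Fˣ) (φ : ConstacyclicRing lam n ≃ₗ[F] ConstacyclicRing lam n) :
    scalar lam n ξ * φ = φ * scalar lam n ξ := by
  refine LinearEquiv.ext fun c => ?_
  change (ξ : F) • φ c = φ ((ξ : F) • c)
  rw [map_smul]

end Scalars

section Weight

variable {F : Type*} [Field F] {lam : Fˣ} {n : ℕ} [NeZero n]

theorem exists_sum_eq (c : ConstacyclicRing lam n) :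
    ∃ (s : Finset ℕ) (a : ℕ → F), (∀ i ∈ s, i < n) ∧ (∀ i ∈ s, a i ≠ 0) ∧
      c = ∑ i ∈ s, a i • x lam n ^ i ∧ weight c = s.card := by
  have hm := monic_X_pow_sub_C (lam : F) (NeZero.ne n)
  refine ⟨(AdjoinRoot.modByMonicHom hm c).support, (AdjoinRoot.modByMonicHom hm c).coeff,
    fun i hi => ?_, fun i hi => mem_support_iff.mp hi, ?_, rfl⟩
  · obtain ⟨f, rfl⟩ := AdjoinRoot.mk_surjective c
    rw [AdjoinRoot.modByMonicHom_mk] at hi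
    have h1 := le_degree_of_mem_supp _ hi
    have h2 := degree_modByMonic_lt f hm
    rw [degree_X_pow_sub_C (NeZero.pos n)] at h2
    exact_mod_cast h1.trans_lt h2
  · conv_lhs => rw [← AdjoinRoot.mk_leftInverse hm c]
    conv_lhs => rw [(AdjoinRoot.modByMonicHom hm c).as_sum_support_C_mul_X_pow]
    rw [map_sum]
    refine Finset.sum_congr rfl fun i _ => ?_
    rw [map_mul, map_pow, AdjoinRoot.mk_X, AdjoinRoot.mk_C, Algebra.smul_def]
    rfl

theorem weight_sum (s : Finset ℕ) (a : ℕ → F) (τ : ℕ → ℕ) (hτ : ∀ i ∈ s, τ i < n)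
    (hinj : Set.InjOn τ s) (ha : ∀ i ∈ s, a i ≠ 0) :
    weight (∑ i ∈ s, a i • x lam n ^ τ i) = s.card := by
  have hm := monic_X_pow_sub_C (lam : F) (NeZero.ne n)
  have h1 : ∑ i ∈ s, a i • x lam n ^ τ i =
      AdjoinRoot.mk (X ^ n - C (lam : F)) (∑ i ∈ s, C (a i) * X ^ τ i) := by
    rw [map_sum]
    refine Finset.sum_congr rfl fun i _ => ?_
    rw [map_mul, map_pow, AdjoinRoot.mk_X, AdjoinRoot.mk_C, Algebra.smul_def]
    rfl
  have hcoeff : ∀ j, (∑ i ∈ s, C (a i) * X ^ τ i).coeff j =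
      ∑ i ∈ s, if j = τ i then a i else 0 := by
    intro j
    rw [finsetSum_coeff]
    exact Finset.sum_congr rfl fun i _ => coeff_C_mul_X_pow _ _ _
  have hsupp : (∑ i ∈ s, C (a i) * X ^ τ i).support = s.image τ := by
    ext j
    rw [mem_support_iff, hcoeff, Finset.mem_image]
    constructor
    · intro h
      obtain ⟨i, hi, h'⟩ := Finset.exists_ne_zero_of_sum_ne_zero h
      exact ⟨i, hi, by by_contra hne; exact h' (if_neg (Ne.symm hne))⟩
    · rintro ⟨i, hi, rfl⟩
      rw [Finset.sum_eq_single_of_mem i hi fun j hj hji =>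
        if_neg fun h => hji (hinj hj hi h.symm), if_pos rfl]
      exact ha i hi
  have hdeg : (∑ i ∈ s, C (a i) * X ^ τ i).degree < (X ^ n - C (lam : F)).degree := by
    rw [degree_X_pow_sub_C (NeZero.pos n), degree_lt_iff_coeff_zero]
    intro j hj
    by_contra h
    rw [← Ne, ← mem_support_iff, hsupp, Finset.mem_image] at h
    obtain ⟨i, hi, rfl⟩ := h
    exact absurd (hτ i hi) (not_lt.mpr (by exact_mod_cast hj))
  rw [weight, h1, AdjoinRoot.modByMonicHom_mk, (modByMonic_eq_self_iff hm).mpr hdeg, hsupp,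
    Finset.card_image_of_injOn hinj]

/-- A map permuting the monomials of degree less than n up to nonzero scalars permutes the nonzero
coefficients; all three generators are of this kind. -/
theorem weight_apply_eq (φ : ConstacyclicRing lam n →ₗ[F] ConstacyclicRing lam n) (τ : ℕ → ℕ)
    (hτ : ∀ i < n, τ i < n) (hinj : Set.InjOn τ (Set.Iio n))
    (hφ : ∀ i < n, ∃ u : F, u ≠ 0 ∧ φ (x lam n ^ i) = u • x lam n ^ τ i)
    (c : ConstacyclicRing lam n) : weight (φ c) = weight c := by
  obtain ⟨s, a, hs, ha, hc, hw⟩ := exists_sum_eq c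
  choose! u hu hφu using hφ
  rw [hw, hc, map_sum, ← weight_sum s (fun i => a i * u i) τ (fun i hi => hτ i (hs i hi))
    (hinj.mono fun i hi => hs i hi) fun i hi => mul_ne_zero (ha i hi) (hu i (hs i hi))]
  congr 1
  refine Finset.sum_congr rfl fun i hi => ?_
  rw [map_smul, hφu i (hs i hi), smul_smul]

theorem weight_scalar (ξ : Fˣ) (c : ConstacyclicRing lam n) : weight (scalar lam n ξ c) = weight c :=
  weight_apply_eq (scalar lam n ξ).toLinearMap id (fun _ h => h) (fun _ _ _ _ h => h)
    (fun _ _ => ⟨ξ, ξ.ne_zero, rfl⟩) c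

variable [Finite F]

theorem shift_apply (c : ConstacyclicRing lam n) : shift lam n c = x lam n * c := rfl

theorem weight_shift (c : ConstacyclicRing lam n) : weight (shift lam n c) = weight c := by
  refine weight_apply_eq (shift lam n).toLinearMap (fun i => (i + 1) % n)
    (fun _ _ => Nat.mod_lt _ (NeZero.pos n)) ?_
    (fun i _ => ⟨_, (lam ^ ((i + 1) / n)).ne_zero, ?_⟩) c
  · intro i hi j hj hij
    have : i + 1 ≡ j + 1 [MOD n] := hij
    have h := Nat.ModEq.add_right_cancel' 1 this
    rwa [Nat.ModEq, Nat.mod_eq_of_lt hi, Nat.mod_eq_of_lt hj] at h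
  · rw [← x_pow_eq_smul, pow_succ']
    rfl

theorem multiplier_x_pow (a : multiplierGroup lam n) (i : ℕ) :
    multiplier lam n a (x lam n ^ i) = x lam n ^ (rep lam n a * i) := by
  change multiplierHom lam n a (x lam n ^ i) = _
  rw [map_pow, multiplierHom_x, ← pow_mul]

theorem rep_coprime (a : multiplierGroup lam n) : (rep lam n a).Coprime n := by
  have h : IsUnit ((rep lam n a : ℕ) : ZMod (orderOf lam * n)) := by
    rw [cast_rep]
    exact Units.isUnit _
  exact Nat.Coprime.coprime_mul_left_right ((ZMod.isUnit_iff_coprime _ _).mp h)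

theorem weight_multiplier (a : multiplierGroup lam n) (c : ConstacyclicRing lam n) :
    weight (multiplier lam n a c) = weight c := by
  refine weight_apply_eq (multiplier lam n a).toLinearMap (fun i => (rep lam n a * i) % n)
    (fun _ _ => Nat.mod_lt _ (NeZero.pos n)) ?_
    (fun i _ => ⟨_, (lam ^ ((rep lam n a * i) / n)).ne_zero, ?_⟩) c
  · intro i hi j hj hij
    have : rep lam n a * i ≡ rep lam n a * j [MOD n] := hij
    have h := Nat.ModEq.cancel_left_of_coprime (rep_coprime a).symm this
    rwa [Nat.ModEq, Nat.mod_eq_of_lt hi, Nat.mod_eq_of_lt hj] at h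
  · rw [← x_pow_eq_smul]
    exact multiplier_x_pow a i

theorem multiplier_mul_apply (a b : multiplierGroup lam n) (c : ConstacyclicRing lam n) :
    multiplier lam n a (multiplier lam n b c) = multiplier lam n (a * b) c := by
  have h : (multiplierHom lam n a).comp (multiplierHom lam n b) = multiplierHom lam n (a * b) := by
    refine AdjoinRoot.algHom_ext ?_
    rw [AlgHom.comp_apply, multiplierHom_x, map_pow, multiplierHom_x, ← pow_mul, multiplierHom_x]
    apply x_pow_eq_of_cast_eq
    rw [Nat.cast_mul, cast_rep, cast_rep, cast_rep, Subgroup.coe_mul, Units.val_mul]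
  exact DFunLike.congr_fun h c

theorem multiplier_mul (a b : multiplierGroup lam n) :
    multiplier lam n a * multiplier lam n b = multiplier lam n (a * b) :=
  LinearEquiv.ext fun c => multiplier_mul_apply a b c

theorem multiplier_one : multiplier lam n 1 = 1 := by
  have h := multiplier_mul (lam := lam) (n := n) 1 1
  rw [mul_one] at h
  exact mul_eq_left.mp h

theorem multiplier_pow (a : multiplierGroup lam n) (i : ℕ) :
    multiplier lam n a ^ i = multiplier lam n (a ^ i) := by
  induction i with
  | zero => rw [pow_zero, pow_zero, multiplier_one]
  | succ i ih => rw [pow_succ, pow_succ, ih, multiplier_mul]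

theorem shift_pow_apply (j : ℕ) (c : ConstacyclicRing lam n) :
    (shift lam n ^ j) c = x lam n ^ j * c := by
  induction j with
  | zero => simp
  | succ j ih =>
    rw [pow_succ', pow_succ', mul_assoc, ← ih]
    rfl

theorem shift_mul_multiplier (a : multiplierGroup lam n) :
    shift lam n * multiplier lam n a =
      multiplier lam n a * shift lam n ^ rep lam n a⁻¹ := by
  refine LinearEquiv.ext fun c => ?_
  change x lam n * multiplier lam n a c = multiplierHom lam n a ((shift lam n ^ rep lam n a⁻¹) c)
  rw [shift_pow_apply, map_mul, map_pow, multiplierHom_x, ← pow_mul]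
  congr 1
  conv_lhs => rw [← pow_one (x lam n)]
  apply x_pow_eq_of_cast_eq
  rw [Nat.cast_mul, cast_rep, cast_rep, ← Units.val_mul, ← Subgroup.coe_mul, mul_inv_cancel]
  simp

instance finite_constacyclicRing : Finite (ConstacyclicRing lam n) := by
  have := (monic_X_pow_sub_C (lam : F) (NeZero.ne n)).finite_adjoinRoot
  exact Module.finite_of_finite F

instance finite_linearEquiv :
    Finite (ConstacyclicRing lam n ≃ₗ[F] ConstacyclicRing lam n) :=
  DFunLike.finite _

theorem shift_pow_mul_multiplier (a : multiplierGroup lam n) (j : ℕ) :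
    shift lam n ^ j * multiplier lam n a =
      multiplier lam n a * shift lam n ^ (rep lam n a⁻¹ * j) := by
  induction j with
  | zero => simp
  | succ j ih =>
    rw [pow_succ, mul_assoc, shift_mul_multiplier, ← mul_assoc, ih, mul_assoc, ← pow_add]
    rfl

/-- Scalars commute with everything, and ρ passes μ_a at the cost of raising it to the power a⁻¹.
Words in the generators can thus be sorted, and finiteness makes inverses unnecessary. -/
theorem mem_autGroup_iff (a : multiplierGroup lam n) (ξ : Fˣ)
    (φ : ConstacyclicRing lam n ≃ₗ[F] ConstacyclicRing lam n) :
    φ ∈ autGroup lam n a ξ ↔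
      ∃ i j l : ℕ, φ = multiplier lam n a ^ i * shift lam n ^ j * scalar lam n ξ ^ l := by
  constructor
  · intro h
    rw [autGroup, ← Subgroup.mem_toSubmonoid, Subgroup.closure_toSubmonoid_of_finite] at h
    induction h using Submonoid.closure_induction_right with
    | one => exact ⟨0, 0, 0, by simp⟩
    | mul_right φ _ ψ hψ ih =>
      obtain ⟨i, j, l, rfl⟩ := ih
      have hcomm : ∀ ψ : ConstacyclicRing lam n ≃ₗ[F] ConstacyclicRing lam n,
          scalar lam n ξ ^ l * ψ = ψ * scalar lam n ξ ^ l := by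
        intro ψ
        rw [scalar_pow, scalar_mul_comm]
      rcases hψ with rfl | rfl | rfl
      · refine ⟨i + 1, rep lam n a⁻¹ * j, l, ?_⟩
        rw [mul_assoc, hcomm, ← mul_assoc, mul_assoc (_ ^ i), shift_pow_mul_multiplier,
          ← mul_assoc, pow_succ]
      · refine ⟨i, j + 1, l, ?_⟩
        rw [mul_assoc, hcomm, ← mul_assoc, mul_assoc (_ ^ i), ← pow_succ]
      · exact ⟨i, j, l + 1, by rw [pow_succ, ← mul_assoc]⟩
  · rintro ⟨i, j, l, rfl⟩
    exact mul_mem (mul_mem (pow_mem (Subgroup.subset_closure (by simp)) _)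
      (pow_mem (Subgroup.subset_closure (by simp)) _))
      (pow_mem (Subgroup.subset_closure (by simp)) _)

theorem shift_pow_n : shift lam n ^ n = scalar lam n lam := by
  refine LinearEquiv.ext fun c => ?_
  rw [shift_pow_apply, x_pow_n, scalar_apply, Algebra.smul_def]

/-- Every element of `⟨μ_a, ρ, σ_ξ⟩` is `μ_a ^ j₁ ρ ^ j₂ σ_ξ ^ j₃` with small exponents. -/
theorem exists_reduced_of_mem_autGroup {a : multiplierGroup lam n} {ξ : Fˣ}
    (hξ : ∀ y : Fˣ, y ∈ Subgroup.zpowers ξ) {M Q : ℕ} (hM : 0 < M) (ha : a ^ M = 1)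
    (hQ : orderOf ξ = Q)
    {φ : ConstacyclicRing lam n ≃ₗ[F] ConstacyclicRing lam n} (hφ : φ ∈ autGroup lam n a ξ) :
    ∃ j₁ < M, ∃ j₂ < n, ∃ j₃ < Q, ∀ c,
      (multiplier lam n a ^ j₁ * shift lam n ^ j₂) ((ξ ^ j₃ : Fˣ) • c) = φ c := by
  obtain ⟨i, j, l, rfl⟩ := (mem_autGroup_iff a ξ φ).mp hφ
  obtain ⟨t, ht⟩ := (mem_powers_iff_mem_zpowers.mpr (hξ lam) : lam ∈ Submonoid.powers ξ)
  refine ⟨i % M, Nat.mod_lt _ hM, j % n, Nat.mod_lt _ (NeZero.pos n), (t * (j / n) + l) % Q,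
    Nat.mod_lt _ (hQ ▸ orderOf_pos ξ), fun c => ?_⟩
  have h1 : multiplier lam n a ^ i = multiplier lam n a ^ (i % M) := by
    rw [multiplier_pow, multiplier_pow, pow_eq_pow_mod i ha]
  -- Since ρⁿ is multiplication by λ = ξ^t, full turns of the shift are absorbed in the exponent of
  -- ξ.
  have h2 : shift lam n ^ j = shift lam n ^ (j % n) * scalar lam n ξ ^ (t * (j / n)) := by
    conv_lhs => rw [← Nat.mod_add_div j n, pow_add, pow_mul, shift_pow_n]
    rw [pow_mul, scalar_pow ξ t]
    exact congrArg (fun y => shift lam n ^ (j % n) * scalar lam n y ^ (j / n)) ht.symm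
  rw [h1, h2, mul_assoc (_ ^ (i % M)), mul_assoc (_ ^ (j % n)), ← pow_add, scalar_pow,
    ← hQ, pow_mod_orderOf, ← mul_assoc]
  rfl

theorem weight_of_mem_autGroup {a : multiplierGroup lam n} {ξ : Fˣ}
    {φ : ConstacyclicRing lam n ≃ₗ[F] ConstacyclicRing lam n} (hφ : φ ∈ autGroup lam n a ξ)
    (c : ConstacyclicRing lam n) : weight (φ c) = weight c := by
  rw [autGroup, ← Subgroup.mem_toSubmonoid, Subgroup.closure_toSubmonoid_of_finite] at hφ
  induction hφ using Submonoid.closure_induction generalizing c with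
  | mem φ h =>
    rcases h with rfl | rfl | rfl
    · exact weight_multiplier a c
    · exact weight_shift c
    · exact weight_scalar ξ c
  | one => rfl
  | mul φ ψ _ _ ih₁ ih₂ => exact (ih₁ (ψ c)).trans (ih₂ c)

end Weight

/-! ### Comparing the numbers of values of two functions, one refining the other. -/

section Orbits

theorem ncard_image_le_ncard_image {A B D : Type*} [Finite A] (f : A → B) (g : A → D) (S : Set A)
    (h : ∀ x ∈ S, ∀ y ∈ S, f x = f y → g x = g y) :
    (g '' S).ncard ≤ (f '' S).ncard ∧
      ((g '' S).ncard = (f '' S).ncard ↔ ∀ x ∈ S, ∀ y ∈ S, g x = g y → f x = f y) := by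
  classical
  rcases S.eq_empty_or_nonempty with rfl | ⟨x₀, hx₀⟩
  · simp
  -- On S the function g factors through f, so its image is the image under t of f '' S; equality of
  -- sizes means that t is injective there. The value `g x₀` outside f '' S is arbitrary.
  obtain ⟨t, ht⟩ : ∃ t : B → D, ∀ x ∈ S, t (f x) = g x := by
    refine ⟨fun b => if hb : ∃ x ∈ S, f x = b then g hb.choose else g x₀, fun x hx => ?_⟩
    have hb : ∃ y ∈ S, f y = f x := ⟨x, hx, rfl⟩
    refine (dif_pos hb).trans ?_
    exact h _ hb.choose_spec.1 _ hx hb.choose_spec.2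
  have himg : g '' S = t '' (f '' S) := by
    rw [Set.image_image]
    exact Set.image_congr fun x hx => (ht x hx).symm
  have hfin : (f '' S).Finite := (Set.toFinite S).image f
  refine ⟨himg ▸ Set.ncard_image_le hfin, ?_⟩
  rw [himg, Set.ncard_image_iff hfin]
  constructor
  · intro hi x hx y hy hxy
    exact hi ⟨x, hx, rfl⟩ ⟨y, hy, rfl⟩ (by rw [ht x hx, ht y hy, hxy])
  · rintro hi _ ⟨x, hx, rfl⟩ _ ⟨y, hy, rfl⟩ hxy
    rw [ht x hx, ht y hy] at hxy
    exact hi x hx y hy hxy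

end Orbits

theorem coprime_orderOf_mul {F : Type*} [Field F] [Fintype F] (lam : Fˣ) {n : ℕ}
    (hn : n.Coprime (Fintype.card F)) : (Fintype.card F).Coprime (orderOf lam * n) := by
  classical
  refine Nat.Coprime.mul_right ?_ hn.symm
  have h1 : orderOf lam ∣ Fintype.card F - 1 := by
    rw [← Fintype.card_units]
    exact orderOf_dvd_card
  refine Nat.Coprime.coprime_dvd_right h1 ?_
  exact (Nat.coprime_self_sub_right Fintype.one_lt_card.le).mpr (Nat.coprime_one_right _)

/-! ### Evaluation at the roots of xⁿ - λ. -/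

section Evaluation

variable {F : Type*} [Field F] {lam : Fˣ} {n : ℕ} {K : Type*} [Field K] [Algebra F K]

/-- Evaluation of elements of `F[x]/⟨xⁿ - λ⟩` at an `n`-th root `y` of `λ`. -/
noncomputable def evalAt (y : K) (hy : y ^ n = algebraMap F K lam) :
    ConstacyclicRing lam n →ₐ[F] K :=
  AdjoinRoot.liftAlgHom _ (Algebra.ofId F K) y (by
    rw [eval₂_sub, eval₂_pow, eval₂_X, eval₂_C, hy]
    exact sub_self _)

theorem evalAt_x (y : K) (hy : y ^ n = algebraMap F K lam) : evalAt y hy (x lam n) = y :=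
  AdjoinRoot.liftAlgHom_root ..

theorem evalAt_mk (y : K) (hy : y ^ n = algebraMap F K lam) (f : F[X]) :
    evalAt y hy (AdjoinRoot.mk _ f) = aeval y f := by
  have h : (evalAt y hy).comp (AdjoinRoot.mkₐ (X ^ n - C (lam : F))) = aeval y := by
    refine Polynomial.algHom_ext ?_
    rw [AlgHom.comp_apply, aeval_X]
    exact evalAt_x y hy
  exact DFunLike.congr_fun h f

theorem evalAt_congr {y z : K} (hyz : y = z) (hy : y ^ n = algebraMap F K lam)
    (hz : z ^ n = algebraMap F K lam) (c : ConstacyclicRing lam n) :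
    evalAt y hy c = evalAt z hz c := by
  subst hyz
  rfl

theorem evalAt_extendScalars (y : K) (hy : y ^ n = algebraMap F K lam)
    (hy' : y ^ n = algebraMap K K (Units.map (algebraMap F K : F →* K) lam : Kˣ))
    (c : ConstacyclicRing lam n) : evalAt y hy' (extendScalars lam n K c) = evalAt y hy c := by
  obtain ⟨f, rfl⟩ := AdjoinRoot.mk_surjective c
  rw [extendScalars_mk, evalAt_mk, evalAt_mk, aeval_map_algebraMap]

theorem evalAt_multiplier [Finite F] [NeZero n] (a : multiplierGroup lam n) (y : K)
    (hy : y ^ n = algebraMap F K lam) (hy' : (y ^ rep lam n a) ^ n = algebraMap F K lam)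
    (c : ConstacyclicRing lam n) :
    evalAt y hy (multiplier lam n a c) = evalAt (y ^ rep lam n a) hy' c := by
  have h : (evalAt y hy).comp (multiplierHom lam n a) = evalAt (y ^ rep lam n a) hy' := by
    refine AdjoinRoot.algHom_ext ?_
    rw [AlgHom.comp_apply, multiplierHom_x, map_pow, evalAt_x]
    exact (evalAt_x _ hy').symm
  exact DFunLike.congr_fun h c

theorem evalAt_pow_card [Fintype F] (t : ℕ) (y : K) (hy : y ^ n = algebraMap F K lam)
    (hy' : (y ^ Fintype.card F ^ t) ^ n = algebraMap F K lam) (c : ConstacyclicRing lam n) :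
    evalAt (y ^ Fintype.card F ^ t) hy' c = evalAt y hy c ^ Fintype.card F ^ t := by
  have hfrob : ∀ z : K, (FiniteField.frobeniusAlgHom F K ^ t) z = z ^ Fintype.card F ^ t := by
    intro z
    rw [AlgHom.coe_pow, FiniteField.coe_frobeniusAlgHom, pow_iterate]
  have h : (FiniteField.frobeniusAlgHom F K ^ t).comp (evalAt y hy) =
      evalAt (y ^ Fintype.card F ^ t) hy' := by
    refine AdjoinRoot.algHom_ext ?_
    rw [AlgHom.comp_apply, evalAt_x y hy, hfrob]
    exact (evalAt_x _ hy').symm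
  rw [← h, AlgHom.comp_apply, hfrob]

theorem pow_card_pow_eq [Fintype F] (t : ℕ) {y : K} (hy : y ^ n = algebraMap F K lam) :
    (y ^ Fintype.card F ^ t) ^ n = algebraMap F K lam := by
  rw [← pow_mul, mul_comm, pow_mul, hy, ← map_pow, FiniteField.pow_card_pow]

/-- The n elements ζ^(1+ri) with i < n are distinct roots of xⁿ - λ, too many for a nonzero
representative of degree less than n. -/
theorem eq_zero_of_evalAt_eq_zero [Finite F] [NeZero n] {ζ : K}
    (hζ : IsPrimitiveRoot ζ (orderOf lam * n)) (hζn : ζ ^ n = algebraMap F K lam)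
    {c : ConstacyclicRing lam n} (hc : ∀ y hy, evalAt (K := K) y hy c = 0) : c = 0 := by
  obtain ⟨f, rfl⟩ := AdjoinRoot.mk_surjective c
  have hm := monic_X_pow_sub_C (lam : F) (NeZero.ne n)
  rw [← AdjoinRoot.mk_leftInverse hm (AdjoinRoot.mk _ f), AdjoinRoot.modByMonicHom_mk] at hc ⊢
  have hpow : ∀ i : ℕ, (ζ ^ (1 + orderOf lam * i)) ^ n = algebraMap F K lam := by
    intro i
    rw [pow_add, pow_one, mul_pow, hζn, ← pow_mul, mul_right_comm, pow_mul, hζ.pow_eq_one,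
      one_pow, mul_one]
  have hζ0 : ζ ≠ 0 := hζ.ne_zero (NeZero.ne _)
  have hzero : (f %ₘ (X ^ n - C (lam : F))).map (algebraMap F K) = 0 := by
    refine eq_zero_of_natDegree_lt_card_of_eval_eq_zero _
      (f := fun i : Fin n => ζ ^ (1 + orderOf lam * i)) ?_ ?_ ?_
    · intro i j hij
      have hlt : ∀ i : Fin n, orderOf lam * (i : ℕ) < orderOf lam * n := fun i =>
        Nat.mul_lt_mul_of_pos_left i.2 (orderOf_pos lam)
      have h : ζ ^ (orderOf lam * (i : ℕ)) = ζ ^ (orderOf lam * (j : ℕ)) := by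
        apply mul_left_cancel₀ hζ0
        simpa [pow_add] using hij
      exact Fin.ext (Nat.eq_of_mul_eq_mul_left (orderOf_pos lam) (hζ.pow_inj (hlt i) (hlt j) h))
    · intro i
      rw [eval_map_algebraMap, ← evalAt_mk _ (hpow i)]
      exact hc _ _
    · rw [natDegree_map, Fintype.card_fin]
      have h := natDegree_modByMonic_lt f hm (by
        intro h1
        have := congrArg natDegree h1
        rw [natDegree_X_pow_sub_C, natDegree_one] at this
        exact NeZero.ne n this)
      rwa [natDegree_X_pow_sub_C] at h
  rw [Polynomial.map_eq_zero] at hzero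
  rw [hzero, map_zero]

/-- The value is the average of the powers of y/ζ^j, an n-th root of unity, and the geometric sum
vanishes unless this root is 1. -/
theorem evalAt_splitIdempotent {ζ y : K} (hn : (n : K) ≠ 0) (hy : y ^ n = algebraMap F K lam)
    (hy' : y ^ n = algebraMap K K (Units.map (algebraMap F K : F →* K) lam : Kˣ))
    {j : ZMod (orderOf lam * n)} (hj : (ζ ^ j.val) ^ n = algebraMap F K lam) [Decidable (y = ζ ^ j.val)] :
    evalAt y hy' (splitIdempotent lam n ζ j) = if y = ζ ^ j.val then 1 else 0 := by
  have hn0 : n ≠ 0 := by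
    rintro rfl
    exact hn Nat.cast_zero
  have hζ0 : ζ ^ j.val ≠ 0 := by
    intro h
    rw [h, zero_pow hn0] at hj
    exact (Units.map (algebraMap F K : F →* K) lam).ne_zero hj.symm
  have h1 : evalAt y hy' (splitIdempotent lam n ζ j) =
      (n : K)⁻¹ * ∑ l ∈ Finset.range n, (y / ζ ^ j.val) ^ l := by
    rw [splitIdempotent, map_smul, map_sum, smul_eq_mul]
    congr 1
    refine Finset.sum_congr rfl fun l _ => ?_
    rw [map_smul, map_pow, evalAt_x y hy', smul_eq_mul, div_pow, pow_mul, div_eq_inv_mul]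
  rw [h1]
  split_ifs with h
  · rw [h, div_self hζ0]
    simp [hn]
  · have hne : y / ζ ^ j.val - 1 ≠ 0 := by
      rw [Ne, sub_eq_zero, div_eq_one_iff_eq hζ0]
      exact h
    have hgeom := geom_sum_mul (y / ζ ^ j.val) n
    rw [div_pow, hy, hj, div_self (hj ▸ pow_ne_zero n hζ0), sub_self] at hgeom
    rw [(mul_eq_zero.mp hgeom).resolve_right hne, mul_zero]

variable [Fintype F]

theorem evalAt_primitiveIdempotent [NeZero n] (hn : n.Coprime (Fintype.card F)) {ζ : K}
    (hζ : IsPrimitiveRoot ζ (orderOf lam * n)) {j : ZMod (orderOf lam * n)}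
    (hj : (ζ ^ j.val) ^ n = algebraMap F K lam) (y : K) (hy : y ^ n = algebraMap F K lam)
    [Decidable (∃ t : ℕ, y = (ζ ^ j.val) ^ Fintype.card F ^ t)] :
    evalAt y hy (primitiveIdempotent lam n ζ j) =
      if ∃ t : ℕ, y = (ζ ^ j.val) ^ Fintype.card F ^ t then 1 else 0 := by
  classical
  have hnK : (n : K) ≠ 0 := by
    have := (CharP.exists F)
    obtain ⟨p, hp⟩ := this
    obtain ⟨e, hpp, hcard⟩ := FiniteField.card F p
    rw [← map_natCast (algebraMap F K), Ne, map_eq_zero, CharP.cast_eq_zero_iff F p]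
    intro hdvd
    rw [hcard] at hn
    have h1 := Nat.dvd_gcd hdvd (dvd_pow_self p e.ne_zero)
    rw [hn] at h1
    exact hpp.one_lt.ne' (Nat.dvd_one.mp h1)
  have hcoset : ∀ i ∈ cyclotomicCoset (Fintype.card F) j,
      ∃ t : ℕ, ζ ^ i.val = (ζ ^ j.val) ^ Fintype.card F ^ t := by
    intro i hi
    obtain ⟨t, -, rfl⟩ := Finset.mem_image.mp hi
    refine ⟨t, ?_⟩
    rw [← pow_mul, pow_eq_pow_mod _ hζ.pow_eq_one, pow_eq_pow_mod (j.val * _) hζ.pow_eq_one]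
    congr 1
    rw [← ZMod.natCast_eq_natCast_iff']
    simp
  have hy' : y ^ n = algebraMap K K (Units.map (algebraMap F K : F →* K) lam : Kˣ) := hy
  rw [← evalAt_extendScalars y hy hy', extendScalars_primitiveIdempotent lam n hn hζ.pow_eq_one,
    map_sum]
  have hterm : ∀ i ∈ cyclotomicCoset (Fintype.card F) j,
      evalAt y hy' (splitIdempotent lam n ζ i) = if y = ζ ^ i.val then 1 else 0 := by
    intro i hi
    obtain ⟨t, ht⟩ := hcoset i hi
    exact evalAt_splitIdempotent hnK hy hy' (ht ▸ pow_card_pow_eq t hj)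
  rw [Finset.sum_congr rfl hterm]
  split_ifs with h
  · obtain ⟨t, ht⟩ := h
    have hmem : j * (Fintype.card F : ZMod (orderOf lam * n)) ^ t ∈
        cyclotomicCoset (Fintype.card F) j := by
      have hu : IsUnit (Fintype.card F : ZMod (orderOf lam * n)) :=
        (ZMod.isUnit_iff_coprime _ _).mpr (coprime_orderOf_mul lam hn)
      have hpos : 0 < orderOf (Fintype.card F : ZMod (orderOf lam * n)) := by
        obtain ⟨u, hu⟩ := hu
        rw [← hu, orderOf_units]
        exact orderOf_pos u
      exact Finset.mem_image.mpr ⟨t % orderOf (Fintype.card F : ZMod (orderOf lam * n)),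
        Finset.mem_range.mpr (Nat.mod_lt _ hpos), by rw [pow_mod_orderOf]⟩
    have hval : y = ζ ^ (j * (Fintype.card F : ZMod (orderOf lam * n)) ^ t).val := by
      rw [ht, ← pow_mul, pow_eq_pow_mod _ hζ.pow_eq_one,
        pow_eq_pow_mod (ZMod.val _) hζ.pow_eq_one]
      congr 1
      rw [← ZMod.natCast_eq_natCast_iff']
      simp
    rw [Finset.sum_eq_single_of_mem _ hmem, if_pos hval]
    intro i _ hi
    refine if_neg fun hyi => hi ?_
    exact ZMod.val_injective _ (hζ.pow_inj (ZMod.val_lt _) (ZMod.val_lt _) (hyi.symm.trans hval))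
  · refine Finset.sum_eq_zero fun i hi => if_neg fun hyi => h ?_
    obtain ⟨t, ht⟩ := hcoset i hi
    exact ⟨t, hyi.trans ht⟩

/-- The idempotent takes the value 1 at the conjugates of ζ^j and 0 at the other roots, so c lies in
its ideal exactly when c times the idempotent has the same values as c. -/
theorem mem_span_primitiveIdempotent_iff [NeZero n] (hn : n.Coprime (Fintype.card F)) {ζ : K}
    (hζ : IsPrimitiveRoot ζ (orderOf lam * n)) (hζn : ζ ^ n = algebraMap F K lam)
    {j : ZMod (orderOf lam * n)}
    (hj : (ζ ^ j.val) ^ n = algebraMap F K lam) (c : ConstacyclicRing lam n) :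
    c ∈ Ideal.span {primitiveIdempotent lam n ζ j} ↔
      ∀ y hy, (¬∃ t : ℕ, y = (ζ ^ j.val) ^ Fintype.card F ^ t) → evalAt (K := K) y hy c = 0 := by
  classical
  rw [Ideal.mem_span_singleton']
  constructor
  · rintro ⟨d, rfl⟩ y hy h
    rw [map_mul, evalAt_primitiveIdempotent hn hζ hj, if_neg h, mul_zero]
  · intro h
    refine ⟨c, ?_⟩
    rw [← sub_eq_zero]
    refine eq_zero_of_evalAt_eq_zero hζ hζn fun y hy => ?_
    rw [map_sub, map_mul, evalAt_primitiveIdempotent hn hζ hj, sub_eq_zero]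
    split_ifs with h'
    · rw [mul_one]
    · rw [mul_zero, h y hy h']

/-- The values at θ form F(θ), which is to be the field of fixed points of the q^k-power map. One
inclusion comes from the period of θ, and cardinalities give equality: there are at most q^k fixed
points, while k divides the degree of F(θ). -/
theorem exists_evalAt_eq_iff [Finite K] {θ : K} (hθ : θ ^ n = algebraMap F K lam) {k : ℕ}
    (hk : 0 < k) (hkθ : ∀ t : ℕ, θ ^ Fintype.card F ^ t = θ ↔ k ∣ t) (u : K) :
    (∃ c, evalAt θ hθ c = u) ↔ u ^ Fintype.card F ^ k = u := by
  classical
  constructor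
  · rintro ⟨c, rfl⟩
    rw [← evalAt_pow_card k θ hθ (pow_card_pow_eq k hθ)]
    exact evalAt_congr ((hkθ k).mpr dvd_rfl) _ _ c
  · intro hu
    let S : Set K := {u : K | u ^ Fintype.card F ^ k = u}
    let L : IntermediateField F K := IntermediateField.adjoin F {θ}
    have hqk : 1 < Fintype.card F ^ k := Nat.one_lt_pow hk.ne' Fintype.one_lt_card
    have hLr : ∀ z ∈ L, ∃ c, evalAt θ hθ c = z := by
      intro z hz
      have hz' : z ∈ Algebra.adjoin F {θ} := by
        rw [← IntermediateField.adjoin_simple_toSubalgebra_of_isAlgebraic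
          (Algebra.IsAlgebraic.isAlgebraic θ)]
        exact hz
      have hle : Algebra.adjoin F {θ} ≤ (evalAt θ hθ).range :=
        Algebra.adjoin_le (Set.singleton_subset_iff.mpr ⟨_, evalAt_x θ hθ⟩)
      exact hle hz'
    have hLS : (L : Set K) ⊆ S := by
      intro z hz
      obtain ⟨c, rfl⟩ := hLr z hz
      change _ ^ _ = _
      rw [← evalAt_pow_card k θ hθ (pow_card_pow_eq k hθ)]
      exact evalAt_congr ((hkθ k).mpr dvd_rfl) _ _ c
    have hScard : S.ncard ≤ Fintype.card F ^ k := by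
      have hne : (X ^ Fintype.card F ^ k - X : K[X]) ≠ 0 :=
        FiniteField.X_pow_card_sub_X_ne_zero K hqk
      have hsub : S ⊆ ((X ^ Fintype.card F ^ k - X : K[X]).roots.toFinset : Set K) := by
        intro z hz
        rw [Finset.mem_coe, Multiset.mem_toFinset, mem_roots hne, IsRoot, eval_sub, eval_pow,
          eval_X, sub_eq_zero]
        exact hz
      refine (Set.ncard_le_ncard hsub (Finset.finite_toSet _)).trans ?_
      rw [Set.ncard_coe_finset]
      refine (Multiset.toFinset_card_le _).trans ((card_roots' _).trans ?_)
      rw [FiniteField.X_pow_card_sub_X_natDegree_eq K hqk]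
    have hLcard : Fintype.card F ^ k ≤ (L : Set K).ncard := by
      have h1 : Nat.card L = Fintype.card F ^ Module.finrank F L := by
        rw [← Nat.card_eq_fintype_card]
        exact Module.natCard_eq_pow_finrank
      -- An element of a field with q^d elements is fixed by its q^d-th power, so applying this to θ
      -- shows that d is a multiple of the period k.
      have hdvd : k ∣ Module.finrank F L := by
        rw [← hkθ]
        let _ := Fintype.ofFinite L
        have h2 := FiniteField.pow_card (⟨θ, IntermediateField.mem_adjoin_simple_self F θ⟩ : L)
        rw [← Nat.card_eq_fintype_card, h1] at h2
        exact congrArg (algebraMap L K) h2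
      rw [← Nat.card_coe_set_eq]
      change _ ≤ Nat.card L
      rw [h1]
      exact Nat.pow_le_pow_right Fintype.card_pos (Nat.le_of_dvd Module.finrank_pos hdvd)
    have heq := Set.eq_of_subset_of_ncard_le hLS (hScard.trans hLcard) (Set.toFinite _)
    exact hLr u (heq ▸ hu : u ∈ (L : Set K))

end Evaluation

/-! ### The code A ⊕ μ_b A in the coordinates given by evaluation at θ and θ^(1/b). -/

section CodePair

variable {F : Type*} [Field F] [Fintype F] {lam : Fˣ} {n : ℕ} [NeZero n] {K : Type*} [Field K]
  [Algebra F K]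

theorem pow_rep_pow_eq (a : multiplierGroup lam n) {y : K} (hy : y ^ n = algebraMap F K lam) :
    (y ^ rep lam n a) ^ n = algebraMap F K lam := by
  rw [← pow_mul, mul_comm, pow_mul, hy, ← map_pow, ← Units.val_pow_eq_pow_val, lam_pow_rep]

theorem pow_eq_pow_of_cast_eq {y : K} (hy : y ^ n = algebraMap F K lam) {i j : ℕ}
    (h : (i : ZMod (orderOf lam * n)) = j) : y ^ i = y ^ j := by
  have h1 : y ^ (orderOf lam * n) = 1 := by
    rw [mul_comm, pow_mul, hy, ← map_pow, ← Units.val_pow_eq_pow_val, pow_orderOf_eq_one,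
      Units.val_one, map_one]
  rw [ZMod.natCast_eq_natCast_iff'] at h
  rw [pow_eq_pow_mod i h1, pow_eq_pow_mod j h1, h]

theorem pow_rep_pow_rep (a b : multiplierGroup lam n) {y : K} (hy : y ^ n = algebraMap F K lam) :
    (y ^ rep lam n a) ^ rep lam n b = y ^ rep lam n (a * b) := by
  rw [← pow_mul]
  apply pow_eq_pow_of_cast_eq hy
  rw [Nat.cast_mul, cast_rep, cast_rep, cast_rep, Subgroup.coe_mul, Units.val_mul]

theorem pow_rep_one {y : K} (hy : y ^ n = algebraMap F K lam) : y ^ rep lam n 1 = y := by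
  conv_rhs => rw [← pow_one y]
  apply pow_eq_pow_of_cast_eq hy
  rw [cast_rep]
  simp

/-- The code `A` consists of the elements of `F[x]/⟨xⁿ - λ⟩` that vanish at all roots of `xⁿ - λ`
but the conjugates of `θ`, and `θ ^ b⁻¹` is not among these. -/
structure IsCodePair (b u : multiplierGroup lam n) (θ : K) (k m : ℕ)
    (A : Submodule F (ConstacyclicRing lam n)) : Prop where
  root : θ ^ n = algebraMap F K lam
  card_eq : Nat.card K = Fintype.card F ^ m
  ext_eval : ∀ c : ConstacyclicRing lam n, (∀ y hy, evalAt (K := K) y hy c = 0) → c = 0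
  sq_eq : b * b = u
  cast_eq : ((u : (ZMod (orderOf lam * n))ˣ) : ZMod (orderOf lam * n)) = Fintype.card F
  pos : 0 < k
  period : ∀ t : ℕ, θ ^ Fintype.card F ^ t = θ ↔ k ∣ t
  mem_iff : ∀ c, c ∈ A ↔ ∀ y hy, (¬∃ t : ℕ, y = θ ^ Fintype.card F ^ t) →
    evalAt (K := K) y hy c = 0
  not_conj : ¬∃ t : ℕ, θ ^ rep lam n b⁻¹ = θ ^ Fintype.card F ^ t
  proj : ∀ d, ∃ c ∈ A, evalAt θ root c = evalAt θ root d

namespace IsCodePair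

variable {b u : multiplierGroup lam n} {θ : K} {k m : ℕ}
  {A : Submodule F (ConstacyclicRing lam n)}

theorem root' (h : IsCodePair b u θ k m A) : (θ ^ rep lam n b⁻¹) ^ n = algebraMap F K lam :=
  pow_rep_pow_eq b⁻¹ h.root

theorem pow_rep_u (h : IsCodePair b u θ k m A) {y : K} (hy : y ^ n = algebraMap F K lam) :
    y ^ rep lam n u = y ^ Fintype.card F ^ 1 := by
  apply pow_eq_pow_of_cast_eq hy
  rw [cast_rep, h.cast_eq, pow_one]

theorem finite (h : IsCodePair b u θ k m A) : Finite K :=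
  (Nat.card_pos_iff.mp (by rw [h.card_eq]; exact pow_pos Fintype.card_pos _)).2

theorem m_pos (h : IsCodePair b u θ k m A) : 0 < m := by
  have := h.finite
  rcases Nat.eq_zero_or_pos m with rfl | hm
  · have h1 := h.card_eq
    rw [pow_zero] at h1
    exact absurd h1 (Finite.one_lt_card (α := K)).ne'
  · exact hm

theorem pow_card_K (h : IsCodePair b u θ k m A) (i : ℕ) (y : K) :
    y ^ Fintype.card F ^ (m * i) = y := by
  have := h.finite
  let _ := Fintype.ofFinite K
  rw [pow_mul, ← h.card_eq, Nat.card_eq_fintype_card, FiniteField.pow_card_pow]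

theorem dvd_m (h : IsCodePair b u θ k m A) : k ∣ m := by
  rw [← h.period]
  simpa using h.pow_card_K 1 θ

theorem evalAt_multiplier_u (h : IsCodePair b u θ k m A) (y : K)
    (hy : y ^ n = algebraMap F K lam) (c : ConstacyclicRing lam n) :
    evalAt y hy (multiplier lam n u c) = evalAt y hy c ^ Fintype.card F := by
  rw [evalAt_multiplier u y hy (pow_rep_pow_eq u hy),
    evalAt_congr (h.pow_rep_u hy) _ (pow_card_pow_eq 1 hy), evalAt_pow_card, pow_one]

theorem eval₂_multiplier_b (h : IsCodePair b u θ k m A) (c : ConstacyclicRing lam n) :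
    evalAt (θ ^ rep lam n b⁻¹) h.root' (multiplier lam n b c) = evalAt θ h.root c := by
  rw [evalAt_multiplier b _ h.root' (pow_rep_pow_eq b h.root')]
  refine evalAt_congr ?_ _ _ c
  rw [pow_rep_pow_rep b⁻¹ b h.root, inv_mul_cancel, pow_rep_one h.root]

/-- Writing μ_u = μ_b μ_b, the value of μ_b c at θ is the value of μ_u c at θ^(1/b), and μ_u acts on
values as the Frobenius. -/
theorem eval₁_multiplier_b (h : IsCodePair b u θ k m A) (c : ConstacyclicRing lam n) :
    evalAt θ h.root (multiplier lam n b c) =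
      evalAt (θ ^ rep lam n b⁻¹) h.root' c ^ Fintype.card F := by
  have hu : multiplier lam n u c = multiplier lam n b (multiplier lam n b c) := by
    rw [multiplier_mul_apply, h.sq_eq]
  rw [← h.evalAt_multiplier_u, hu, h.eval₂_multiplier_b]

theorem eval₂_eq_zero (h : IsCodePair b u θ k m A) {c : ConstacyclicRing lam n} (hc : c ∈ A) :
    evalAt (θ ^ rep lam n b⁻¹) h.root' c = 0 :=
  (h.mem_iff c).mp hc _ _ h.not_conj

theorem eval₁_multiplier_eq_zero (h : IsCodePair b u θ k m A) {c : ConstacyclicRing lam n}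
    (hc : c ∈ A) : evalAt θ h.root (multiplier lam n b c) = 0 := by
  rw [h.eval₁_multiplier_b, h.eval₂_eq_zero hc, zero_pow Fintype.card_ne_zero]

theorem eq_zero_of_eval₁ (h : IsCodePair b u θ k m A) {c : ConstacyclicRing lam n} (hc : c ∈ A)
    (h₁ : evalAt θ h.root c = 0) : c = 0 := by
  refine h.ext_eval c fun y hy => ?_
  by_cases hyθ : ∃ t : ℕ, y = θ ^ Fintype.card F ^ t
  · obtain ⟨t, ht⟩ := hyθ
    rw [evalAt_congr ht hy (pow_card_pow_eq t h.root), evalAt_pow_card t θ h.root, h₁,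
      zero_pow (pow_pos Fintype.card_pos _).ne']
  · exact (h.mem_iff c).mp hc y hy hyθ

theorem shift_mem (h : IsCodePair b u θ k m A) {c : ConstacyclicRing lam n} (hc : c ∈ A) :
    shift lam n c ∈ A := by
  rw [h.mem_iff] at hc ⊢
  intro y hy hyθ
  rw [shift_apply, map_mul, hc y hy hyθ, mul_zero]

theorem multiplier_u_mem (h : IsCodePair b u θ k m A) {c : ConstacyclicRing lam n} (hc : c ∈ A) :
    multiplier lam n u c ∈ A := by
  rw [h.mem_iff] at hc ⊢
  intro y hy hyθ
  rw [h.evalAt_multiplier_u, hc y hy hyθ, zero_pow Fintype.card_ne_zero]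

/-- Elements of μ_b A vanish at θ, and an element of A vanishing at θ also vanishes at all
conjugates of θ, hence is 0. -/
theorem disjoint (h : IsCodePair b u θ k m A) :
    Disjoint A (A.map (multiplier lam n b : ConstacyclicRing lam n →ₗ[F] ConstacyclicRing lam n)) := by
  rw [Submodule.disjoint_def]
  rintro _ hc ⟨d, hd, rfl⟩
  exact h.eq_zero_of_eval₁ hc (h.eval₁_multiplier_eq_zero hd)

theorem mem_sup_iff {c : ConstacyclicRing lam n} :
    c ∈ A ⊔ A.map (multiplier lam n b : ConstacyclicRing lam n →ₗ[F] ConstacyclicRing lam n) ↔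
      ∃ c₁ ∈ A, ∃ c₂ ∈ A, c = c₁ + multiplier lam n b c₂ := by
  rw [Submodule.mem_sup]
  constructor
  · rintro ⟨c₁, h₁, _, ⟨c₂, h₂, rfl⟩, rfl⟩
    exact ⟨c₁, h₁, c₂, h₂, rfl⟩
  · rintro ⟨c₁, h₁, c₂, h₂, rfl⟩
    exact ⟨c₁, h₁, _, ⟨c₂, h₂, rfl⟩, rfl⟩

/-- μ_b exchanges the two summands because its square μ_u preserves A. -/
theorem multiplier_b_mem_sup (h : IsCodePair b u θ k m A) {c : ConstacyclicRing lam n}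
    (hc : c ∈ A ⊔ A.map (multiplier lam n b : ConstacyclicRing lam n →ₗ[F] ConstacyclicRing lam n)) :
    multiplier lam n b c ∈
      A ⊔ A.map (multiplier lam n b : ConstacyclicRing lam n →ₗ[F] ConstacyclicRing lam n) := by
  obtain ⟨c₁, h₁, c₂, h₂, rfl⟩ := mem_sup_iff.mp hc
  refine mem_sup_iff.mpr ⟨_, h.multiplier_u_mem h₂, c₁, h₁, ?_⟩
  rw [map_add, multiplier_mul_apply, h.sq_eq, add_comm]

theorem multiplier_u_mem_sup (h : IsCodePair b u θ k m A) {c : ConstacyclicRing lam n}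
    (hc : c ∈ A ⊔ A.map (multiplier lam n b : ConstacyclicRing lam n →ₗ[F] ConstacyclicRing lam n)) :
    multiplier lam n u c ∈
      A ⊔ A.map (multiplier lam n b : ConstacyclicRing lam n →ₗ[F] ConstacyclicRing lam n) := by
  rw [← h.sq_eq, ← multiplier_mul_apply]
  exact h.multiplier_b_mem_sup (h.multiplier_b_mem_sup hc)

theorem shift_mem_sup (h : IsCodePair b u θ k m A) {c : ConstacyclicRing lam n}
    (hc : c ∈ A ⊔ A.map (multiplier lam n b : ConstacyclicRing lam n →ₗ[F] ConstacyclicRing lam n)) :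
    shift lam n c ∈
      A ⊔ A.map (multiplier lam n b : ConstacyclicRing lam n →ₗ[F] ConstacyclicRing lam n) := by
  obtain ⟨c₁, h₁, c₂, h₂, rfl⟩ := mem_sup_iff.mp hc
  have hpow : ∀ j : ℕ, (shift lam n ^ j) c₂ ∈ A := by
    intro j
    induction j with
    | zero => exact h₂
    | succ j ih =>
      rw [pow_succ']
      exact h.shift_mem ih
  refine mem_sup_iff.mpr ⟨_, h.shift_mem h₁, _, hpow (rep lam n b⁻¹), ?_⟩
  rw [map_add]
  congr 1
  exact DFunLike.congr_fun (shift_mul_multiplier b) c₂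

theorem scalar_mem_sup (ξ : Fˣ) {c : ConstacyclicRing lam n}
    (hc : c ∈ A ⊔ A.map (multiplier lam n b : ConstacyclicRing lam n →ₗ[F] ConstacyclicRing lam n)) :
    scalar lam n ξ c ∈
      A ⊔ A.map (multiplier lam n b : ConstacyclicRing lam n →ₗ[F] ConstacyclicRing lam n) :=
  Submodule.smul_mem _ (ξ : F) hc

theorem autGroup_u_mem (h : IsCodePair b u θ k m A) (ξ : Fˣ)
    {φ : ConstacyclicRing lam n ≃ₗ[F] ConstacyclicRing lam n} (hφ : φ ∈ autGroup lam n u ξ)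
    {c : ConstacyclicRing lam n} (hc : c ∈ A) : φ c ∈ A := by
  rw [autGroup, ← Subgroup.mem_toSubmonoid, Subgroup.closure_toSubmonoid_of_finite] at hφ
  induction hφ using Submonoid.closure_induction generalizing c with
  | mem φ hm =>
    rcases hm with rfl | rfl | rfl
    · exact h.multiplier_u_mem hc
    · exact h.shift_mem hc
    · exact Submodule.smul_mem _ (ξ : F) hc
  | one => exact hc
  | mul φ ψ _ _ ih₁ ih₂ => exact ih₁ (ih₂ hc)

theorem autGroup_mem_sup (h : IsCodePair b u θ k m A) (ξ : Fˣ)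
    {φ : ConstacyclicRing lam n ≃ₗ[F] ConstacyclicRing lam n} (hφ : φ ∈ autGroup lam n b ξ)
    {c : ConstacyclicRing lam n}
    (hc : c ∈ A ⊔ A.map (multiplier lam n b : ConstacyclicRing lam n →ₗ[F] ConstacyclicRing lam n)) :
    φ c ∈ A ⊔ A.map (multiplier lam n b : ConstacyclicRing lam n →ₗ[F] ConstacyclicRing lam n) := by
  rw [autGroup, ← Subgroup.mem_toSubmonoid, Subgroup.closure_toSubmonoid_of_finite] at hφ
  induction hφ using Submonoid.closure_induction generalizing c with
  | mem φ hm =>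
    rcases hm with rfl | rfl | rfl
    · exact h.multiplier_b_mem_sup hc
    · exact h.shift_mem_sup hc
    · exact scalar_mem_sup ξ hc
  | one => exact hc
  | mul φ ψ _ _ ih₁ ih₂ => exact ih₁ (ih₂ hc)

theorem eq_zero_of_eval (h : IsCodePair b u θ k m A) {c : ConstacyclicRing lam n}
    (hc : c ∈ A ⊔ A.map (multiplier lam n b : ConstacyclicRing lam n →ₗ[F] ConstacyclicRing lam n))
    (h₁ : evalAt θ h.root c = 0) (h₂ : evalAt (θ ^ rep lam n b⁻¹) h.root' c = 0) : c = 0 := by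
  obtain ⟨c₁, hc₁, c₂, hc₂, rfl⟩ := mem_sup_iff.mp hc
  rw [map_add, h.eval₁_multiplier_eq_zero hc₂, add_zero] at h₁
  rw [map_add, h.eval₂_multiplier_b, h.eval₂_eq_zero hc₁, zero_add] at h₂
  rw [h.eq_zero_of_eval₁ hc₁ h₁, h.eq_zero_of_eval₁ hc₂ h₂, map_zero, add_zero]

/-- The code `A ⊕ μ_b A` as a set of pairs, through the evaluations at `θ` and `θ ^ b⁻¹`. -/
theorem pairModel (h : IsCodePair b u θ k m A) (g : Kˣ) (N s x₁ x₂ : ℤ) (hN : 0 < N)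
    (hs : N = s * (Fintype.card F - 1))
    (hg : ∀ y : ℤ, g ^ y = 1 ↔ N ∣ y)
    (hL : ∀ v : K, v ^ Fintype.card F ^ k = v ↔ v = 0 ∨ ∃ y : ℤ, v = (g ^ y : Kˣ))
    (hx₁ : θ = (g ^ x₁ : Kˣ)) (hx₂ : θ ^ rep lam n b⁻¹ = (g ^ x₂ : Kˣ))
    (ξ : Fˣ) (hξ : ∀ y : Fˣ, y ∈ Subgroup.zpowers ξ) :
    PairModel {c | c ∈ A ⊔ A.map (multiplier lam n b :
        ConstacyclicRing lam n →ₗ[F] ConstacyclicRing lam n)}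
      (evalAt θ h.root) (evalAt (θ ^ rep lam n b⁻¹) h.root') g N s x₁ x₂
      (shift lam n) (scalar lam n ξ) where
  pos := hN
  zpow_eq_one := hg
  inj c hc c' hc' h₁ h₂ := by
    rw [← sub_eq_zero]
    exact h.eq_zero_of_eval (Submodule.sub_mem _ hc hc') (by rw [map_sub, h₁, sub_self])
      (by rw [map_sub, h₂, sub_self])
  surj v w hv hw := by
    have := h.finite
    obtain ⟨d, rfl⟩ := (exists_evalAt_eq_iff h.root h.pos h.period v).mpr ((hL v).mpr hv)
    obtain ⟨d', rfl⟩ := (exists_evalAt_eq_iff h.root h.pos h.period w).mpr ((hL w).mpr hw)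
    obtain ⟨c, hc, hcd⟩ := h.proj d
    obtain ⟨c', hc', hcd'⟩ := h.proj d'
    refine ⟨c + multiplier lam n b c', mem_sup_iff.mpr ⟨c, hc, c', hc', rfl⟩, ?_, ?_⟩
    · rw [map_add, h.eval₁_multiplier_eq_zero hc', add_zero, hcd]
    · rw [map_add, h.eval₂_multiplier_b, h.eval₂_eq_zero hc, zero_add, hcd']
  val₁ c _ := by
    have := h.finite
    exact (hL _).mp ((exists_evalAt_eq_iff h.root h.pos h.period _).mp ⟨c, rfl⟩)
  val₂ c hc := by
    have := h.finite
    obtain ⟨c₁, hc₁, c₂, hc₂, rfl⟩ := mem_sup_iff.mp hc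
    rw [map_add, h.eval₂_multiplier_b, h.eval₂_eq_zero hc₁, zero_add]
    exact (hL _).mp ((exists_evalAt_eq_iff h.root h.pos h.period _).mp ⟨c₂, rfl⟩)
  shift c hc := by
    refine ⟨h.shift_mem_sup hc, ?_, ?_⟩
    · change evalAt θ h.root (shift lam n c) = _
      rw [shift_apply, map_mul, evalAt_x θ h.root, ← hx₁]
    · change evalAt _ h.root' (shift lam n c) = _
      rw [shift_apply, map_mul, evalAt_x _ h.root', ← hx₂]
  scalar := by
    have hq1 : (Fintype.card F : ℤ) - 1 ≠ 0 := by
      have := Fintype.one_lt_card (α := F)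
      omega
    have hcard : ∀ v : F, (algebraMap F K v) ^ Fintype.card F = algebraMap F K v := by
      intro v
      rw [← map_pow, FiniteField.pow_card]
    refine ⟨Units.map (algebraMap F K : F →* K) ξ, ?_, ?_, fun c hc => ?_⟩
    -- Write ξ = g^y in K. From ξ^(q-1) = 1 and N = s(q - 1) it follows that s divides y.
    · obtain ⟨y, hy⟩ := ((hL (algebraMap F K ξ)).mp (by
        rw [← map_pow, FiniteField.pow_card_pow])).resolve_left
          (Units.map (algebraMap F K : F →* K) ξ).ne_zero
      have hy' : Units.map (algebraMap F K : F →* K) ξ = g ^ y := Units.ext hy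
      have h1 : g ^ (y * (Fintype.card F - 1 : ℤ)) = 1 := by
        rw [mul_sub, mul_one, zpow_sub, mul_inv_eq_one, zpow_mul, zpow_natCast, ← hy']
        exact Units.ext (hcard ξ)
      obtain ⟨t, ht⟩ := (hg _).mp h1
      refine ⟨t, ?_⟩
      rw [hy']
      congr 1
      apply mul_right_cancel₀ hq1
      rw [ht, hs]
      ring
    -- Conversely g^s is fixed by the Frobenius, so it lies in F and is a power of ξ.
    · have h1 : ((g ^ s : Kˣ) : K) ^ Fintype.card F = (g ^ s : Kˣ) := by
        rw [← Units.val_pow_eq_pow_val, Units.val_inj, ← zpow_natCast, ← zpow_mul,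
          ← mul_inv_eq_one, ← zpow_sub, hg, hs]
        exact ⟨1, by ring⟩
      obtain ⟨v, hv⟩ := mem_range_of_pow_card_eq h1
      have hv0 : v ≠ 0 := by
        rintro rfl
        rw [map_zero] at hv
        exact (g ^ s).ne_zero hv.symm
      obtain ⟨t, ht⟩ := (mem_powers_iff_mem_zpowers.mpr (hξ (Units.mk0 v hv0)) :
        Units.mk0 v hv0 ∈ Submonoid.powers ξ)
      refine ⟨t, Units.ext ?_⟩
      rw [← hv, ← map_pow]
      exact congrArg (fun y : Fˣ => algebraMap F K y) ht
    · refine ⟨scalar_mem_sup ξ hc, ?_, ?_⟩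
      · change evalAt θ h.root ((ξ : F) • c) = _
        rw [map_smul, Algebra.smul_def]
        rfl
      · change evalAt _ h.root' ((ξ : F) • c) = _
        rw [map_smul, Algebra.smul_def]
        rfl

end IsCodePair

end CodePair

/-! ### The size of a cyclotomic coset as the period of multiplication by q. -/

section Cosets

theorem cyclotomicCoset_card_dvd_iff {q N : ℕ} [NeZero N] (hq : q.Coprime N) (j : ZMod N) :
    0 < (cyclotomicCoset q j).card ∧
      ∀ t : ℕ, j * (q : ZMod N) ^ t = j ↔ (cyclotomicCoset q j).card ∣ t := by
  classical
  have hpos : 0 < orderOf (q : ZMod N) := by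
    obtain ⟨u, hu⟩ := (ZMod.isUnit_iff_coprime q N).mpr hq
    rw [← hu, orderOf_units]
    exact orderOf_pos u
  let f : ZMod N → ZMod N := fun i => i * (q : ZMod N)
  have hf : ∀ t : ℕ, f^[t] j = j * (q : ZMod N) ^ t := by
    intro t
    induction t with
    | zero => simp
    | succ t ih =>
      rw [Function.iterate_succ_apply', ih, pow_succ, ← mul_assoc]
  have hper : ∀ t : ℕ, j * (q : ZMod N) ^ t = j ↔ Function.minimalPeriod f j ∣ t := by
    intro t
    rw [← hf, ← Function.isPeriodicPt_iff_minimalPeriod_dvd]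
    rfl
  have hpp : 0 < Function.minimalPeriod f j := by
    refine Function.IsPeriodicPt.minimalPeriod_pos hpos ?_
    change f^[_] j = j
    rw [hf, pow_orderOf_eq_one, mul_one]
  have hset : cyclotomicCoset q j =
      (Finset.range (Function.minimalPeriod f j)).image fun t => f^[t] j := by
    ext z
    simp only [cyclotomicCoset, Finset.mem_image, Finset.mem_range]
    constructor
    · rintro ⟨t, -, rfl⟩
      exact ⟨t % Function.minimalPeriod f j, Nat.mod_lt _ hpp, by
        rw [Function.iterate_mod_minimalPeriod_eq, hf]⟩
    · rintro ⟨t, -, rfl⟩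
      exact ⟨t % orderOf (q : ZMod N), Nat.mod_lt _ hpos, by rw [pow_mod_orderOf, hf]⟩
  have hcard : (cyclotomicCoset q j).card = Function.minimalPeriod f j := by
    rw [hset, Finset.card_image_of_injOn, Finset.card_range]
    intro s hs t ht hst
    exact Function.iterate_injOn_Iio_minimalPeriod (Finset.mem_range.mp (Finset.mem_coe.mp hs))
      (Finset.mem_range.mp (Finset.mem_coe.mp ht)) hst
  rw [hcard]
  exact ⟨hpp, hper⟩

end Cosets

/-! ### Exponents of roots of unity. -/

section Roots

theorem zpow_eq_zpow_iff_intCast_eq {G : Type*} [Group G] {ζ : G} {R : ℕ} (hζ : orderOf ζ = R)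
    (z w : ℤ) : ζ ^ z = ζ ^ w ↔ (z : ZMod R) = w := by
  rw [zpow_eq_zpow_iff_modEq, hζ, ZMod.intCast_eq_intCast_iff]

theorem pow_val_intCast {G : Type*} [Group G] {ζ : G} {R : ℕ} [NeZero R] (hζ : orderOf ζ = R)
    (z : ℤ) : ζ ^ (z : ZMod R).val = ζ ^ z := by
  rw [← zpow_natCast, zpow_eq_zpow_iff_intCast_eq hζ]
  simp

/-- This rewrites a power of ζ = ω^W as a power of the generator g = ω^V of L^*: multiplied by RN,
both exponents of ω agree. -/
theorem zpow_div_eq {G : Type*} [Group G] (ω : G) {T R N W V : ℕ} (hR : T = R * W)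
    (hN : T = N * V) (hR0 : R ≠ 0) (hN0 : N ≠ 0) {z x : ℤ} (hx : R * x = z * N) :
    (ω ^ W) ^ z = (ω ^ V) ^ x := by
  rw [← zpow_natCast, ← zpow_natCast, ← zpow_mul, ← zpow_mul]
  congr 1
  have h : (R : ℤ) * W = N * V := by exact_mod_cast hR.symm.trans hN
  have hRN : (R : ℤ) * N ≠ 0 := mul_ne_zero (by exact_mod_cast hR0) (by exact_mod_cast hN0)
  apply mul_left_cancel₀ hRN
  linear_combination z * N * h - N * V * hx

theorem pow_succ_eq_self_iff {K : Type*} [Field K] {g : Kˣ} {N : ℕ} (hN : N ≠ 0)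
    (hg : orderOf g = N) (v : K) :
    v ^ (N + 1) = v ↔ v = 0 ∨ ∃ y : ℤ, v = (g ^ y : Kˣ) := by
  have hgN : (g : K) ^ N = 1 := by
    rw [← Units.val_pow_eq_pow_val, ← hg, pow_orderOf_eq_one, Units.val_one]
  constructor
  · intro h
    rw [or_iff_not_imp_left]
    intro hv
    have : NeZero N := ⟨hN⟩
    have hprim : IsPrimitiveRoot (g : K) N := by
      rw [IsPrimitiveRoot.coe_units_iff, ← hg]
      exact IsPrimitiveRoot.orderOf g
    have hv1 : v ^ N = 1 := by
      rw [pow_succ] at h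
      exact mul_right_cancel₀ hv (by rw [h, one_mul])
    obtain ⟨i, -, hi⟩ := hprim.eq_pow_of_pow_eq_one hv1
    exact ⟨i, by rw [← hi]; simp⟩
  · rintro (rfl | ⟨y, rfl⟩)
    · rw [zero_pow (Nat.succ_ne_zero _)]
    · have h1 : (g ^ y) ^ N = 1 := by
        rw [← zpow_natCast, ← zpow_mul, mul_comm, zpow_mul, zpow_natCast, ← hg,
          pow_orderOf_eq_one, one_zpow]
      rw [pow_succ, ← Units.val_pow_eq_pow_val, h1, Units.val_one, one_mul]

theorem pow_pow_card_eq_self_iff {K : Type*} [Field K] {g : Kˣ} {Q : ℕ} (hQ : 1 < Q)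
    (hg : orderOf g = Q - 1) (v : K) :
    v ^ Q = v ↔ v = 0 ∨ ∃ y : ℤ, v = (g ^ y : Kˣ) := by
  have h := pow_succ_eq_self_iff (Nat.sub_ne_zero_of_lt hQ) hg v
  rwa [Nat.sub_add_cancel hQ.le] at h

end Roots

/-! ### The ideal of a primitive idempotent as an instance of the abstract code pair. -/

section CodePair

variable {F : Type*} [Field F] [Fintype F] {lam : Fˣ} {n : ℕ} [NeZero n] {K : Type*} [Field K]
  [Algebra F K]

theorem isCodePair_span [Finite K] (hn : n.Coprime (Fintype.card F)) {ζ : Kˣ}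
    (hζ : orderOf ζ = orderOf lam * n) (hζn : (ζ : K) ^ n = algebraMap F K lam)
    (b : multiplierGroup lam n)
    (hu : (((b * b : multiplierGroup lam n) : (ZMod (orderOf lam * n))ˣ) :
      ZMod (orderOf lam * n)) = Fintype.card F)
    (b' : ℤ) (hb' : (b' : ZMod (orderOf lam * n)) = ((b⁻¹ : multiplierGroup lam n) :
      (ZMod (orderOf lam * n))ˣ))
    (m : ℕ) (hK : Nat.card K = Fintype.card F ^ m) (a : ℤ)
    (hbΓ : ((b' * (1 + orderOf lam * a) : ℤ) : ZMod (orderOf lam * n)) ∉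
      cyclotomicCoset (Fintype.card F)
        ((1 + orderOf lam * a : ℤ) : ZMod (orderOf lam * n))) :
    IsCodePair b (b * b) ((ζ ^ (1 + orderOf lam * a : ℤ) : Kˣ) : K)
      (cyclotomicCoset (Fintype.card F)
        ((1 + orderOf lam * a : ℤ) : ZMod (orderOf lam * n))).card m
      ((Ideal.span {primitiveIdempotent lam n (ζ : K)
        ((1 + orderOf lam * a : ℤ) : ZMod (orderOf lam * n))}).restrictScalars F) := by
  classical
  have hprim : IsPrimitiveRoot (ζ : K) (orderOf lam * n) := by
    rw [IsPrimitiveRoot.coe_units_iff, ← hζ]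
    exact IsPrimitiveRoot.orderOf ζ
  have hθ : ((ζ : K) ^ ((1 + orderOf lam * a : ℤ) : ZMod (orderOf lam * n)).val) =
      ((ζ ^ (1 + orderOf lam * a : ℤ) : Kˣ) : K) := by
    rw [← Units.val_pow_eq_pow_val, pow_val_intCast hζ]
  have hroot : ((ζ ^ (1 + orderOf lam * a : ℤ) : Kˣ) : K) ^ n = algebraMap F K lam := by
    have h1 : (ζ ^ (1 + orderOf lam * a : ℤ)) ^ n = ζ ^ n := by
      rw [← zpow_natCast, ← zpow_mul, ← zpow_natCast ζ n, zpow_eq_zpow_iff_intCast_eq hζ]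
      have h0 := ZMod.natCast_self (orderOf lam * n)
      push_cast at h0 ⊢
      linear_combination (a : ZMod (orderOf lam * n)) * h0
    rw [← Units.val_pow_eq_pow_val, h1, Units.val_pow_eq_pow_val, hζn]
  have hθpow : ∀ t : ℕ, ∀ z : ℤ, ((ζ ^ z : Kˣ) : K) =
      ((ζ ^ (1 + orderOf lam * a : ℤ) : Kˣ) : K) ^ Fintype.card F ^ t ↔
      (z : ZMod (orderOf lam * n)) = ((1 + orderOf lam * a : ℤ) : ZMod (orderOf lam * n)) *
        (Fintype.card F : ZMod (orderOf lam * n)) ^ t := by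
    intro t z
    rw [← Units.val_pow_eq_pow_val, Units.val_inj, ← zpow_natCast, ← zpow_mul,
      zpow_eq_zpow_iff_intCast_eq hζ]
    push_cast
    rfl
  obtain ⟨hpos, hper⟩ := cyclotomicCoset_card_dvd_iff (coprime_orderOf_mul lam hn)
    ((1 + orderOf lam * a : ℤ) : ZMod (orderOf lam * n))
  refine
    { root := hroot
      card_eq := hK
      ext_eval := fun c hc => eq_zero_of_evalAt_eq_zero hprim hζn hc
      sq_eq := rfl
      cast_eq := hu
      pos := hpos
      period := fun t => ?_
      mem_iff := fun c => ?_
      not_conj := ?_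
      proj := fun d => ?_ }
  · rw [← hper, eq_comm, hθpow, eq_comm]
  · rw [Submodule.restrictScalars_mem, ← hθ]
    exact mem_span_primitiveIdempotent_iff hn hprim hζn (hθ ▸ hroot) c
  · rintro ⟨t, ht⟩
    have h1 : ((ζ ^ (1 + orderOf lam * a : ℤ) : Kˣ) : K) ^ rep lam n b⁻¹ =
        ((ζ ^ (b' * (1 + orderOf lam * a) : ℤ) : Kˣ) : K) := by
      rw [← Units.val_pow_eq_pow_val, Units.val_inj, ← zpow_natCast, ← zpow_mul,
        zpow_eq_zpow_iff_intCast_eq hζ, Int.cast_mul, Int.cast_mul, Int.cast_natCast, cast_rep,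
        hb']
      exact mul_comm _ _
    rw [h1, hθpow] at ht
    refine hbΓ (ht ▸ Finset.mem_image.mpr
      ⟨t % orderOf (Fintype.card F : ZMod (orderOf lam * n)), ?_, by rw [pow_mod_orderOf]⟩)
    refine Finset.mem_range.mpr (Nat.mod_lt _ ?_)
    obtain ⟨v, hv⟩ := (ZMod.isUnit_iff_coprime _ _).mpr (coprime_orderOf_mul lam hn)
    rw [← hv, orderOf_units]
    exact orderOf_pos v
  · refine ⟨d * primitiveIdempotent lam n (ζ : K)
      ((1 + orderOf lam * a : ℤ) : ZMod (orderOf lam * n)), ?_, ?_⟩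
    · exact Ideal.mul_mem_left _ _ (Ideal.mem_span_singleton_self _)
    · rw [map_mul, evalAt_primitiveIdempotent hn hprim (hθ ▸ hroot), if_pos, mul_one]
      exact ⟨0, by rw [pow_zero, pow_one, hθ]⟩

end CodePair

end ConstacyclicRing

/-! ### The theorem itself. -/

open ConstacyclicRing in
theorem theorem3p6
    -- the finite field `F` with `q = p ^ e` elements, `e` even, and `ξ` generating `F^*`
    {F : Type*} [Field F] [Fintype F] (p e q : ℕ) (hp : p.Prime) (he : Even e)
    (hq : q = p ^ e) (hF : Fintype.card F = q)
    (ξ : Fˣ) (hξ : ∀ y : Fˣ, y ∈ Subgroup.zpowers ξ)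
    -- the length `n`, the constant `λ` of order `r`, and the order `m` of `q` modulo `r n`
    (n : ℕ) [NeZero n] (hn : 1 < n) (hnq : n.Coprime q)
    (lam : Fˣ) (r : ℕ) (hr : r = orderOf lam)
    (m : ℕ) (hm : m = orderOf (q : ZMod (orderOf lam * n)))
    -- the field `K` with `q ^ m` elements, its primitive element `ω`, and `ζ = ω ^ ((q ^ m - 1) / (r n))`
    {K : Type*} [Field K] [Fintype K] [Algebra F K] (hK : Fintype.card K = q ^ m)
    (ω : Kˣ) (hω : ∀ y : Kˣ, y ∈ Subgroup.zpowers ω)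
    (hlam : algebraMap F K lam = (ω : K) ^ ((q ^ m - 1) / r))
    (ζ : K) (hζ : ζ = (ω : K) ^ ((q ^ m - 1) / (r * n)))
    -- the element `b = (-1) ^ l₀ p ^ (e / 2)` of `ℤ_{rn}^* ∩ (1 + r ℤ_{rn})`
    (l₀ : ℕ) (hl₀ : l₀ = 0 ∨ l₀ = 1)
    (b : multiplierGroup lam n)
    (hb : ((b : (ZMod (orderOf lam * n))ˣ) : ZMod (orderOf lam * n)) =
      (-1) ^ l₀ * (p : ZMod (orderOf lam * n)) ^ (e / 2))
    -- an integer `b'` representing `b⁻¹ = (-1) ^ l₀ p ^ (-e / 2)`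
    (b' : ℤ) (hb' : (b' : ZMod (orderOf lam * n)) = (b⁻¹ : (ZMod (orderOf lam * n))ˣ))
    -- the `q`-cyclotomic coset `Γ` of `1 + r a`, of size `k`, and the idempotent code of `Γ`
    (a : ℤ) (Γ : Finset (ZMod (orderOf lam * n)))
    (hΓ : Γ = cyclotomicCoset q ((1 + r * a : ℤ) : ZMod (orderOf lam * n)))
    (k : ℕ) (hk : k = Γ.card)
    (hbΓ : ((b' * (1 + r * a) : ℤ) : ZMod (orderOf lam * n)) ∉ Γ)
    (A : Submodule F (ConstacyclicRing lam n))
    (hA : A = (Ideal.span {primitiveIdempotent lam n ζ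
      ((1 + r * a : ℤ) : ZMod (orderOf lam * n))}).restrictScalars F)
    (𝓒 : Submodule F (ConstacyclicRing lam n))
    (h𝓒 : 𝓒 = A ⊔ A.map (multiplier lam n b : ConstacyclicRing lam n →ₗ[F] ConstacyclicRing lam n)) :
    -- the sum defining `𝓒` is direct, and the group acts on `𝓒`
    Disjoint A (A.map (multiplier lam n b : ConstacyclicRing lam n →ₗ[F] ConstacyclicRing lam n)) ∧
    (∀ g ∈ autGroup lam n b ξ, ∀ c ∈ 𝓒, g c ∈ 𝓒) ∧
    -- the number of orbits
    (numOrbits (autGroup lam n b ξ) 𝓒 : ℚ) =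
      1 / k * ∑ h ∈ k.divisors, (Nat.totient (k / h) : ℚ) *
        gcd₃ (q ^ h - 1) ((q ^ k - 1) / (q - 1)) ((1 + r * a) * (q ^ k - 1) / (r * n))
      + 1 / (2 * m) * ∑ h ∈ Finset.range m,
        ((gcd₃ (q ^ Nat.gcd k (2 * h + 1) - 1) (2 * (q ^ k - 1) / (q - 1))
            ((b' + q ^ h) * (1 + r * a) * (q ^ k - 1) / (r * n)) : ℚ)
          + Int.gcd
              ((q ^ Nat.gcd k h - 1) *
                gcd₃ (q ^ Nat.gcd k h - 1) ((q ^ k - 1) / (q - 1))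
                  ((1 + r * a) * (q ^ k - 1) / (r * n)))
              ((b' - 1) * (1 + r * a) * (q ^ k - 1) ^ 2 / (r * n * (q - 1)))) ∧
    -- the bound on the number of nonzero weights, and the equality case
    numWeights 𝓒 ≤ numOrbits (autGroup lam n b ξ) 𝓒 ∧
    (numWeights 𝓒 = numOrbits (autGroup lam n b ξ) 𝓒 ↔
      ∀ c₁ ∈ 𝓒, ∀ c₂ ∈ 𝓒, c₁ ≠ 0 → c₂ ≠ 0 → weight c₁ = weight c₂ →
        ∃ j₁ < 2 * m, ∃ j₂ < n, ∃ j₃ < q - 1,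
          (multiplier lam n b ^ j₁ * shift lam n ^ j₂) ((ξ ^ j₃ : Fˣ) • c₁) = c₂) ∧
    -- the number of orbits is smaller than that of `⟨μ_q, ρ, σ_ξ⟩`, whose value is given as well;
    -- here `1 + r a₂` represents `b⁻¹ (1 + r a)`
    (∃ u : multiplierGroup lam n,
      ((u : (ZMod (orderOf lam * n))ˣ) : ZMod (orderOf lam * n)) = q ∧
      autGroup lam n u ξ ≤ autGroup lam n b ξ ∧
      numOrbits (autGroup lam n b ξ) 𝓒 < numOrbits (autGroup lam n u ξ) 𝓒 ∧
      ∀ a₂ : ℤ, ((1 + r * a₂ : ℤ) : ZMod (orderOf lam * n)) = ((b' * (1 + r * a) : ℤ) : ZMod _) →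
        (numOrbits (autGroup lam n u ξ) 𝓒 : ℚ) =
          1 / k * ∑ h ∈ k.divisors, (Nat.totient (k / h) : ℚ) *
            (gcd₃ (q ^ h - 1) ((q ^ k - 1) / (q - 1)) ((1 + r * a) * (q ^ k - 1) / (r * n))
              + gcd₃ (q ^ h - 1) ((q ^ k - 1) / (q - 1)) ((1 + r * a₂) * (q ^ k - 1) / (r * n))
              + Int.gcd
                  ((q ^ h - 1) *
                    Int.gcd
                      (gcd₃ (q ^ h - 1) ((q ^ k - 1) / (q - 1))
                        ((1 + r * a) * (q ^ k - 1) / (r * n)))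
                      ((1 + r * a₂) * (q ^ k - 1) / (r * n)))
                  ((a₂ - a) * (q ^ k - 1) ^ 2 / (n * (q - 1))))) := by
  classical
  subst hF hr hk hΓ hA h𝓒
  set q := Fintype.card F with hqF
  set R := orderOf lam * n with hR
  have hq1 : 1 < q := Fintype.one_lt_card
  have hq0 : 0 < q := Fintype.card_pos
  have hcop : q.Coprime R := coprime_orderOf_mul lam hnq
  have hR0 : R ≠ 0 := NeZero.ne _
  have hqm : (q : ZMod R) ^ m = 1 := by rw [hm, pow_orderOf_eq_one]
  have hm0 : 0 < m := by
    obtain ⟨v, hv⟩ := (ZMod.isUnit_iff_coprime q R).mpr hcop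
    rw [hm, ← hv, orderOf_units]
    exact orderOf_pos v
  have hcardK : Nat.card K = q ^ m := by rw [Nat.card_eq_fintype_card, hK]
  have hqm1 : 1 ≤ q ^ m := Nat.one_le_pow _ _ hq0
  have hω' : orderOf ω = q ^ m - 1 := by
    rw [orderOf_eq_card_of_forall_mem_zpowers hω, Nat.card_eq_fintype_card, Fintype.card_units, hK]
  obtain ⟨W, hW⟩ : R ∣ q ^ m - 1 := by
    rw [← ZMod.natCast_eq_zero_iff, Nat.cast_sub hqm1]
    push_cast
    rw [hqm, sub_self]
  have hT0 : q ^ m - 1 ≠ 0 := Nat.sub_ne_zero_of_lt (Nat.one_lt_pow hm0.ne' hq1)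
  have hW0 : W ≠ 0 := by
    rintro rfl
    exact hT0 hW
  have hWdiv : (q ^ m - 1) / R = W := by
    rw [hW, Nat.mul_div_cancel_left _ (Nat.pos_of_ne_zero hR0)]
  have hζω : orderOf (ω ^ W) = R := by
    rw [orderOf_pow_of_dvd hW0 (by rw [hω', hW]; exact dvd_mul_left _ _), hω', hW,
      Nat.mul_div_cancel _ (Nat.pos_of_ne_zero hW0)]
  have hζ' : ζ = ((ω ^ W : Kˣ) : K) := by
    rw [hζ, hWdiv, Units.val_pow_eq_pow_val]
  have hζn : ((ω ^ W : Kˣ) : K) ^ n = algebraMap F K lam := by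
    rw [hlam, ← Units.val_pow_eq_pow_val, ← pow_mul, Units.val_pow_eq_pow_val]
    congr 1
    rw [hW, hR, mul_assoc, Nat.mul_div_cancel_left _ (orderOf_pos lam), mul_comm]
  have hbb : (((b * b : multiplierGroup lam n) : (ZMod R)ˣ) : ZMod R) = q := by
    obtain ⟨f, rfl⟩ := he
    rw [Subgroup.coe_mul, Units.val_mul, hb, hq, ← two_mul f, Nat.mul_div_cancel_left f two_pos]
    push_cast
    rcases hl₀ with rfl | rfl <;> ring
  have hb'' : (b' : ZMod R) = ((b⁻¹ : multiplierGroup lam n) : (ZMod R)ˣ) := by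
    rw [hb']
    simp
  rw [hζ']
  have h := isCodePair_span hnq hζω hζn b hbb b' hb'' m hcardK a hbΓ
  set k := (cyclotomicCoset q ((1 + orderOf lam * a : ℤ) : ZMod R)).card with hk
  set A := (Ideal.span {primitiveIdempotent lam n ((ω ^ W : Kˣ) : K)
    ((1 + orderOf lam * a : ℤ) : ZMod R)}).restrictScalars F with hA
  set 𝓒 := A ⊔ A.map (multiplier lam n b : ConstacyclicRing lam n →ₗ[F] ConstacyclicRing lam n)
    with h𝓒
  have hk0 : 0 < k := h.pos
  have hqk : 1 < q ^ k := Nat.one_lt_pow hk0.ne' hq1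
  obtain ⟨V, hV⟩ : q ^ k - 1 ∣ q ^ m - 1 := Nat.pow_sub_one_dvd_pow_sub_one q h.dvd_m
  have hN0 : q ^ k - 1 ≠ 0 := Nat.sub_ne_zero_of_lt hqk
  have hV0 : V ≠ 0 := by
    rintro rfl
    exact hT0 hV
  have hg : orderOf (ω ^ V) = q ^ k - 1 := by
    rw [orderOf_pow_of_dvd hV0 (by rw [hω', hV]; exact dvd_mul_left _ _), hω', hV,
      Nat.mul_div_cancel _ (Nat.pos_of_ne_zero hV0)]
  have hNcast : ((q ^ k - 1 : ℕ) : ℤ) = (q : ℤ) ^ k - 1 := by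
    rw [Nat.cast_sub hqk.le]
    push_cast
    rfl
  have hNpos : 0 < (q : ℤ) ^ k - 1 := by
    rw [← hNcast]
    exact_mod_cast Nat.pos_of_ne_zero hN0
  have hgz : ∀ y : ℤ, (ω ^ V) ^ y = 1 ↔ (q : ℤ) ^ k - 1 ∣ y := by
    intro y
    rw [← hNcast, ← hg, orderOf_dvd_iff_zpow_eq_one]
  obtain ⟨s, hs⟩ : (q : ℤ) - 1 ∣ (q : ℤ) ^ k - 1 := sub_one_dvd_pow_sub_one _ _
  have hs' : (q : ℤ) ^ k - 1 = s * (q - 1) := by rw [hs, mul_comm]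
  have hqZ : (q : ℤ) - 1 ≠ 0 := by omega
  have hRZ : (orderOf lam : ℤ) * n ≠ 0 := by exact_mod_cast hR0
  have hRcast : (R : ℤ) = orderOf lam * n := by rw [hR]; push_cast; rfl
  have hperiod : ((1 + orderOf lam * a : ℤ) : ZMod R) * (q : ZMod R) ^ k =
      ((1 + orderOf lam * a : ℤ) : ZMod R) :=
    ((cyclotomicCoset_card_dvd_iff hcop _).2 k).mpr dvd_rfl
  obtain ⟨x₁, hx₁⟩ : (orderOf lam : ℤ) * n ∣ (1 + orderOf lam * a) * ((q : ℤ) ^ k - 1) := by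
    rw [← hRcast, ← ZMod.intCast_zmod_eq_zero_iff_dvd, Int.cast_mul]
    push_cast at hperiod ⊢
    linear_combination hperiod
  have hθ₁ : (((ω ^ W) ^ (1 + orderOf lam * a : ℤ) : Kˣ) : K) = ((ω ^ V) ^ x₁ : Kˣ) := by
    rw [zpow_div_eq ω hW hV hR0 hN0 (x := x₁) (by rw [hRcast, ← hx₁, hNcast])]
  -- Any integer representing b⁻¹(1+ra) may serve as exponent of the second root. The first formula
  -- takes b'(1+ra), the last one 1+ra₂.
  have hη : ∀ z : ℤ, (z : ZMod R) = ((b' * (1 + orderOf lam * a) : ℤ) : ZMod R) →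
      (((ω ^ W) ^ (1 + orderOf lam * a : ℤ) : Kˣ) : K) ^ rep lam n b⁻¹ = ((ω ^ W) ^ z : Kˣ) := by
    intro z hz
    rw [← Units.val_pow_eq_pow_val, Units.val_inj, ← zpow_natCast, ← zpow_mul,
      zpow_eq_zpow_iff_intCast_eq hζω, hz, Int.cast_mul, Int.cast_mul, Int.cast_natCast, cast_rep,
      hb'']
    exact mul_comm _ _
  have hL : ∀ v : K, v ^ q ^ k = v ↔ v = 0 ∨ ∃ y : ℤ, v = ((ω ^ V) ^ y : Kˣ) :=
    pow_pow_card_eq_self_iff hqk hg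
  have hset : {c | c ∈ 𝓒 ∧ c ≠ 0} = {c | c ∈ {c | c ∈ 𝓒} ∧
      ¬(evalAt _ h.root c = 0 ∧ evalAt _ h.root' c = 0)} := by
    ext c
    refine and_congr_right fun hc => not_congr ⟨?_, fun hc' => h.eq_zero_of_eval hc hc'.1 hc'.2⟩
    rintro rfl
    exact ⟨map_zero _, map_zero _⟩
  have hle : autGroup lam n (b * b) ξ ≤ autGroup lam n b ξ := by
    rw [autGroup, Subgroup.closure_le]
    rintro _ (rfl | rfl | rfl)
    · rw [← multiplier_mul]
      exact mul_mem (Subgroup.subset_closure (by simp)) (Subgroup.subset_closure (by simp))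
    · exact Subgroup.subset_closure (by simp)
    · exact Subgroup.subset_closure (by simp)
  have hbm : b ^ (2 * m) = 1 := by
    rw [pow_mul, pow_two]
    refine Subtype.ext (Units.ext ?_)
    rw [Subgroup.coe_pow, Units.val_pow_eq_pow_val, hbb, hqm]
    rfl
  have hξ' : orderOf ξ = q - 1 := by
    rw [orderOf_eq_card_of_forall_mem_zpowers hξ, Nat.card_eq_fintype_card, Fintype.card_units]
  have hweights := ncard_image_le_ncard_image
    (fun c : ConstacyclicRing lam n => MulAction.orbit (autGroup lam n b ξ) c) weight
    {c | c ∈ 𝓒 ∧ c ≠ 0} (fun c _ d _ hcd => by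
      obtain ⟨⟨φ, hφ⟩, hφd⟩ := MulAction.orbit_eq_iff.mp hcd
      rw [← hφd]
      exact weight_of_mem_autGroup hφ d)
  refine ⟨h.disjoint, fun φ hφ c hc => h.autGroup_mem_sup ξ hφ hc, ?_, hweights.1, ?_,
    b * b, hbb, hle, ?_, ?_⟩
  · have hmodel := h.pairModel (ω ^ V) ((q : ℤ) ^ k - 1) s x₁ (b' * x₁) hNpos hs' hgz hL hθ₁ (by
      rw [hη _ rfl, zpow_div_eq ω hW hV hR0 hN0 (x := b' * x₁)]
      rw [hRcast, hNcast]
      linear_combination -b' * hx₁) ξ hξ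
    -- Since rn·x₁ = (1+ra)N, congruences modulo rn become congruences modulo N after multiplication
    -- by x₁. With q/b = b and b·b⁻¹ = 1 this yields the two divisibility conditions on β.
    have hcast : ∀ z : ℤ, (z : ZMod R) = 0 → (q : ℤ) ^ k - 1 ∣ z * x₁ := by
      intro z hz
      obtain ⟨w, rfl⟩ := (ZMod.intCast_zmod_eq_zero_iff_dvd _ _).mp hz
      rw [hRcast]
      exact ⟨w * (1 + orderOf lam * a), by linear_combination -w * hx₁⟩
    have hbrep : ((rep lam n b : ℕ) : ZMod R) = ((b : (ZMod R)ˣ) : ZMod R) := cast_rep lam n b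
    have hbinv : (b' : ZMod R) * ((b : (ZMod R)ˣ) : ZMod R) = 1 := by
      rw [hb', ← Units.val_mul]
      simp
    have hbsq : ((b : (ZMod R)ˣ) : ZMod R) * ((b : (ZMod R)ˣ) : ZMod R) = q := by
      rw [← hbb, Subgroup.coe_mul, Units.val_mul]
    have hcount := hmodel.ncard_orbits_twisted (multiplier lam n b) hq1
      (fun c hc => ⟨h.multiplier_b_mem_sup hc, h.eval₁_multiplier_b c, h.eval₂_multiplier_b c⟩)
      hk0 hm0 h.dvd_m rfl hs' (b' := b') (β := rep lam n b) rfl (by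
        have := hcast (q * b' - rep lam n b) (by
          push_cast
          rw [hbrep, ← hbsq]
          linear_combination ((b : (ZMod R)ˣ) : ZMod R) * hbinv)
        convert this using 1
        ring) (by
        have := hcast (1 - rep lam n b * b') (by
          push_cast
          rw [hbrep]
          linear_combination -hbinv)
        convert this using 1
        ring)
    -- The quotients in the statement are integer divisions, so each is shown to be exact before it
    -- is identified with the lattice data.
    have e₁ : ((q : ℤ) ^ k - 1) / (q - 1) = s := Int.ediv_eq_of_eq_mul_right hqZ hs
    have e₂ : 2 * ((q : ℤ) ^ k - 1) / (q - 1) = 2 * s :=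
      Int.ediv_eq_of_eq_mul_right hqZ (by rw [hs]; ring)
    have e₃ : (1 + (orderOf lam : ℤ) * a) * ((q : ℤ) ^ k - 1) / (orderOf lam * n) = x₁ :=
      Int.ediv_eq_of_eq_mul_right hRZ hx₁
    have e₄ : ∀ i : ℕ, (b' + (q : ℤ) ^ i) * (1 + orderOf lam * a) * ((q : ℤ) ^ k - 1) /
        (orderOf lam * n) = b' * x₁ + q ^ i * x₁ := fun i =>
      Int.ediv_eq_of_eq_mul_right hRZ (by linear_combination (b' + (q : ℤ) ^ i) * hx₁)
    have e₅ : (b' - 1) * (1 + (orderOf lam : ℤ) * a) * ((q : ℤ) ^ k - 1) ^ 2 /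
        (orderOf lam * n * (q - 1)) = s * (b' * x₁ - x₁) :=
      Int.ediv_eq_of_eq_mul_right (mul_ne_zero hRZ hqZ) (by
        linear_combination (b' - 1) * ((q : ℤ) ^ k - 1) * hx₁ +
          (b' - 1) * (orderOf lam * n) * x₁ * hs)
    rw [numOrbits, hset, autGroup, hcount]
    simp only [e₁, e₂, e₃, e₄, e₅]
  · refine hweights.2.trans ⟨fun hw c₁ hc₁ c₂ hc₂ h₁ h₂ hw' => ?_,
      fun hw c₁ hc₁ c₂ hc₂ hw' => ?_⟩
    · obtain ⟨⟨φ, hφ⟩, hφc⟩ := MulAction.orbit_eq_iff.mp (hw c₁ ⟨hc₁, h₁⟩ c₂ ⟨hc₂, h₂⟩ hw').symm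
      obtain ⟨j₁, hj₁, j₂, hj₂, j₃, hj₃, hj⟩ :=
        exists_reduced_of_mem_autGroup hξ (by omega) hbm hξ' hφ
      exact ⟨j₁, hj₁, j₂, hj₂, j₃, hj₃, (hj c₁).trans hφc⟩
    · obtain ⟨j₁, -, j₂, -, j₃, -, hj⟩ := hw c₁ hc₁.1 c₂ hc₂.1 hc₁.2 hc₂.2 hw'
      refine (MulAction.orbit_eq_iff.mpr ⟨⟨_, (mem_autGroup_iff b ξ _).mpr ⟨j₁, j₂, j₃, rfl⟩⟩,
        ?_⟩).symm
      rw [← hj]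
      exact congrArg (fun φ : ConstacyclicRing lam n ≃ₗ[F] ConstacyclicRing lam n =>
        (multiplier lam n b ^ j₁ * shift lam n ^ j₂) (φ c₁)) (scalar_pow ξ j₃)
  · have horb := ncard_image_le_ncard_image
      (fun c : ConstacyclicRing lam n => MulAction.orbit (autGroup lam n (b * b) ξ) c)
      (fun c : ConstacyclicRing lam n => MulAction.orbit (autGroup lam n b ξ) c)
      {c | c ∈ 𝓒 ∧ c ≠ 0} (fun c _ d _ hcd => by
        obtain ⟨⟨φ, hφ⟩, hφd⟩ := MulAction.orbit_eq_iff.mp hcd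
        exact MulAction.orbit_eq_iff.mpr ⟨⟨φ, hle hφ⟩, hφd⟩)
    refine lt_of_le_of_ne horb.1 fun heq => ?_
    -- A nonzero c in A and its image μ_b c lie in one orbit of the larger group. If the counts
    -- agreed, they would share an orbit of ⟨μ_q, ρ, σ_ξ⟩, which preserves A, and μ_b c would lie in
    -- both summands.
    obtain ⟨c, hc, hc1⟩ := h.proj 1
    have hc0 : c ≠ 0 := by
      rintro rfl
      rw [map_zero, map_one] at hc1
      exact zero_ne_one hc1
    have hbc : multiplier lam n b c ∈ 𝓒 := h.multiplier_b_mem_sup (Submodule.mem_sup_left hc)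
    have hbc0 : multiplier lam n b c ≠ 0 := (multiplier lam n b).map_ne_zero_iff.mpr hc0
    have h1 := horb.2.mp heq _ ⟨hbc, hbc0⟩ c ⟨Submodule.mem_sup_left hc, hc0⟩
      (MulAction.orbit_eq_iff.mpr ⟨⟨multiplier lam n b, Subgroup.subset_closure (by simp)⟩, rfl⟩)
    obtain ⟨⟨φ, hφ⟩, hφc⟩ := MulAction.orbit_eq_iff.mp h1
    have hbA : multiplier lam n b c ∈ A := by
      rw [← hφc]
      exact h.autGroup_u_mem ξ hφ hc
    exact hbc0 ((Submodule.disjoint_def.mp h.disjoint) _ hbA ⟨c, hc, rfl⟩)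
  · intro a₂ ha₂
    have hcop' : (orderOf lam : ℤ) ≠ 0 := by exact_mod_cast (orderOf_pos lam).ne'
    obtain ⟨x₂, hx₂⟩ : (orderOf lam : ℤ) * n ∣ (1 + orderOf lam * a₂) * ((q : ℤ) ^ k - 1) := by
      rw [← hRcast, ← ZMod.intCast_zmod_eq_zero_iff_dvd, Int.cast_mul, ha₂]
      push_cast at hperiod ⊢
      linear_combination (b' : ZMod R) * hperiod
    have hmodel := h.pairModel (ω ^ V) ((q : ℤ) ^ k - 1) s x₁ x₂ hNpos hs' hgz hL hθ₁ (by
      rw [hη _ ha₂, zpow_div_eq ω hW hV hR0 hN0 (x := x₂)]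
      rw [hRcast, hNcast, hx₂]) ξ hξ
    have hcount := hmodel.ncard_orbits_frobenius (multiplier lam n (b * b)) hq1
      (fun c hc => ⟨h.multiplier_u_mem_sup hc, h.evalAt_multiplier_u _ h.root c,
        h.evalAt_multiplier_u _ h.root' c⟩) hk0 rfl
    have e₁ : ((q : ℤ) ^ k - 1) / (q - 1) = s := Int.ediv_eq_of_eq_mul_right hqZ hs
    have e₂ : (1 + (orderOf lam : ℤ) * a) * ((q : ℤ) ^ k - 1) / (orderOf lam * n) = x₁ :=
      Int.ediv_eq_of_eq_mul_right hRZ hx₁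
    have e₃ : (1 + (orderOf lam : ℤ) * a₂) * ((q : ℤ) ^ k - 1) / (orderOf lam * n) = x₂ :=
      Int.ediv_eq_of_eq_mul_right hRZ hx₂
    have hn0 : (n : ℤ) ≠ 0 := by exact_mod_cast NeZero.ne n
    have e₄ : (a₂ - a) * ((q : ℤ) ^ k - 1) ^ 2 / (n * (q - 1)) = s * (x₂ - x₁) := by
      -- Subtracting the equations defining x₁ and x₂ leaves a common factor r, whose cancellation
      -- explains the denominator n(q-1) in place of rn(q-1).
      have h1 : (a₂ - a) * ((q : ℤ) ^ k - 1) = n * (x₂ - x₁) := by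
        apply mul_left_cancel₀ hcop'
        linear_combination hx₂ - hx₁
      refine Int.ediv_eq_of_eq_mul_right (mul_ne_zero hn0 hqZ) ?_
      linear_combination ((q : ℤ) ^ k - 1) * h1 + n * (x₂ - x₁) * hs
    rw [numOrbits, hset, autGroup, hcount]
    simp only [e₁, e₂, e₃, e₄]
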